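/- Let $n\ge 3$, let $(M,g)$ be a smooth Riemannian $n$-manifold, and let $S=\partial_\infty M$ be a closed $(n-1)$-manifold. Suppose that a neighbourhood of infinity in $M$ is diffeomorphic to $(0,\varepsilon)\times S$ in such a way that attaching $S$ at $x=0$ gives a manifold with boundary $S$ and that there $$g=x^{-2}\left(dx^2\oplus h_x\right),$$ i.e. $x$ is a special defining function. Here $h_x$, $0\le x<\varepsilon$, are smooth Riemannian metrics on $S$, and $h_x$ has a polyhomogeneous expansion at $x=0$ through order $x^n$, that is, locally on $S$ $$h_x=\sum_{k=0}^{n}\sum_{l=0}^{L}x^k(\log x)^l a_{k,l}+o(x^n),\qquad a_{0,0}=h_{x}|_{x=0},\quad a_{0,l}=0\ (l\ge1),$$ with $C^2$ coefficient tensors $a_{k,l}$ on $S$, and the expansion may be differentiated termwise twice. (If $x^2g$ extends smoothly to $x=0$ this holds without logarithms.) Suppose that $g$ is Poincaré–Einstein, $\mathrm{Ric}(g)+(n-1)g=0$, or only that $$|\mathrm{Ric}(g)+(n-1)g|_g=O(x^{n+1})\quad\text{as }x\to0 .$$ Suppose finally that the conformal class of $h_x|_{x=0}$ on $S$ contains a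 metric $h_0$ with $\mathrm{Ric}(h_0)=(n-2)\lambda h_0$ for a constant $\lambda\in\mathbb R$. (a) ($n$ even or odd.) If $x$ is the special defining function belonging to $h_0$, i.e. $h_x|_{x=0}=h_0$, then there are 2-tensor fields $\theta,\kappa$ on $S$ with $$h_x=\left(1-\tfrac{\lambda}{4}x^2\right)^2h_0+\tfrac{x^{n-1}}{n-1}\theta+\tfrac{x^n}{n}\kappa+o(x^n)\quad\text{pointwise on }S,$$ and for all $\theta,\kappa$ with this property $\kappa$ vanishes identically (in particular it does not depend on the Neumann datum $\theta$), and the Wang mass of $(M,g)$ is zero: $$m=\int_S \mathrm{tr}_{h_0}\kappa\; dV(h_0)=0 .$$ (b) If $n$ is odd, then the same holds for every special defining function $x$ as above, whether or not the metric $\hat h_0:=h_x|_{x=0}$, conformal to $h_0$, is itself Einstein: whenever $h_x=\sum_{k=0}^{n-1}x^kb_k+\frac{x^n}{n}\kappa+o(x^n)$ pointwise on $S$ with 2-tensor fields $b_k,\kappa$, then $\mathrm{tr}_{\hat h_0}\kappa=0$ everywhere on $S$ and $\int_S\mathrm{tr}_{\hat h_0}\kappa\;dV(\hat h_0)=0$.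 -/

import Mathlib

open Set Filter Topology MeasureTheory Asymptotics
open scoped Manifold ContDiff

noncomputable section

namespace WangMass

/-! ### Riemannian metrics and 2-tensors, in coordinates -/

/-- The model space `ℝᵐ`. -/
abbrev Model (m : ℕ) : Type := EuclideanSpace ℝ (Fin m)

/-- Smooth Riemannian metrics on an `m`-manifold `X` without boundary. -/
abbrev Metric (m : ℕ) (X : Type*) [TopologicalSpace X] [ChartedSpace (Model m) X]
    [IsManifold (𝓡 m) ∞ X] : Type _ :=
  Bundle.ContMDiffRiemannianMetric (𝓡 m) ∞ (Model m) (fun p : X => TangentSpace (𝓡 m) p)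

/-- Covariant 2-tensor fields on `X` (no regularity). -/
abbrev Tensor2 (m : ℕ) (X : Type*) [TopologicalSpace X] [ChartedSpace (Model m) X] : Type _ :=
  ∀ p : X, TangentSpace (𝓡 m) p →L[ℝ] TangentSpace (𝓡 m) p →L[ℝ] ℝ

section Coordinates

variable {m : ℕ} {X : Type*} [TopologicalSpace X] [ChartedSpace (Model m) X]

/-- The `i`-th vector of the standard basis of `ℝᵐ`. -/
def stdVec (m : ℕ) (i : Fin m) : Model m := EuclideanSpace.single i 1

/-- The coordinate vector field `∂ᵢ` of the chart `φ`, at the point with coordinates `u`. -/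
def coordVec (φ : OpenPartialHomeomorph X (Model m)) (i : Fin m) (u : Model m) :
    TangentSpace (𝓡 m) (φ.symm u) :=
  mfderiv (𝓡 m) (𝓡 m) φ.symm u (stdVec m i)

/-- The component matrix `T(∂ᵢ, ∂ⱼ)` of a 2-tensor field in the chart `φ`. -/
def comps (φ : OpenPartialHomeomorph X (Model m)) (T : Tensor2 m X) (u : Model m) :
    Matrix (Fin m) (Fin m) ℝ :=
  Matrix.of fun i j => T (φ.symm u) (coordVec φ i u) (coordVec φ j u)

end Coordinates

/-- The partial derivative `∂ᵢ f` on `ℝᵐ`. -/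
def pd {m : ℕ} (i : Fin m) (f : Model m → ℝ) (u : Model m) : ℝ := fderiv ℝ f u (stdVec m i)

/-- The Christoffel symbol `Γᵏᵢⱼ` of a matrix-valued function `G` on `ℝᵐ`. -/
def christoffel {m : ℕ} (G : Model m → Matrix (Fin m) (Fin m) ℝ) (k i j : Fin m) (u : Model m) :
    ℝ :=
  (1 / 2) * ∑ l, (G u)⁻¹ k l *
    (pd i (fun v => G v j l) u + pd j (fun v => G v i l) u - pd l (fun v => G v i j) u)

/-- The Ricci tensor of the metric with components `G`,
`Rᵢⱼ = ∂ₖ Γᵏᵢⱼ - ∂ⱼ Γᵏᵢₖ + Γᵏₖₗ Γˡᵢⱼ - Γᵏⱼₗ Γˡᵢₖ` (positive on round spheres). -/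
def ricciComps {m : ℕ} (G : Model m → Matrix (Fin m) (Fin m) ℝ) (u : Model m) :
    Matrix (Fin m) (Fin m) ℝ :=
  Matrix.of fun i j =>
    (∑ k, (pd k (christoffel G k i j) u - pd j (christoffel G k i k) u)) +
    ∑ k, ∑ l, (christoffel G k k l u * christoffel G l i j u -
      christoffel G k j l u * christoffel G l i k u)

section Curvature

variable {m : ℕ} {X : Type*} [TopologicalSpace X] [ChartedSpace (Model m) X]
  [IsManifold (𝓡 m) ∞ X]

/-- The Einstein equation `Ric(g) = c g`, in all smooth charts. -/
def IsEinstein (g : Metric m X) (c : ℝ) : Prop :=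
  ∀ φ ∈ IsManifold.maximalAtlas (𝓡 m) ∞ X, ∀ u ∈ φ.target,
    ricciComps (comps φ g.inner) u = c • comps φ g.inner u

/-- A metric on an `m`-manifold is Poincaré-Einstein (as far as the field equation goes) if
`Ric(g) = -(m - 1) g`. -/
def IsPoincareEinstein (g : Metric m X) : Prop := IsEinstein g (-((m : ℝ) - 1))

/-- The components in the chart `φ` of `E = Ric(g) + (m - 1) g`. -/
def defectComps (g : Metric m X) (φ : OpenPartialHomeomorph X (Model m)) (u : Model m) :
    Matrix (Fin m) (Fin m) ℝ :=
  ricciComps (comps φ g.inner) u + ((m : ℝ) - 1) • comps φ g.inner u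

/-- The pointwise norm `|E|_g = (gⁱᵏ gʲˡ Eᵢⱼ Eₖₗ)^(1/2)`, computed in the chart `φ` (the value does
not depend on the chart). -/
def defectNorm (g : Metric m X) (φ : OpenPartialHomeomorph X (Model m)) (u : Model m) : ℝ :=
  Real.sqrt (∑ i, ∑ j, ∑ k, ∑ l, (comps φ g.inner u)⁻¹ i k * (comps φ g.inner u)⁻¹ j l *
    defectComps g φ u i j * defectComps g φ u k l)

/-- Two metrics are conformal: `g' = e^{2f} g` with `f` smooth. -/
def IsConformal (g g' : Metric m X) : Prop :=
  ∃ f : X → ℝ, ContMDiff (𝓡 m) 𝓘(ℝ, ℝ) ∞ f ∧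
    ∀ (p : X) (v w : TangentSpace (𝓡 m) p),
      g'.inner p v w = Real.exp (2 * f p) * g.inner p v w

/-- The trace `tr_g T = gⁱʲ Tᵢⱼ` at `p`, computed in the standard basis of `T_p X = ℝᵐ`. -/
def metricTrace (g : Metric m X) (T : Tensor2 m X) (p : X) : ℝ :=
  ∑ i, ∑ j, (Matrix.of fun i j : Fin m => g.inner p (stdVec m i) (stdVec m j))⁻¹ i j *
    T p (stdVec m i) (stdVec m j)

end Curvature

/-! ### The Riemannian volume measure -/

section Volume

variable {m : ℕ} {X : Type*} [TopologicalSpace X] [ChartedSpace (Model m) X]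
  [IsManifold (𝓡 m) ∞ X] [MeasurableSpace X]

/-- The volume measure of `g` on the domain of the chart `φ`: the image under `φ⁻¹` of
`√(det gᵢⱼ) du`. -/
def chartVolume (g : Metric m X) (φ : OpenPartialHomeomorph X (Model m)) : Measure X :=
  (((volume : Measure (Model m)).restrict φ.target).withDensity
    (fun u => ENNReal.ofReal (Real.sqrt (comps φ g.inner u).det))).map φ.symm

/-- The Riemannian volume measure `dV(g)`, glued from the chart volumes by a smooth partition of
unity subordinate to the chart domains. -/
def riemannianVolume [T2Space X] [SigmaCompactSpace X] (g : Metric m X) : Measure X :=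
  Measure.sum fun p : X => (chartVolume g (chartAt (Model m) p)).withDensity fun q =>
    ENNReal.ofReal
      (Classical.choose
        (SmoothPartitionOfUnity.exists_isSubordinate_chartAt_source (𝓡 m) X) p q)

/-- The mass integral `∫ tr_{h₀} κ dV(h₀)`; the integrand is the mass aspect. -/
def massIntegral [T2Space X] [SigmaCompactSpace X] (h₀ : Metric m X) (κ : Tensor2 m X) : ℝ :=
  ∫ p, metricTrace h₀ κ p ∂(riemannianVolume h₀)

end Volume

/-- `|Ric(g) + (n - 1) g|_g = O(xᵏ)` at conformal infinity, for the collar `Φ`. -/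
def IsPoincareEinsteinToOrder {d : ℕ} {M : Type*} [TopologicalSpace M]
    [ChartedSpace (Model (d + 1)) M] [IsManifold (𝓡 (d + 1)) ∞ M] {S : Type*} [TopologicalSpace S]
    (g : Metric (d + 1) M) (Φ : OpenPartialHomeomorph (ℝ × S) M) (k : ℕ) : Prop :=
  ∃ C : ℝ, ∃ δ > 0, ∀ z ∈ Φ.source, z.1 < δ →
    ∀ φ ∈ IsManifold.maximalAtlas (𝓡 (d + 1)) ∞ M, Φ z ∈ φ.source →
      defectNorm g φ (φ (Φ z)) ≤ C * z.1 ^ k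

/-- Poincaré-Einstein metrics satisfy the decay condition to every order. -/
theorem IsPoincareEinstein.toOrder {d : ℕ} {M : Type*} [TopologicalSpace M]
    [ChartedSpace (Model (d + 1)) M] [IsManifold (𝓡 (d + 1)) ∞ M] {S : Type*} [TopologicalSpace S]
    {g : Metric (d + 1) M} (hg : IsPoincareEinstein g)
    (Φ : OpenPartialHomeomorph (ℝ × S) M) (k : ℕ) : IsPoincareEinsteinToOrder g Φ k := by
  refine ⟨0, 1, one_pos, fun z _ _ φ hφ hz => ?_⟩
  have h0 : defectComps g φ (φ (Φ z)) = 0 := by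
    rw [defectComps, hg φ hφ _ (φ.map_source hz), ← add_smul, neg_add_cancel, zero_smul]
  simp [defectNorm, h0]

/-! ### Metrics in normal form near conformal infinity

The bulk `M` has dimension `n = d + 1`; the boundary at infinity `S` has dimension `d = n - 1`. -/

section NormalForm

variable {d : ℕ}
  {M : Type*} [TopologicalSpace M] [ChartedSpace (Model (d + 1)) M] [IsManifold (𝓡 (d + 1)) ∞ M]
  {S : Type*} [TopologicalSpace S] [ChartedSpace (Model d) S] [IsManifold (𝓡 d) ∞ S]

/-- `Φ` is a diffeomorphism of `(0, ε) × S` onto an open subset of `M` in which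
`g = x⁻² (dx² ⊕ h_x)`, the coordinate `x` being the special defining function. The sets
`Φ((0, δ] × S)` are closed in `M`: points with `x → 0` leave every compact subset of `M`, so that
attaching `S` to `M` along `x = 0` gives a manifold with boundary `S = ∂_∞ M`. -/
structure IsNormalForm (g : Metric (d + 1) M) (ε : ℝ) (Φ : OpenPartialHomeomorph (ℝ × S) M)
    (h : ℝ → Metric d S) : Prop where
  pos : 0 < ε
  source_eq : Φ.source = Ioo 0 ε ×ˢ univ
  smooth : ContMDiffOn (𝓘(ℝ, ℝ).prod (𝓡 d)) (𝓡 (d + 1)) ∞ Φ Φ.source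
  smooth_symm : ContMDiffOn (𝓡 (d + 1)) (𝓘(ℝ, ℝ).prod (𝓡 d)) ∞ Φ.symm Φ.target
  isClosed_image : ∀ δ ∈ Ioo 0 ε, IsClosed (Φ '' (Ioc 0 δ ×ˢ univ))
  metric_eq : ∀ x ∈ Ioo 0 ε, ∀ (y : S) (a b : ℝ) (v w : TangentSpace (𝓡 d) y),
    g.inner (Φ (x, y))
        (mfderiv (𝓘(ℝ, ℝ).prod (𝓡 d)) (𝓡 (d + 1)) Φ (x, y)
          ((a, v) : TangentSpace (𝓘(ℝ, ℝ).prod (𝓡 d)) (x, y)))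
        (mfderiv (𝓘(ℝ, ℝ).prod (𝓡 d)) (𝓡 (d + 1)) Φ (x, y)
          ((b, w) : TangentSpace (𝓘(ℝ, ℝ).prod (𝓡 d)) (x, y))) =
      (x ^ 2)⁻¹ * (a * b + (h x).inner y v w)

/-- `h_x` extends to `x = 0` by `h_0` and is polyhomogeneous there up to order `x^N`: locally on
`S`, `h_x = ∑_{k ≤ N} ∑_{l ≤ L} x^k (log x)^l a_{k,l} + o(x^N)`, where the `x⁰` part is `h_0` alone
and the expansion may be differentiated termwise twice. Smooth families satisfy this (Taylor's
formula, no logarithms). -/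
def IsPolyhomogeneous (N : ℕ) (h : ℝ → Metric d S) : Prop :=
  ∃ (L : ℕ) (a : ℕ → ℕ → Tensor2 d S),
    a 0 0 = (h 0).inner ∧ (∀ l, 0 < l → a 0 l = 0) ∧
    ∀ φ ∈ IsManifold.maximalAtlas (𝓡 d) ∞ S, ∀ i j : Fin d,
      (∀ k l, ContDiffOn ℝ 2 (fun u => comps φ (a k l) u i j) φ.target) ∧
      ∀ u₀ ∈ φ.target, ∀ r s : ℕ, r + s ≤ 2 →
        (fun z : ℝ × Model d => z.1 ^ r *
          ‖iteratedFDeriv ℝ s (fun u => iteratedDeriv r (fun x =>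
              comps φ (h x).inner u i j -
                ∑ k ∈ Finset.range (N + 1), ∑ l ∈ Finset.range (L + 1),
                  x ^ k * Real.log x ^ l * comps φ (a k l) u i j) z.1) z.2‖)
          =o[𝓝[>] 0 ×ˢ 𝓝 u₀] fun z => z.1 ^ N

/-- The expansion
`h_x = (1 - λ x² / 4)² h₀ + x^(n-1) / (n-1) θ + x^n / n κ + o(x^n)`, with `n = d + 1`. -/
def HasEinsteinExpansion (h : ℝ → Metric d S) (h₀ : Metric d S) (lam : ℝ) (θ κ : Tensor2 d S) :
    Prop :=
  ∀ (y : S) (v w : TangentSpace (𝓡 d) y),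
    (fun x : ℝ => (h x).inner y v w - ((1 - lam / 4 * x ^ 2) ^ 2 * h₀.inner y v w +
        x ^ d / (d : ℝ) * θ y v w + x ^ (d + 1) / ((d : ℝ) + 1) * κ y v w))
      =o[𝓝[>] 0] fun x => x ^ (d + 1)

/-- `κ / n` is the coefficient of `x^n`, `n = d + 1`, in an expansion
`h_x = b₀ + x b₁ + ⋯ + x^(n-1) b_(n-1) + x^n / n κ + o(x^n)`. -/
def HasPowerExpansion (h : ℝ → Metric d S) (κ : Tensor2 d S) : Prop :=
  ∃ b : ℕ → Tensor2 d S, ∀ (y : S) (v w : TangentSpace (𝓡 d) y),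
    (fun x : ℝ => (h x).inner y v w - (∑ k ∈ Finset.range (d + 1), x ^ k * b k y v w +
        x ^ (d + 1) / ((d : ℝ) + 1) * κ y v w))
      =o[𝓝[>] 0] fun x => x ^ (d + 1)

end NormalForm

end WangMass

end

open scoped Polynomial

noncomputable section

namespace WangMass

/-! Write `s = x²`, `p = x h_x'`, `q = x² h_x''`. In a collar chart, `-2 x²` times the tangential
part of `Ric(g) + d g` is a smooth function `einsteinOp` of `s`, the 2-jet of `h_x` along `S`, `p`
and `q` (`IsCollarMetric.neg_two_mul_ricci_add`). The decay of the defect makes it `O(x^(d+2))`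
along the family. It vanishes wherever `s = p = q = 0`, whatever the jet, so its derivative at such
a point is `q + (1 - d) p - tr(p) h₀ - 2 s Ric(h₀)` and contains no variation of the jet
(`fderiv_einsteinOp`).

Let `D` denote `x d/dx` acting on the coefficient of `x^k`, a polynomial in `log x`; thus `D p = k p
+ p'`. For two families with the same value `h₀` at `x = 0`, a difference `c` at order `k`
contributes `D(D - d) c - tr(D c) h₀`. If this is zero, its trace gives `D(D - 2d) tr c = 0`. Both
factors are injective for `1 ≤ k < 2d`, hence `tr c = 0` and then `(D - d) c = 0`
(`indicial_equation`): `c = 0` if `k ≠ d`, and `c` has no logarithms if `k = d`.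

The nonlinear error is controlled by comparing with a reference family even in `x`. If the two
families first differ at order `k`, the error consists, up to logarithms, of terms `x^(k+2)` and
`x^(2k)` (`isLittleO_sub_fderiv`). For `k = d ≥ 2` both are `o(x^(d+1))`, so one linear comparison
settles orders `d` and `d + 1` together: the Neumann datum is free at order `d` and cannot influence
order `d + 1`.

For Einstein `h₀` the reference is `(1 - λ x²/4)² h₀`, an exact solution (`einsteinOp_warp`), and
`comps_einstein` fixes every coefficient through order `d + 1` except the log-free one at order `d`.
For even `d` the reference consists of the even coefficients of `h_x` itself. Its Einstein operator
is a smooth function of `x²`, hence has no odd orders, and `comps_odd` removes the odd coefficients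
one after another; `k = d` never occurs because `d` is even. In both cases the whole tensor `κ`
vanishes, not only its trace. -/

/-! ### Expansions in powers of `x` and `log x` -/

/-- `f = ∑_{k ≤ N} x^k c_k(log x) + o(x^N)` as `x → 0+`, with polynomials `c_k`. -/
def LogExpansion (N : ℕ) (f : ℝ → ℝ) (c : ℕ → ℝ[X]) : Prop :=
  (fun x : ℝ => f x - ∑ k ∈ Finset.range (N + 1), x ^ k * (c k).eval (Real.log x))
    =o[𝓝[>] 0] fun x => x ^ N

/-- The weight `x^(-1/4)`, which dominates every power of `log x`. -/
def logWeight (x : ℝ) : ℝ := x ^ (-(1 / 4) : ℝ)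

theorem logWeight_pos {x : ℝ} (hx : 0 < x) : 0 < logWeight x := Real.rpow_pos_of_pos hx _

theorem isLittleO_log_pow_logWeight (n : ℕ) :
    (fun x : ℝ => Real.log x ^ n) =o[𝓝[>] 0] logWeight := by
  have h := isLittleO_abs_log_rpow_rpow_nhdsGT_zero (n : ℝ) (s := -(1 / 4)) (by norm_num)
  refine (isLittleO_norm_left.1 ?_)
  simp only [Real.rpow_natCast] at h
  simp only [norm_pow, Real.norm_eq_abs]
  exact h

theorem isLittleO_eval_log_logWeight (p : ℝ[X]) :
    (fun x : ℝ => p.eval (Real.log x)) =o[𝓝[>] 0] logWeight := by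
  induction p using Polynomial.induction_on' with
  | add p q hp hq => simpa using! hp.add hq
  | monomial n a =>
    simpa using! (isLittleO_log_pow_logWeight n).const_mul_left a

/-- The exponent `-1/4` leaves room for two weights: quadratic error terms carry the weight squared,
which still costs only `x^(1/2)`. -/
theorem tendsto_mul_logWeight_sq :
    Tendsto (fun x : ℝ => x * logWeight x ^ 2) (𝓝[>] 0) (𝓝 0) := by
  have h : Tendsto (fun x : ℝ => x ^ (1 / 2 : ℝ)) (𝓝[>] 0) (𝓝 0) := by
    have := (Real.continuousAt_rpow_const (0 : ℝ) (1 / 2) (Or.inr (by norm_num))).tendsto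
    rw [Real.zero_rpow (by norm_num)] at this
    exact this.mono_left nhdsWithin_le_nhds
  refine h.congr' ?_
  filter_upwards [self_mem_nhdsWithin] with x hx
  have hx : (0 : ℝ) < x := hx
  rw [logWeight, ← Real.rpow_natCast, ← Real.rpow_mul hx.le]
  nth_rw 2 [← Real.rpow_one x]
  rw [← Real.rpow_add hx]
  norm_num

theorem isBigO_one_logWeight : (fun _ : ℝ => (1 : ℝ)) =O[𝓝[>] 0] logWeight := by
  simpa using (isLittleO_log_pow_logWeight 0).isBigO

theorem tendsto_mul_logWeight :
    Tendsto (fun x : ℝ => x * logWeight x) (𝓝[>] 0) (𝓝 0) := by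
  have h : (fun x : ℝ => x * logWeight x) =O[𝓝[>] 0] fun x => x * logWeight x ^ 2 := by
    have h2 := isBigO_one_logWeight.mul (isBigO_refl (fun x => x * logWeight x) (𝓝[>] 0))
    refine h2.congr (fun x => by ring) (fun x => by ring)
  exact h.trans_tendsto tendsto_mul_logWeight_sq

theorem isLittleO_pow_succ_mul_logWeight (k : ℕ) :
    (fun x : ℝ => x ^ (k + 1) * logWeight x) =o[𝓝[>] 0] fun x => x ^ k := by
  have h := (isBigO_refl (fun x : ℝ => x ^ k) (𝓝[>] 0)).mul_isLittleO
    ((isLittleO_one_iff ℝ).2 tendsto_mul_logWeight)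
  exact h.congr (fun x => by ring) (fun x => by ring)

theorem isLittleO_pow_mul_eval_log {k m : ℕ} (h : k < m) (p : ℝ[X]) :
    (fun x : ℝ => x ^ m * p.eval (Real.log x)) =o[𝓝[>] 0] fun x => x ^ k := by
  have h1 : (fun x : ℝ => x ^ (m - k - 1)) =O[𝓝[>] 0] fun _ => (1 : ℝ) :=
    (((continuous_pow (m - k - 1)).tendsto (0 : ℝ)).mono_left
      nhdsWithin_le_nhds).isBigO_one ℝ
  have h2 := h1.mul_isLittleO (((isBigO_refl (fun x : ℝ => x ^ (k + 1)) (𝓝[>] 0)).mul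
    (isLittleO_eval_log_logWeight p).isBigO).trans_isLittleO (isLittleO_pow_succ_mul_logWeight k))
  refine h2.congr (fun x => ?_) (fun x => by ring)
  rw [← mul_assoc, ← pow_add]
  congr 2
  omega

theorem isBigO_pow_of_le {k m : ℕ} (h : k ≤ m) :
    (fun x : ℝ => x ^ m) =O[𝓝[>] 0] fun x : ℝ => x ^ k := by
  have h1 : (fun x : ℝ => x ^ (m - k)) =O[𝓝[>] 0] fun _ => (1 : ℝ) :=
    (((continuous_pow (m - k)).tendsto (0 : ℝ)).mono_left nhdsWithin_le_nhds).isBigO_one ℝ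
  refine (h1.mul (isBigO_refl (fun x : ℝ => x ^ k) _)).congr (fun x => ?_) (fun x => by ring)
  rw [← pow_add]; congr 1; omega

/-- With `t = log x → -∞` the hypothesis says that a polynomial tends to zero at infinity, which
only the zero polynomial does. This is the source of uniqueness for all expansions below. -/
theorem eq_zero_of_eval_log_isLittleO {p : ℝ[X]}
    (h : (fun x : ℝ => p.eval (Real.log x)) =o[𝓝[>] 0] fun _ => (1 : ℝ)) : p = 0 := by
  have h1 : Tendsto (fun t : ℝ => p.eval t) atBot (𝓝 0) := by
    have h2 := (isLittleO_one_iff ℝ).1 h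
    have h3 : Tendsto Real.exp atBot (𝓝[>] 0) := Real.tendsto_exp_atBot_nhdsGT
    simpa [Function.comp_def] using h2.comp h3
  -- The limit criterion for polynomials is at `+∞`, so the variable is reflected here and reflected
  -- back at the end.
  have h4 : Tendsto (fun t : ℝ => (p.comp (-Polynomial.X)).eval t) atTop (𝓝 0) := by
    simpa [Function.comp_def] using h1.comp tendsto_neg_atTop_atBot
  have h5 := ((p.comp (-Polynomial.X)).tendsto_nhds_iff).1 h4
  have h6 : p.comp (-Polynomial.X) = 0 := Polynomial.leadingCoeff_eq_zero.1 h5.1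
  have h7 := congrArg (fun q : ℝ[X] => q.comp (-Polynomial.X)) h6
  simpa [Polynomial.comp_assoc] using h7

theorem eq_zero_of_pow_mul_eval_log_isLittleO {k : ℕ} {p : ℝ[X]}
    (h : (fun x : ℝ => x ^ k * p.eval (Real.log x)) =o[𝓝[>] 0] fun x => x ^ k) : p = 0 := by
  apply eq_zero_of_eval_log_isLittleO
  have h2 := (isBigO_refl (fun x : ℝ => (x ^ k)⁻¹) (𝓝[>] 0)).mul_isLittleO h
  refine h2.congr' ?_ ?_ <;>
  · filter_upwards [self_mem_nhdsWithin] with x hx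
    have hx : (0 : ℝ) < x := hx
    field_simp

/-! ### Algebra and uniqueness of logarithmic expansions. -/

namespace LogExpansion

variable {N : ℕ} {f g : ℝ → ℝ} {c e : ℕ → ℝ[X]}

theorem congr' (h : LogExpansion N f c) (hfg : f =ᶠ[𝓝[>] 0] g) : LogExpansion N g c := by
  refine IsLittleO.congr' h ?_ EventuallyEq.rfl
  filter_upwards [hfg] with x hx
  rw [hx]

theorem congr_coeff (h : LogExpansion N f c) (hce : ∀ k ≤ N, c k = e k) : LogExpansion N f e := by
  refine IsLittleO.congr_left h fun x => ?_
  congr 1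
  refine Finset.sum_congr rfl fun k hk => ?_
  rw [hce k (by simpa [Nat.lt_succ_iff] using hk)]

theorem add (hf : LogExpansion N f c) (hg : LogExpansion N g e) :
    LogExpansion N (fun x => f x + g x) (fun k => c k + e k) := by
  refine (IsLittleO.add hf hg).congr_left fun x => ?_
  simp only [Polynomial.eval_add, mul_add, Finset.sum_add_distrib]
  ring

theorem const_mul (hf : LogExpansion N f c) (a : ℝ) :
    LogExpansion N (fun x => a * f x) (fun k => Polynomial.C a * c k) := by
  refine (IsLittleO.const_mul_left hf a).congr_left fun x => ?_
  simp only [Polynomial.eval_mul, Polynomial.eval_C, mul_sub, Finset.mul_sum]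
  congr 1
  exact Finset.sum_congr rfl fun k _ => by ring

theorem sub (hf : LogExpansion N f c) (hg : LogExpansion N g e) :
    LogExpansion N (fun x => f x - g x) (fun k => c k - e k) := by
  refine (IsLittleO.sub hf hg).congr_left fun x => ?_
  simp only [Polynomial.eval_sub, mul_sub, Finset.sum_sub_distrib]
  ring

theorem sum {ι : Type*} (s : Finset ι) {f : ι → ℝ → ℝ} {c : ι → ℕ → ℝ[X]}
    (h : ∀ i ∈ s, LogExpansion N (f i) (c i)) :
    LogExpansion N (fun x => ∑ i ∈ s, f i x) (fun k => ∑ i ∈ s, c i k) := by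
  classical
  induction s using Finset.induction_on with
  | empty => simp [LogExpansion]
  | insert a s ha ih =>
    simp only [Finset.sum_insert ha]
    exact (h a (Finset.mem_insert_self a s)).add
      (ih fun i hi => h i (Finset.mem_insert_of_mem hi))

theorem of_isLittleO (hf : f =o[𝓝[>] 0] fun x : ℝ => x ^ N) : LogExpansion N f fun _ => 0 := by
  simpa [LogExpansion] using hf

/-- Polynomials in `x` are their own expansion. -/
theorem of_sum (K : ℕ) (t : ℕ → ℝ) (ht : ∀ k, K < k → t k = 0) :
    LogExpansion N (fun x => ∑ k ∈ Finset.range (K + 1), t k * x ^ k)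
      (fun k => Polynomial.C (t k)) := by
  -- The degree `K` and the order `N` are unrelated; padding with zeros to the larger of the two
  -- covers both cases, and the terms above `N` go into the remainder.
  have key : ∀ x : ℝ, ∑ k ∈ Finset.range (K + 1), t k * x ^ k =
      ∑ k ∈ Finset.range (max K N + 1), t k * x ^ k := fun x => by
    refine Finset.sum_subset (fun k hk => ?_) fun k _ hk => ?_
    · simp only [Finset.mem_range] at hk ⊢; omega
    · rw [ht k (by simp only [Finset.mem_range] at hk; omega), zero_mul]
  have h : (fun x : ℝ => ∑ k ∈ Finset.range (max K N + 1) \ Finset.range (N + 1), t k * x ^ k)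
      =o[𝓝[>] 0] fun x => x ^ N := by
    refine IsLittleO.fun_sum fun k hk => ?_
    have hk : N < k := by
      simp only [Finset.mem_sdiff, Finset.mem_range] at hk; omega
    simpa using (isLittleO_pow_mul_eval_log hk (1 : ℝ[X])).const_mul_left (t k)
  refine h.congr_left fun x => ?_
  simp only [key]
  rw [← Finset.sum_sdiff (s₁ := Finset.range (N + 1)) (s₂ := Finset.range (max K N + 1))
    (fun k hk => by simp only [Finset.mem_range] at hk ⊢; omega)]
  simp only [Polynomial.eval_C, mul_comm]
  ring

/-- Higher orders are `o(x^k)` in spite of their logarithms, since a full power of `x` beats any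
power of `log x`. -/
theorem leading (h : LogExpansion N f c) {k : ℕ} (hk : k ≤ N) (hc : ∀ j < k, c j = 0) :
    (fun x : ℝ => f x - x ^ k * (c k).eval (Real.log x)) =o[𝓝[>] 0] fun x => x ^ k := by
  have h1 : (fun x : ℝ => f x - ∑ k ∈ Finset.range (N + 1), x ^ k * (c k).eval (Real.log x))
      =o[𝓝[>] 0] fun x : ℝ => x ^ k := IsLittleO.trans_isBigO h (isBigO_pow_of_le hk)
  have h2 : (fun x : ℝ => ∑ j ∈ (Finset.range (N + 1)).erase k, x ^ j * (c j).eval (Real.log x))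
      =o[𝓝[>] 0] fun x => x ^ k := by
    refine IsLittleO.fun_sum fun j hj => ?_
    rcases lt_trichotomy j k with hjk | hjk | hjk
    · simp [hc j hjk]
    · simp [hjk] at hj
    · exact isLittleO_pow_mul_eval_log hjk _
  refine (h1.add h2).congr_left fun x => ?_
  rw [← Finset.add_sum_erase _ _ (show k ∈ Finset.range (N + 1) by simp; omega)]
  ring

theorem coeff_eq_zero (h : LogExpansion N f c) {k : ℕ} (hk : k ≤ N) (hc : ∀ j < k, c j = 0)
    (hf : f =o[𝓝[>] 0] fun x : ℝ => x ^ k) : c k = 0 := by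
  apply eq_zero_of_pow_mul_eval_log_isLittleO (k := k)
  refine (hf.sub (h.leading hk hc)).congr_left fun x => by ring

theorem eq_zero (h : LogExpansion N f c) {n : ℕ} (hn : n ≤ N)
    (hf : f =o[𝓝[>] 0] fun x : ℝ => x ^ n) : ∀ k ≤ n, c k = 0 := by
  intro k
  induction k using Nat.strong_induction_on with
  | _ k ih =>
    intro hk
    exact h.coeff_eq_zero (hk.trans hn) (fun j hj => ih j hj (hj.le.trans hk))
      (hf.trans_isBigO (isBigO_pow_of_le hk))

theorem unique (hf : LogExpansion N f c) (hf' : LogExpansion N f e) : ∀ k ≤ N, c k = e k := by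
  intro k hk
  have h := (hf.sub hf').eq_zero le_rfl (by simp) k hk
  exact sub_eq_zero.1 h

/-- The weight absorbs the polynomial in `log x`, so a single rate serves for coefficients of every
logarithmic degree. -/
theorem isBigO (h : LogExpansion N f c) {k : ℕ} (hk : k ≤ N) (hc : ∀ j < k, c j = 0) :
    f =O[𝓝[>] 0] fun x : ℝ => x ^ k * logWeight x := by
  have h1 : (fun x : ℝ => x ^ k) =O[𝓝[>] 0] fun x : ℝ => x ^ k * logWeight x :=
    ((isBigO_refl (fun x : ℝ => x ^ k) _).mul isBigO_one_logWeight).congr_left fun x => by ring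
  have h2 := (isBigO_refl (fun x : ℝ => x ^ k) (𝓝[>] 0)).mul
    (isLittleO_eval_log_logWeight (c k)).isBigO
  exact (((h.leading hk hc).isBigO.trans h1).add h2).congr_left fun x => by ring

/-- A smooth function of `x²` has an expansion in even powers of `x`, without logarithms. -/
theorem exists_of_comp_sq {f : ℝ → ℝ} (hf : ContDiffAt ℝ ∞ f 0) (N : ℕ) :
    ∃ t : ℕ → ℝ, (∀ k, Odd k → t k = 0) ∧
      LogExpansion N (fun x => f (x ^ 2)) fun k => Polynomial.C (t k) := by
  obtain ⟨u, hu, hfu⟩ := (contDiffAt_infty.1 hf N).contDiffOn (m := N) le_rfl (by simp)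
  obtain ⟨r, hr, hru⟩ := Metric.mem_nhds_iff.1 hu
  have h0 : (0 : ℝ) ∈ Metric.ball (0 : ℝ) r := Metric.mem_ball_self hr
  have hT := taylor_isLittleO (convex_ball (0 : ℝ) r) h0 (n := N) (hfu.mono hru)
  rw [Metric.isOpen_ball.nhdsWithin_eq h0] at hT
  have hsq : Tendsto (fun x : ℝ => x ^ 2) (𝓝[>] 0) (𝓝 0) := by
    have := (continuous_pow 2).tendsto (0 : ℝ)
    simp only [ne_eq, OfNat.ofNat_ne_zero, not_false_eq_true, zero_pow] at this
    exact this.mono_left nhdsWithin_le_nhds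
  have hT2 := hT.comp_tendsto hsq
  set s : ℕ → ℝ := fun k => ((k.factorial : ℝ)⁻¹ *
    iteratedDerivWithin k f (Metric.ball 0 r) 0) with hs
  have hev : ∀ z : ℝ, taylorWithinEval f N (Metric.ball 0 r) 0 z =
      ∑ k ∈ Finset.range (N + 1), s k * z ^ k := fun z => by
    rw [taylor_within_apply]
    refine Finset.sum_congr rfl fun k _ => ?_
    simp [hs]; ring
  -- The Taylor coefficient of order `k / 2` in the variable `x²`; the cutoff at `2N` makes this a
  -- polynomial, to which `of_sum` applies.
  refine ⟨fun k => if Even k ∧ k ≤ 2 * N then s (k / 2) else 0, fun k hk => ?_, ?_⟩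
  · simp [Nat.not_even_iff_odd.2 hk]
  have hE := of_sum (N := N) (2 * N) (fun k => if Even k ∧ k ≤ 2 * N then s (k / 2) else 0)
    (fun k hk => by simp [Nat.not_le.2 hk])
  have hsum : ∀ x : ℝ, ∑ k ∈ Finset.range (2 * N + 1),
      (if Even k ∧ k ≤ 2 * N then s (k / 2) else 0) * x ^ k =
      ∑ k ∈ Finset.range (N + 1), s k * (x ^ 2) ^ k := fun x => by
    symm
    refine Finset.sum_of_injOn (fun k => 2 * k) (fun a _ b _ h => by simpa using h) ?_ ?_ ?_
    · intro k hk
      simp only [Finset.coe_range, mem_Iio] at hk ⊢; omega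
    · intro k hk hk'
      have : ¬ Even k := by
        rintro ⟨m, rfl⟩
        apply hk'
        simp only [Finset.mem_range] at hk
        exact ⟨m, by simp; omega, by simp; omega⟩
      simp [this]
    · intro k hk
      simp only [Finset.mem_range] at hk
      have : k ≤ N := by omega
      simp [pow_mul, this]
  have hR : (fun x : ℝ => f (x ^ 2) - ∑ k ∈ Finset.range (N + 1), s k * (x ^ 2) ^ k)
      =o[𝓝[>] 0] fun x : ℝ => x ^ N := by
    have h3 : (fun x : ℝ => (x ^ 2) ^ N) =O[𝓝[>] 0] fun x : ℝ => x ^ N := by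
      simpa [← pow_mul] using isBigO_pow_of_le (show N ≤ 2 * N by omega)
    refine IsLittleO.trans_isBigO ?_ h3
    refine hT2.congr (fun x => ?_) (fun x => ?_)
    · simp [hev]
    · simp
  have := (of_isLittleO hR).add hE
  refine (this.congr' (Eventually.of_forall fun x => ?_)).congr_coeff fun k _ => by simp
  simp only [hsum]
  ring

end LogExpansion

/-! ### The Euler operator `x d/dx` on polynomials in `log x` -/

/-- The action of `x d/dx` on `x^k p(log x)`: it gives `x^k (k p + p')(log x)`. -/
def eulerOp (k : ℕ) : ℝ[X] →ₗ[ℝ] ℝ[X] :=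
  (k : ℝ) • LinearMap.id + Polynomial.derivative

theorem eulerOp_apply (k : ℕ) (p : ℝ[X]) :
    eulerOp k p = (k : ℝ) • p + Polynomial.derivative p := rfl

@[simp]
theorem eulerOp_C (k : ℕ) (a : ℝ) : eulerOp k (Polynomial.C a) = Polynomial.C (k * a) := by
  simp [eulerOp_apply, Polynomial.smul_eq_C_mul]

/-- Differentiation lowers the degree, so a nonzero `p` cannot satisfy `p' = -a p`. Hence `D - b` is
injective at every order `k ≠ b`. -/
theorem eq_zero_of_smul_add_derivative {a : ℝ} (ha : a ≠ 0) {p : ℝ[X]}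
    (h : a • p + Polynomial.derivative p = 0) : p = 0 := by
  by_contra hp
  have h1 := Polynomial.degree_derivative_lt hp
  have h2 : Polynomial.derivative p = -(a • p) := by
    rw [eq_neg_iff_add_eq_zero, add_comm, h]
  rw [h2, Polynomial.degree_neg, Polynomial.degree_smul_of_smul_regular _
    (isSMulRegular_iff_right_eq_zero_of_smul.2 fun x hx => by simpa [ha] using hx)] at h1
  exact lt_irrefl _ h1

/-- The indicial analysis of the linearised Einstein operator. -/
theorem indicial_equation {d k : ℕ} (hk : 1 ≤ k) (hkd : k < 2 * d) (g gi : Fin d → Fin d → ℝ)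
    (htr : ∑ a, ∑ b, gi a b * g b a = d) (p : Fin d → Fin d → ℝ[X])
    (h : ∀ i j, eulerOp k (eulerOp k (p i j)) - (d : ℝ) • eulerOp k (p i j) -
      g i j • ∑ a, ∑ b, gi a b • eulerOp k (p b a) = 0) :
    (∀ i j, eulerOp k (p i j) - (d : ℝ) • p i j = 0) ∧ ∑ a, ∑ b, gi a b • p b a = 0 := by
  have hk0 : (k : ℝ) ≠ 0 := by positivity
  have inj : ∀ q, eulerOp k q = 0 → q = 0 := fun q hq => eq_zero_of_smul_add_derivative hk0 hq
  set t := ∑ a, ∑ b, gi a b • p b a with ht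
  have hDt : ∑ a, ∑ b, gi a b • eulerOp k (p b a) = eulerOp k t := by
    simp [ht, map_sum]
  have hDDt : ∑ a, ∑ b, gi a b • eulerOp k (eulerOp k (p b a)) = eulerOp k (eulerOp k t) := by
    simp [ht, map_sum]
  simp only [hDt] at h
  -- Contracting with the inverse metric: the trace term contributes a second `d D t`, because the
  -- trace of the metric is `d`.
  have h1 : eulerOp k (eulerOp k t) - (d : ℝ) • eulerOp k t - (d : ℝ) • eulerOp k t = 0 := by
    have : ∑ a, ∑ b, gi a b • (eulerOp k (eulerOp k (p b a)) - (d : ℝ) • eulerOp k (p b a) -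
      g b a • eulerOp k t) = 0 := by simp [h]
    simp only [smul_sub, Finset.sum_sub_distrib, hDDt, smul_smul, ← Finset.sum_smul, htr] at this
    simp only [mul_comm _ (d : ℝ), mul_smul, ← Finset.smul_sum, hDt] at this
    exact this
  -- The traced equation is `D (D - 2d) t = 0`; `D` is cancelled here and `D - 2d` next, by `k < 2 *
  -- d`.
  have h2 : eulerOp k t - (2 * d : ℝ) • t = 0 := by
    apply inj
    rw [map_sub, map_smul, ← h1, two_mul, add_smul]
    abel
  have h3 : t = 0 := by
    refine eq_zero_of_smul_add_derivative (a := (k : ℝ) - 2 * d) ?_ ?_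
    · have : (k : ℝ) < 2 * d := by exact_mod_cast hkd
      linarith
    · rw [← h2, eulerOp_apply, sub_smul]
      abel
  refine ⟨fun i j => inj _ ?_, h3⟩
  have := h i j
  rw [h3] at this
  simpa [map_sub] using this

theorem hasDerivAt_pow_mul_eval_log (k : ℕ) (p : ℝ[X]) {x : ℝ} (hx : 0 < x) :
    HasDerivAt (fun x : ℝ => x ^ k * p.eval (Real.log x))
      (x⁻¹ * (x ^ k * (eulerOp k p).eval (Real.log x))) x := by
  have h1 := (hasDerivAt_pow k x).mul
    ((p.hasDerivAt (Real.log x)).comp x (Real.hasDerivAt_log hx.ne'))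
  refine h1.congr_deriv ?_
  rw [eulerOp_apply]
  simp only [Polynomial.eval_add, Polynomial.eval_smul, smul_eq_mul, Function.comp]
  rcases k with _ | k
  · simp; ring
  · simp only [Nat.add_sub_cancel]
    field_simp
    ring

theorem hasDerivAt_deriv_pow_mul_eval_log (k : ℕ) (p : ℝ[X]) {x : ℝ} (hx : 0 < x) :
    HasDerivAt (fun x : ℝ => x⁻¹ * (x ^ k * (eulerOp k p).eval (Real.log x)))
      ((x ^ 2)⁻¹ * (x ^ k * (eulerOp k (eulerOp k p) - eulerOp k p).eval (Real.log x))) x := by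
  refine ((hasDerivAt_inv hx.ne').mul
    (hasDerivAt_pow_mul_eval_log k (eulerOp k p) hx)).congr_deriv ?_
  simp only [Polynomial.eval_sub]
  field_simp
  ring

/-- Differentiating an expansion whose remainder may be differentiated. -/
theorem LogExpansion.of_iteratedDeriv_remainder {N : ℕ} {ε : ℝ} (hε : 0 < ε) {f : ℝ → ℝ}
    {c : ℕ → ℝ[X]} (hf : ContDiffOn ℝ 2 f (Ioo 0 ε))
    (hr : ∀ r ≤ 2, (fun x : ℝ => x ^ r * iteratedDeriv r (fun x => f x -
      ∑ k ∈ Finset.range (N + 1), x ^ k * (c k).eval (Real.log x)) x) =o[𝓝[>] 0]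
        fun x => x ^ N) :
    LogExpansion N f c ∧ LogExpansion N (fun x => x * deriv f x) (fun k => eulerOp k (c k)) ∧
      LogExpansion N (fun x => x ^ 2 * deriv (deriv f) x)
        (fun k => eulerOp k (eulerOp k (c k)) - eulerOp k (c k)) := by
  have hev : ∀ᶠ x in 𝓝[>] (0 : ℝ), x ∈ Ioo 0 ε := Ioo_mem_nhdsGT hε
  have hd : ∀ x ∈ Ioo (0 : ℝ) ε, DifferentiableAt ℝ f x := fun x hx =>
    (hf.differentiableOn (by norm_num)).differentiableAt (isOpen_Ioo.mem_nhds hx)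
  have hdd : ∀ x ∈ Ioo (0 : ℝ) ε, DifferentiableAt ℝ (deriv f) x := fun x hx => by
    have h2 : ContDiffOn ℝ 1 (deriv f) (Ioo 0 ε) :=
      hf.deriv_of_isOpen isOpen_Ioo (by norm_num)
    exact (h2.differentiableOn (by norm_num)).differentiableAt (isOpen_Ioo.mem_nhds hx)
  have h1 : ∀ x ∈ Ioo (0 : ℝ) ε, HasDerivAt (fun x => f x -
      ∑ k ∈ Finset.range (N + 1), x ^ k * (c k).eval (Real.log x))
      (deriv f x - ∑ k ∈ Finset.range (N + 1),
        x⁻¹ * (x ^ k * (eulerOp k (c k)).eval (Real.log x))) x := fun x hx =>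
    (hd x hx).hasDerivAt.sub (HasDerivAt.fun_sum fun k _ =>
      hasDerivAt_pow_mul_eval_log k (c k) hx.1)
  have h2 : ∀ x ∈ Ioo (0 : ℝ) ε, HasDerivAt (deriv (fun x => f x -
      ∑ k ∈ Finset.range (N + 1), x ^ k * (c k).eval (Real.log x)))
      (deriv (deriv f) x - ∑ k ∈ Finset.range (N + 1), (x ^ 2)⁻¹ *
        (x ^ k * (eulerOp k (eulerOp k (c k)) - eulerOp k (c k)).eval (Real.log x))) x :=
    fun x hx => by
    have h3 : HasDerivAt (fun x => deriv f x - ∑ k ∈ Finset.range (N + 1),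
        x⁻¹ * (x ^ k * (eulerOp k (c k)).eval (Real.log x))) _ x :=
      (hdd x hx).hasDerivAt.sub (HasDerivAt.fun_sum fun k _ =>
        hasDerivAt_deriv_pow_mul_eval_log k (c k) hx.1)
    refine h3.congr_of_eventuallyEq ?_
    filter_upwards [isOpen_Ioo.mem_nhds hx] with y hy
    exact (h1 y hy).deriv
  refine ⟨by simpa [LogExpansion] using hr 0 (by norm_num), ?_, ?_⟩
  · refine (hr 1 (by norm_num)).congr' ?_ EventuallyEq.rfl
    filter_upwards [hev] with x hx
    have hx0 : x ≠ 0 := hx.1.ne'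
    rw [iteratedDeriv_one, (h1 x hx).deriv, pow_one, mul_sub, Finset.mul_sum]
    congr 1
    refine Finset.sum_congr rfl fun k _ => ?_
    field_simp
  · refine (hr 2 le_rfl).congr' ?_ EventuallyEq.rfl
    filter_upwards [hev] with x hx
    have hx0 : x ≠ 0 := hx.1.ne'
    rw [iteratedDeriv_succ, iteratedDeriv_one, (h2 x hx).deriv, mul_sub, Finset.mul_sum]
    congr 1
    refine Finset.sum_congr rfl fun k _ => ?_
    field_simp

/-! ### Comparing a smooth function along two nearby curves -/

/-- The derivative of a `C²` function is locally Lipschitz, so along the segment from `y₂` to `y₁`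
it differs from its value at `y₀` by a multiple of the distance to `y₀`; the mean value inequality
does the rest. Linearising at the fixed point `y₀`, not at `y₂`, keeps the linear part independent
of `x`. -/
theorem exists_fderiv_remainder_le {Y : Type*} [NormedAddCommGroup Y] [NormedSpace ℝ Y]
    {f : Y → ℝ} {y₀ : Y} (hf : ContDiffAt ℝ 2 f y₀) :
    ∃ K : ℝ, ∃ r > 0, ∀ y₁ ∈ Metric.ball y₀ r, ∀ y₂ ∈ Metric.ball y₀ r,
      ‖f y₁ - f y₂ - fderiv ℝ f y₀ (y₁ - y₂)‖ ≤
        K * (‖y₁ - y₀‖ + ‖y₂ - y₀‖) * ‖y₁ - y₂‖ := by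
  have h1 : ContDiffAt ℝ 1 (fderiv ℝ f) y₀ := hf.fderiv_right (by norm_num)
  obtain ⟨K, t, ht, hK⟩ := h1.exists_lipschitzOnWith
  have h2 : ∀ᶠ y in 𝓝 y₀, DifferentiableAt ℝ f y :=
    (hf.eventually (by norm_num)).mono fun y hy => hy.differentiableAt (by norm_num)
  obtain ⟨r, hr, hrt⟩ := Metric.mem_nhds_iff.1 (Filter.inter_mem ht h2)
  refine ⟨K, r, hr, fun y₁ hy₁ y₂ hy₂ => ?_⟩
  set ρ := ‖y₁ - y₀‖ + ‖y₂ - y₀‖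
  have hseg : segment ℝ y₂ y₁ ⊆ Metric.ball y₀ r := (convex_ball y₀ r).segment_subset hy₂ hy₁
  have hseg2 : segment ℝ y₂ y₁ ⊆ Metric.closedBall y₀ ρ :=
    (convex_closedBall y₀ ρ).segment_subset
      (by rw [mem_closedBall_iff_norm]; exact le_add_of_nonneg_left (norm_nonneg _))
      (by rw [mem_closedBall_iff_norm]; exact le_add_of_nonneg_right (norm_nonneg _))
  refine (convex_segment y₂ y₁).norm_image_sub_le_of_norm_fderiv_le' (𝕜 := ℝ)
    (fun y hy => (hrt (hseg hy)).2) (fun y hy => ?_) (left_mem_segment ℝ y₂ y₁)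
    (right_mem_segment ℝ y₂ y₁)
  have h3 := hK.dist_le_mul y (hrt (hseg hy)).1 y₀ (mem_of_mem_nhds ht)
  rw [dist_eq_norm] at h3
  refine h3.trans (mul_le_mul_of_nonneg_left ?_ K.2)
  exact hseg2 hy

/-- The remainder is bounded by `(x^k w + x²) x^k w`, with `w` the logarithmic weight. The two
numerical conditions on `m` are what its two products require. Quadratic closeness of `y₂` to `y₀`
is essential: closeness of order `x` would leave an error of order `x^(k+1) w`. -/
theorem isLittleO_sub_fderiv {Y : Type*} [NormedAddCommGroup Y] [NormedSpace ℝ Y]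
    {f : Y → ℝ} {y₀ : Y} (hf : ContDiffAt ℝ 2 f y₀) {y₁ y₂ : ℝ → Y} {k m : ℕ} (hk : 1 ≤ k)
    (hm : m ≤ k + 1) (hmk : m + 1 ≤ 2 * k)
    (h₂ : (fun x => y₂ x - y₀) =O[𝓝[>] 0] fun x : ℝ => x ^ 2)
    (h₁ : (fun x => y₁ x - y₂ x) =O[𝓝[>] 0] fun x : ℝ => x ^ k * logWeight x) :
    (fun x => f (y₁ x) - f (y₂ x) - fderiv ℝ f y₀ (y₁ x - y₂ x)) =o[𝓝[>] 0]
      fun x : ℝ => x ^ m := by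
  obtain ⟨K, r, hr, hK⟩ := exists_fderiv_remainder_le hf
  have hx1 : ∀ n : ℕ, 1 ≤ n → Tendsto (fun x : ℝ => x ^ n) (𝓝[>] 0) (𝓝 0) := fun n hn => by
    have := (continuous_pow n).tendsto (0 : ℝ)
    rw [zero_pow (by omega)] at this
    exact this.mono_left nhdsWithin_le_nhds
  have t2 : Tendsto (fun x => y₂ x - y₀) (𝓝[>] 0) (𝓝 0) := h₂.trans_tendsto (hx1 2 (by norm_num))
  have hkl : Tendsto (fun x : ℝ => x ^ k * logWeight x) (𝓝[>] 0) (𝓝 0) := by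
    obtain ⟨n, rfl⟩ : ∃ n, k = n + 1 := ⟨k - 1, by omega⟩
    have h3 := (isLittleO_pow_succ_mul_logWeight n).trans_isBigO
      (isBigO_pow_of_le (Nat.zero_le n))
    simpa using h3
  have t12 : Tendsto (fun x => y₁ x - y₂ x) (𝓝[>] 0) (𝓝 0) := h₁.trans_tendsto hkl
  have t1 : Tendsto (fun x => y₁ x - y₀) (𝓝[>] 0) (𝓝 0) := by
    simpa using (t12.add t2).congr fun x => by abel
  have h₁₀ : (fun x => y₁ x - y₀) =O[𝓝[>] 0] fun x : ℝ => x ^ k * logWeight x + x ^ 2 := by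
    have e1 : (fun x : ℝ => x ^ k * logWeight x) =O[𝓝[>] 0]
        fun x : ℝ => x ^ k * logWeight x + x ^ 2 := by
      refine IsBigO.of_bound 1 ?_
      filter_upwards [self_mem_nhdsWithin] with x hx
      have hx : (0 : ℝ) < x := hx
      have := logWeight_pos hx
      rw [Real.norm_of_nonneg (by positivity), Real.norm_of_nonneg (by positivity)]
      nlinarith [sq_nonneg x]
    have e2 : (fun x : ℝ => x ^ 2) =O[𝓝[>] 0]
        fun x : ℝ => x ^ k * logWeight x + x ^ 2 := by
      refine IsBigO.of_bound 1 ?_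
      filter_upwards [self_mem_nhdsWithin] with x hx
      have hx : (0 : ℝ) < x := hx
      have := logWeight_pos hx
      rw [Real.norm_of_nonneg (by positivity), Real.norm_of_nonneg (by positivity)]
      have : 0 < x ^ k * logWeight x := by positivity
      linarith
    exact ((h₁.trans e1).add (h₂.trans e2)).congr_left fun x => by abel
  have h₂₀ : (fun x => y₂ x - y₀) =O[𝓝[>] 0] fun x : ℝ => x ^ k * logWeight x + x ^ 2 := by
    refine h₂.trans (IsBigO.of_bound 1 ?_)
    filter_upwards [self_mem_nhdsWithin] with x hx
    have hx : (0 : ℝ) < x := hx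
    have := logWeight_pos hx
    rw [Real.norm_of_nonneg (by positivity), Real.norm_of_nonneg (by positivity)]
    have : 0 < x ^ k * logWeight x := by positivity
    linarith
  have hmain : (fun x => f (y₁ x) - f (y₂ x) - fderiv ℝ f y₀ (y₁ x - y₂ x)) =O[𝓝[>] 0]
      fun x : ℝ => (x ^ k * logWeight x + x ^ 2) * (x ^ k * logWeight x) := by
    have h4 : (fun x => K * (‖y₁ x - y₀‖ + ‖y₂ x - y₀‖) * ‖y₁ x - y₂ x‖) =O[𝓝[>] 0]
        fun x : ℝ => (x ^ k * logWeight x + x ^ 2) * (x ^ k * logWeight x) :=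
      ((h₁₀.norm_left.add h₂₀.norm_left).const_mul_left K).mul h₁.norm_left
    refine IsBigO.trans (IsBigO.of_bound 1 ?_) h4
    have b1 : ∀ᶠ x in 𝓝[>] (0 : ℝ), y₁ x ∈ Metric.ball y₀ r := by
      filter_upwards [t1 (Metric.ball_mem_nhds 0 hr)] with x hx
      simpa [dist_eq_norm] using hx
    have b2 : ∀ᶠ x in 𝓝[>] (0 : ℝ), y₂ x ∈ Metric.ball y₀ r := by
      filter_upwards [t2 (Metric.ball_mem_nhds 0 hr)] with x hx
      simpa [dist_eq_norm] using hx
    filter_upwards [b1, b2] with x hx1 hx2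
    rw [one_mul]
    exact (hK _ hx1 _ hx2).trans (le_abs_self _)
  refine hmain.trans_isLittleO ?_
  -- One factor `x` is spent on the squared weight; the remaining `x^(2k-1)` is where `m + 1 ≤ 2 *
  -- k` enters.
  have s1 : (fun x : ℝ => (x ^ k * logWeight x) * (x ^ k * logWeight x)) =o[𝓝[>] 0]
      fun x : ℝ => x ^ m := by
    have h5 := (isBigO_pow_of_le (show m ≤ 2 * k - 1 by omega)).mul_isLittleO
      ((isLittleO_one_iff ℝ).2 tendsto_mul_logWeight_sq)
    refine h5.congr (fun x => ?_) (fun x => by ring)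
    have : x ^ k * x ^ k = x ^ (2 * k - 1) * x := by rw [← pow_add, ← pow_succ]; congr 1; omega
    linear_combination (-logWeight x ^ 2) * this
  have s2 : (fun x : ℝ => x ^ 2 * (x ^ k * logWeight x)) =o[𝓝[>] 0] fun x : ℝ => x ^ m := by
    refine ((isLittleO_pow_succ_mul_logWeight (k + 1)).trans_isBigO
      (isBigO_pow_of_le hm)).congr_left fun x => by ring
  exact (s1.add s2).congr_left fun x => by ring

/-! ### The Ricci tensor as a function of the 2-jet of the metric -/

section MatrixInverse

variable {Y : Type*} [NormedAddCommGroup Y] [NormedSpace ℝ Y] {m : ℕ} {n : WithTop ℕ∞}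

theorem contDiffAt_det {f : Y → Matrix (Fin m) (Fin m) ℝ} {y : Y}
    (hf : ∀ i j, ContDiffAt ℝ n (fun z => f z i j) y) :
    ContDiffAt ℝ n (fun z => (f z).det) y := by
  simp only [Matrix.det_apply']
  exact ContDiffAt.sum fun σ _ => contDiffAt_const.mul (contDiffAt_prod fun i _ => hf _ _)

/-- Cramer's rule: an entry of the inverse is a determinant with one row replaced, divided by the
determinant. -/
theorem contDiffAt_inv_apply {f : Y → Matrix (Fin m) (Fin m) ℝ} {y : Y}
    (hf : ∀ i j, ContDiffAt ℝ n (fun z => f z i j) y) (hdet : (f y).det ≠ 0) (i j : Fin m) :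
    ContDiffAt ℝ n (fun z => (f z)⁻¹ i j) y := by
  simp only [Matrix.inv_def, Ring.inverse_eq_inv', Matrix.smul_apply, smul_eq_mul,
    Matrix.adjugate_apply]
  refine ((contDiffAt_det hf).inv hdet).mul (contDiffAt_det fun a b => ?_)
  by_cases h : a = j
  · subst h
    simpa using contDiffAt_const
  · simpa [Matrix.updateRow_ne h] using hf a b

end MatrixInverse

section Jets

variable {m : ℕ}

/-- A metric with its first derivatives, at a point. -/
abbrev MetricJet1 (m : ℕ) : Type := (Fin m → Fin m → ℝ) × (Fin m → Fin m → Fin m → ℝ)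

/-- A metric with its first and second derivatives, at a point. -/
abbrev MetricJet2 (m : ℕ) : Type :=
  (Fin m → Fin m → ℝ) × (Fin m → Fin m → Fin m → ℝ) × (Fin m → Fin m → Fin m → Fin m → ℝ)

def jet1 (G : Model m → Matrix (Fin m) (Fin m) ℝ) (u : Model m) : MetricJet1 m :=
  (fun i j => G u i j, fun p i j => pd p (fun v => G v i j) u)

def jet2 (G : Model m → Matrix (Fin m) (Fin m) ℝ) (u : Model m) : MetricJet2 m :=
  (fun i j => G u i j, fun p i j => pd p (fun v => G v i j) u,
    fun p q i j => pd p (fun v => pd q (fun w => G w i j) v) u)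

/-- The Christoffel symbols as functions of the 1-jet of the metric. -/
def christoffelJet (k i j : Fin m) (J : MetricJet1 m) : ℝ :=
  (1 / 2) * ∑ l, (Matrix.of J.1)⁻¹ k l * (J.2 i j l + J.2 j i l - J.2 l i j)

/-- The derivatives of the Christoffel symbols as functions of the 2-jet of the metric. -/
def christoffelDerivJet (p k i j : Fin m) (J : MetricJet2 m) : ℝ :=
  fderiv ℝ (christoffelJet k i j) (J.1, J.2.1) (J.2.1 p, J.2.2 p)

/-- The Ricci tensor as a function of the 2-jet of the metric. -/
def ricciJet (i j : Fin m) (J : MetricJet2 m) : ℝ :=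
  (∑ k, (christoffelDerivJet k k i j J - christoffelDerivJet j k i k J)) +
  ∑ k, ∑ l, (christoffelJet k k l (J.1, J.2.1) * christoffelJet l i j (J.1, J.2.1) -
      christoffelJet k j l (J.1, J.2.1) * christoffelJet l i k (J.1, J.2.1))

theorem contDiffAt_christoffelJet (k i j : Fin m) {J : MetricJet1 m}
    (hJ : (Matrix.of J.1).det ≠ 0) : ContDiffAt ℝ ∞ (christoffelJet k i j) J := by
  unfold christoffelJet
  refine contDiffAt_const.mul (ContDiffAt.sum fun l _ => ?_)
  refine ContDiffAt.mul (contDiffAt_inv_apply (f := fun J : MetricJet1 m => Matrix.of J.1)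
    (fun a b => ?_) hJ k l) (by fun_prop)
  simp only [Matrix.of_apply]
  fun_prop

theorem contDiffAt_ricciJet (i j : Fin m) {J : MetricJet2 m}
    (hJ : (Matrix.of J.1).det ≠ 0) : ContDiffAt ℝ ∞ (ricciJet i j) J := by
  have h1 : ContDiffAt ℝ ∞ (fun J : MetricJet2 m => ((J.1, J.2.1) : MetricJet1 m)) J := by
    fun_prop
  have hc : ∀ k i j : Fin m, ContDiffAt ℝ ∞
      (fun J : MetricJet2 m => christoffelJet k i j (J.1, J.2.1)) J := fun k i j =>
    ContDiffAt.comp (g := christoffelJet k i j) J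
      (contDiffAt_christoffelJet k i j (J := (J.1, J.2.1)) hJ) h1
  have hd : ∀ p k i j : Fin m, ContDiffAt ℝ ∞ (christoffelDerivJet p k i j) J :=
    fun p k i j => by
    have h2 : ContDiffAt ℝ ∞ (fderiv ℝ (christoffelJet k i j)) (J.1, J.2.1) :=
      (contDiffAt_christoffelJet k i j (J := (J.1, J.2.1)) hJ).fderiv_right (by simp)
    have h3 : ContDiffAt ℝ ∞ (fun J : MetricJet2 m => fderiv ℝ (christoffelJet k i j)
      (J.1, J.2.1)) J := ContDiffAt.comp J h2 h1
    unfold christoffelDerivJet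
    refine h3.clm_apply ?_
    fun_prop
  unfold ricciJet
  exact (ContDiffAt.sum fun k _ => (hd _ _ _ _).sub (hd _ _ _ _)).add
    (ContDiffAt.sum fun k _ => ContDiffAt.sum fun l _ =>
      ((hc _ _ _).mul (hc _ _ _)).sub ((hc _ _ _).mul (hc _ _ _)))

theorem christoffel_eq_jet (G : Model m → Matrix (Fin m) (Fin m) ℝ) (k i j : Fin m) :
    christoffel G k i j = fun u => christoffelJet k i j (jet1 G u) := rfl

theorem differentiableAt_pd {f : Model m → ℝ} {u : Model m} (hf : ContDiffAt ℝ 2 f u)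
    (p : Fin m) : DifferentiableAt ℝ (fun v => pd p f v) u := by
  have h1 : ContDiffAt ℝ 1 (fderiv ℝ f) u := hf.fderiv_right (by norm_num)
  exact (h1.differentiableAt (by norm_num)).clm_apply (differentiableAt_const _)

/-- Chain rule through the 1-jet: the derivative of `jet1 G` in direction `p` is read off from the
2-jet. -/
theorem pd_christoffel {G : Model m → Matrix (Fin m) (Fin m) ℝ} {u : Model m}
    (hG : ∀ i j, ContDiffAt ℝ 2 (fun v => G v i j) u) (hdet : (G u).det ≠ 0)
    (p k i j : Fin m) :
    pd p (christoffel G k i j) u = christoffelDerivJet p k i j (jet2 G u) := by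
  have h1 : HasFDerivAt (christoffelJet k i j)
      (fderiv ℝ (christoffelJet k i j) (jet1 G u)) (jet1 G u) :=
    ((contDiffAt_christoffelJet k i j (J := jet1 G u) hdet).differentiableAt
      (by simp)).hasFDerivAt
  have h2 : HasFDerivAt (fun v => (fun i j => G v i j : Fin m → Fin m → ℝ))
      (ContinuousLinearMap.pi fun i => ContinuousLinearMap.pi fun j =>
        fderiv ℝ (fun v => G v i j) u) u := by
    refine hasFDerivAt_pi.2 fun i => hasFDerivAt_pi.2 fun j => ?_
    exact ((hG i j).differentiableAt (by norm_num)).hasFDerivAt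
  have h3 : HasFDerivAt (fun v => (fun q i j => pd q (fun w => G w i j) v :
      Fin m → Fin m → Fin m → ℝ))
      (ContinuousLinearMap.pi fun q => ContinuousLinearMap.pi fun i =>
        ContinuousLinearMap.pi fun j =>
        fderiv ℝ (fun v => pd q (fun w => G w i j) v) u) u := by
    refine hasFDerivAt_pi.2 fun q => hasFDerivAt_pi.2 fun i => hasFDerivAt_pi.2 fun j => ?_
    exact (differentiableAt_pd (hG i j) q).hasFDerivAt
  have h4 := h1.comp u (h2.prodMk h3)
  rw [christoffel_eq_jet, pd]
  have h5 : HasFDerivAt (fun u => christoffelJet k i j (jet1 G u)) _ u := h4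
  rw [h5.fderiv]
  rfl

/-- This turns the Ricci tensor, a differential operator, into a smooth function on a
finite-dimensional space, so that curves of jets over a fixed point of `S` can be compared by
calculus in `x` alone. -/
theorem ricciComps_eq_jet {G : Model m → Matrix (Fin m) (Fin m) ℝ} {u : Model m}
    (hG : ∀ i j, ContDiffAt ℝ 2 (fun v => G v i j) u) (hdet : (G u).det ≠ 0) (i j : Fin m) :
    ricciComps G u i j = ricciJet i j (jet2 G u) := by
  simp only [ricciComps, Matrix.of_apply, ricciJet, pd_christoffel hG hdet]
  rfl

theorem christoffel_smul {c : ℝ} (hc : c ≠ 0) (G : Model m → Matrix (Fin m) (Fin m) ℝ)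
    (k i j : Fin m) : christoffel (fun v => c • G v) k i j = christoffel G k i j := by
  funext u
  simp only [christoffel, Matrix.smul_apply, smul_eq_mul]
  have h1 : ∀ (p a b : Fin m), pd p (fun v => c * G v a b) u = c * pd p (fun v => G v a b) u := by
    intro p a b
    simp only [pd]
    rw [show (fun v => c * G v a b) = c • fun v => G v a b from rfl, fderiv_const_smul_field]
    simp
  have h2 : (c • G u)⁻¹ = c⁻¹ • (G u)⁻¹ := by
    -- For a singular matrix both inverses take the default value zero, so no nondegeneracy is
    -- needed.
    by_cases h : (G u).det = 0
    · have h' : (c • G u).det = 0 := by rw [Matrix.det_smul, h, mul_zero]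
      simp [Matrix.inv_def, h, h']
    · exact Matrix.inv_smul' (G u) (Units.mk0 c hc) (isUnit_iff_ne_zero.2 h)
  simp only [h1, h2, Matrix.smul_apply, smul_eq_mul]
  congr 1
  refine Finset.sum_congr rfl fun l _ => ?_
  field_simp

/-- The Ricci tensor is invariant under rescaling the metric by a constant. -/
theorem ricciComps_smul {c : ℝ} (hc : c ≠ 0) (G : Model m → Matrix (Fin m) (Fin m) ℝ)
    (u : Model m) : ricciComps (fun v => c • G v) u = ricciComps G u := by
  simp only [ricciComps, christoffel_smul hc]

theorem jet2_smul (c : ℝ) (G : Model m → Matrix (Fin m) (Fin m) ℝ) (u : Model m) :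
    jet2 (fun v => c • G v) u = c • jet2 G u := by
  have h1 : ∀ (p : Fin m) (f : Model m → ℝ) (u : Model m),
      pd p (fun v => c * f v) u = c * pd p f u := by
    intro p f u
    simp only [pd]
    rw [show (fun v => c * f v) = c • f from rfl, fderiv_const_smul_field]
    simp
  refine Prod.ext ?_ (Prod.ext ?_ ?_) <;> ext <;> simp [jet2, h1]

end Jets

/-! ### The tangential Einstein operator -/

section EinsteinOperator

variable {d : ℕ}

/-- The data entering the tangential Einstein equation in normal form: `x²`, the 2-jet of `h_x`
along `S`, `x h_x'` and `x² h_x''`. -/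
abbrev EinsteinJet (d : ℕ) : Type :=
  ℝ × MetricJet2 d × (Fin d → Fin d → ℝ) × (Fin d → Fin d → ℝ)

/-- `-2 x²` times the tangential part of `Ric(g) + d g` for `g = x⁻² (dx² + h_x)`. -/
def einsteinOp (i j : Fin d) (y : EinsteinJet d) : ℝ :=
  y.2.2.2 i j + (1 - (d : ℝ)) * y.2.2.1 i j -
    (∑ a, ∑ b, (Matrix.of y.2.1.1)⁻¹ a b * y.2.2.1 b a) * y.2.1.1 i j +
    1 / 2 * (∑ a, ∑ b, (Matrix.of y.2.1.1)⁻¹ a b * y.2.2.1 b a) * y.2.2.1 i j -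
    (∑ a, ∑ b, y.2.2.1 i a * (Matrix.of y.2.1.1)⁻¹ a b * y.2.2.1 b j) -
    2 * y.1 * ricciJet i j y.2.1

theorem contDiffAt_einsteinOp (i j : Fin d) {y : EinsteinJet d}
    (hy : (Matrix.of y.2.1.1).det ≠ 0) : ContDiffAt ℝ ∞ (einsteinOp i j) y := by
  have h1 : ∀ a b, ContDiffAt ℝ ∞ (fun y : EinsteinJet d => (Matrix.of y.2.1.1)⁻¹ a b) y :=
    fun a b => contDiffAt_inv_apply (f := fun y : EinsteinJet d => Matrix.of y.2.1.1)
      (fun a b => by simp only [Matrix.of_apply]; fun_prop) hy a b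
  have h2 : ContDiffAt ℝ ∞ (fun y : EinsteinJet d => ricciJet i j y.2.1) y :=
    ContDiffAt.comp (g := ricciJet i j) (f := fun y : EinsteinJet d => y.2.1) y
      (contDiffAt_ricciJet i j (J := y.2.1) hy) (by fun_prop)
  have hq : ContDiffAt ℝ ∞ (fun y : EinsteinJet d => y.2.2.2 i j) y := by fun_prop
  have hp : ∀ a b, ContDiffAt ℝ ∞ (fun y : EinsteinJet d => y.2.2.1 a b) y := fun a b => by
    fun_prop
  have hg : ContDiffAt ℝ ∞ (fun y : EinsteinJet d => y.2.1.1 i j) y := by fun_prop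
  have htr : ContDiffAt ℝ ∞ (fun y : EinsteinJet d =>
      ∑ a, ∑ b, (Matrix.of y.2.1.1)⁻¹ a b * y.2.2.1 b a) y :=
    ContDiffAt.sum fun a _ => ContDiffAt.sum fun b _ => (h1 a b).mul (hp b a)
  have hquad : ContDiffAt ℝ ∞ (fun y : EinsteinJet d =>
      ∑ a, ∑ b, y.2.2.1 i a * (Matrix.of y.2.1.1)⁻¹ a b * y.2.2.1 b j) y :=
    ContDiffAt.sum fun a _ => ContDiffAt.sum fun b _ => ((hp i a).mul (h1 a b)).mul (hp b j)
  exact ((((hq.add (contDiffAt_const.mul (hp i j))).sub (htr.mul hg)).add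
    ((contDiffAt_const.mul htr).mul (hp i j))).sub hquad).sub
    ((contDiffAt_const.mul contDiffAt_fst).mul h2)

/-- The derivative of the Einstein operator at `x = 0`. -/
theorem fderiv_einsteinOp (i j : Fin d) (J : MetricJet2 d) (hJ : (Matrix.of J.1).det ≠ 0)
    (v : EinsteinJet d) :
    fderiv ℝ (einsteinOp i j) (0, J, 0, 0) v = v.2.2.2 i j + (1 - (d : ℝ)) * v.2.2.1 i j -
      (∑ a, ∑ b, (Matrix.of J.1)⁻¹ a b * v.2.2.1 b a) * J.1 i j - 2 * v.1 * ricciJet i j J := by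
  set y₀ : EinsteinJet d := (0, J, 0, 0) with hy₀
  have h1 : HasFDerivAt (einsteinOp i j) (fderiv ℝ (einsteinOp i j) y₀) y₀ :=
    ((contDiffAt_einsteinOp i j (y := y₀) hJ).differentiableAt (by simp)).hasFDerivAt
  have h2 : HasDerivAt (fun t : ℝ => einsteinOp i j (y₀ + t • v))
      (fderiv ℝ (einsteinOp i j) y₀ v) 0 := by
    have h3 : HasDerivAt (fun t : ℝ => y₀ + t • v) v 0 := by
      simpa using ((hasDerivAt_id (0 : ℝ)).smul_const v).const_add y₀
    have h4 : HasFDerivAt (einsteinOp i j) (fderiv ℝ (einsteinOp i j) y₀) (y₀ + (0 : ℝ) • v) := by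
      simpa using h1
    exact h4.comp_hasDerivAt (0 : ℝ) h3
  -- Every term of the operator contains `s`, `p` or `q`, all zero at the base point, so a factor
  -- `t` splits off along the line. The derivative is then `Ψ 0`, and continuity of `Ψ` suffices:
  -- the Ricci term is never differentiated in the jet.
  set Ψ : ℝ → ℝ := fun t => v.2.2.2 i j + (1 - (d : ℝ)) * v.2.2.1 i j -
    (∑ a, ∑ b, (Matrix.of (J + t • v.2.1).1)⁻¹ a b * v.2.2.1 b a) * (J + t • v.2.1).1 i j +
    1 / 2 * (∑ a, ∑ b, (Matrix.of (J + t • v.2.1).1)⁻¹ a b * v.2.2.1 b a) *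
      (t * v.2.2.1 i j) -
    t * (∑ a, ∑ b, v.2.2.1 i a * (Matrix.of (J + t • v.2.1).1)⁻¹ a b * v.2.2.1 b j) -
    2 * v.1 * ricciJet i j (J + t • v.2.1) with hΨ
  have h5 : ∀ t : ℝ, einsteinOp i j (y₀ + t • v) = t * Ψ t := fun t => by
    simp only [einsteinOp, hΨ, hy₀, Prod.snd_add, Prod.fst_add, Prod.smul_snd, Prod.smul_fst,
      zero_add, Pi.smul_apply, smul_eq_mul]
    have e1 : ∀ A : Matrix (Fin d) (Fin d) ℝ, ∑ a, ∑ b, A a b * (t * v.2.2.1 b a) =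
        t * ∑ a, ∑ b, A a b * v.2.2.1 b a := fun A => by
      simp only [Finset.mul_sum]
      exact Finset.sum_congr rfl fun a _ => Finset.sum_congr rfl fun b _ => by ring
    have e2 : ∀ A : Matrix (Fin d) (Fin d) ℝ,
        ∑ a, ∑ b, (t * v.2.2.1 i a) * A a b * (t * v.2.2.1 b j) =
        t * (t * ∑ a, ∑ b, v.2.2.1 i a * A a b * v.2.2.1 b j) := fun A => by
      simp only [Finset.mul_sum]
      exact Finset.sum_congr rfl fun a _ => Finset.sum_congr rfl fun b _ => by ring
    rw [e1, e2]
    ring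
  have hline : ContinuousAt (fun t : ℝ => J + t • v.2.1) 0 := by fun_prop
  have hJ0 : J + (0 : ℝ) • v.2.1 = J := by simp
  have h6 : ContinuousAt Ψ 0 := by
    have c1 : ∀ a b, ContinuousAt (fun t : ℝ => (Matrix.of (J + t • v.2.1).1)⁻¹ a b) 0 :=
      fun a b => by
      have : ContDiffAt ℝ ∞ (fun J : MetricJet2 d => (Matrix.of J.1)⁻¹ a b) (J + (0 : ℝ) • v.2.1) :=
        contDiffAt_inv_apply (f := fun J : MetricJet2 d => Matrix.of J.1)
          (fun a b => by simp only [Matrix.of_apply]; fun_prop) (by rw [hJ0]; exact hJ) a b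
      exact ContinuousAt.comp (f := fun t : ℝ => J + t • v.2.1) this.continuousAt hline
    have c2 : ContinuousAt (fun t : ℝ => ricciJet i j (J + t • v.2.1)) 0 := by
      have : ContDiffAt ℝ ∞ (ricciJet i j) (J + (0 : ℝ) • v.2.1) :=
        contDiffAt_ricciJet i j (by rw [hJ0]; exact hJ)
      exact ContinuousAt.comp (f := fun t : ℝ => J + t • v.2.1) this.continuousAt hline
    have c3 : ContinuousAt (fun t : ℝ => (J + t • v.2.1).1 i j) 0 := by
      simp only [Prod.fst_add, Prod.smul_fst, Pi.add_apply, Pi.smul_apply]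
      fun_prop
    rw [hΨ]
    fun_prop
  have h7 : HasDerivAt (fun t : ℝ => einsteinOp i j (y₀ + t • v)) (Ψ 0) 0 := by
    rw [hasDerivAt_iff_tendsto_slope]
    refine (h6.tendsto.mono_left nhdsWithin_le_nhds).congr' ?_
    filter_upwards [self_mem_nhdsWithin] with t ht
    have ht : t ≠ 0 := ht
    rw [slope_def_field, h5, h5]
    field_simp
    ring
  rw [h2.unique h7, hΨ]
  simp

end EinsteinOperator

/-! ### Comparing expansions of approximate solutions -/

section Comparison

variable {d : ℕ}

/-- The indicial operator `p ↦ D (D - d) p - tr(D p) g` acting on coefficients of `x^k`. -/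
def indicialOp (g gi : Fin d → Fin d → ℝ) (k : ℕ) (p : Fin d → Fin d → ℝ[X]) (i j : Fin d) :
    ℝ[X] :=
  eulerOp k (eulerOp k (p i j)) - (d : ℝ) • eulerOp k (p i j) -
    g i j • ∑ a, ∑ b, gi a b • eulerOp k (p b a)

/-- The curve `y` in the space of Einstein data comes from a family of metrics with the expansion
coefficients `c`, having first and second derivatives `dc` and `ddc`. -/
structure JetExpansion (N : ℕ) (y : ℝ → EinsteinJet d) (c : ℕ → Fin d → Fin d → ℝ[X])
    (dc : ℕ → Fin d → Fin d → Fin d → ℝ[X])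
    (ddc : ℕ → Fin d → Fin d → Fin d → Fin d → ℝ[X]) : Prop where
  sq : ∀ x, (y x).1 = x ^ 2
  metric : ∀ i j, LogExpansion N (fun x => (y x).2.1.1 i j) fun k => c k i j
  deriv_one : ∀ p i j, LogExpansion N (fun x => (y x).2.1.2.1 p i j) fun k => dc k p i j
  deriv_two : ∀ p q i j, LogExpansion N (fun x => (y x).2.1.2.2 p q i j) fun k => ddc k p q i j
  euler : ∀ i j, LogExpansion N (fun x => (y x).2.2.1 i j) fun k => eulerOp k (c k i j)
  euler_two : ∀ i j, LogExpansion N (fun x => (y x).2.2.2 i j)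
    fun k => eulerOp k (eulerOp k (c k i j)) - eulerOp k (c k i j)

variable {N : ℕ} {y₁ y₂ : ℝ → EinsteinJet d} {c e : ℕ → Fin d → Fin d → ℝ[X]}
  {dc de : ℕ → Fin d → Fin d → Fin d → ℝ[X]}
  {ddc dde : ℕ → Fin d → Fin d → Fin d → Fin d → ℝ[X]}

theorem JetExpansion.sub_isBigO (h₁ : JetExpansion N y₁ c dc ddc)
    (h₂ : JetExpansion N y₂ e de dde) {k : ℕ} (hk : k ≤ N)
    (hc : ∀ j < k, c j = e j) (hdc : ∀ j < k, dc j = de j) (hddc : ∀ j < k, ddc j = dde j) :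
    (fun x => y₁ x - y₂ x) =O[𝓝[>] 0] fun x : ℝ => x ^ k * logWeight x := by
  refine IsBigO.prod_left ?_ (IsBigO.prod_left (IsBigO.prod_left ?_
    (IsBigO.prod_left ?_ ?_)) (IsBigO.prod_left ?_ ?_))
  · simp only [h₁.sq, h₂.sq, sub_self]
    exact isBigO_zero _ _
  · exact isBigO_pi.2 fun i => isBigO_pi.2 fun j => ((h₁.metric i j).sub (h₂.metric i j)).isBigO hk
      fun l hl => by simp [hc l hl]
  · exact isBigO_pi.2 fun p => isBigO_pi.2 fun i => isBigO_pi.2 fun j =>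
      ((h₁.deriv_one p i j).sub (h₂.deriv_one p i j)).isBigO hk fun l hl => by simp [hdc l hl]
  · exact isBigO_pi.2 fun p => isBigO_pi.2 fun q => isBigO_pi.2 fun i => isBigO_pi.2 fun j =>
      ((h₁.deriv_two p q i j).sub (h₂.deriv_two p q i j)).isBigO hk
        fun l hl => by simp [hddc l hl]
  · exact isBigO_pi.2 fun i => isBigO_pi.2 fun j => ((h₁.euler i j).sub (h₂.euler i j)).isBigO hk
      fun l hl => by simp [hc l hl]
  · exact isBigO_pi.2 fun i => isBigO_pi.2 fun j =>
      ((h₁.euler_two i j).sub (h₂.euler_two i j)).isBigO hk fun l hl => by simp [hc l hl]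

/-- The components `x²` of the two curves cancel, and the Ricci term with them. What remains has
coefficient `(D² - D) + (1 - d) D = D (D - d)`, minus the trace term. -/
theorem JetExpansion.fderiv_sub (h₁ : JetExpansion N y₁ c dc ddc)
    (h₂ : JetExpansion N y₂ e de dde) (J : MetricJet2 d) (hJ : (Matrix.of J.1).det ≠ 0)
    (i j : Fin d) :
    LogExpansion N (fun x => fderiv ℝ (einsteinOp i j) (0, J, 0, 0) (y₁ x - y₂ x))
      fun k => indicialOp J.1 (fun a b => (Matrix.of J.1)⁻¹ a b) k (c k - e k) i j := by
  have hp := fun i j => (h₁.euler i j).sub (h₂.euler i j)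
  have hq := fun i j => (h₁.euler_two i j).sub (h₂.euler_two i j)
  have htr := LogExpansion.sum Finset.univ fun a _ => LogExpansion.sum Finset.univ fun b _ =>
    (hp b a).const_mul ((Matrix.of J.1)⁻¹ a b)
  have hall := ((hq i j).add ((hp i j).const_mul (1 - (d : ℝ)))).sub (htr.const_mul (J.1 i j))
  refine (hall.congr' (Eventually.of_forall fun x => ?_)).congr_coeff fun k _ => ?_
  · simp only [fderiv_einsteinOp i j J hJ, Prod.fst_sub, Prod.snd_sub, Pi.sub_apply, h₁.sq, h₂.sq]
    ring
  · simp only [indicialOp, Pi.sub_apply, map_sub, Polynomial.smul_eq_C_mul, Polynomial.C_1]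
    ring

/-- If `y₁` is an approximate solution of the Einstein equation and `y₂` is a reference curve, then
the expansion coefficients of the difference solve the indicial equation. -/
theorem JetExpansion.indicial (h₁ : JetExpansion N y₁ c dc ddc)
    (h₂ : JetExpansion N y₂ e de dde) {J : MetricJet2 d} (hJ : (Matrix.of J.1).det ≠ 0)
    (h₂₀ : (fun x => y₂ x - (0, J, 0, 0)) =O[𝓝[>] 0] fun x : ℝ => x ^ 2) {k m : ℕ} (hk : 1 ≤ k)
    (hkN : k ≤ N) (hmN : m ≤ N) (hm : m ≤ k + 1) (hmk : m + 1 ≤ 2 * k)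
    (hc : ∀ j < k, c j = e j) (hdc : ∀ j < k, dc j = de j) (hddc : ∀ j < k, ddc j = dde j)
    (i j : Fin d) (hsol : (fun x => einsteinOp i j (y₁ x)) =o[𝓝[>] 0] fun x : ℝ => x ^ m)
    {t : ℕ → ℝ[X]} (href : LogExpansion N (fun x => einsteinOp i j (y₂ x)) t) :
    ∀ l ≤ m, indicialOp J.1 (fun a b => (Matrix.of J.1)⁻¹ a b) l (c l - e l) i j + t l = 0 := by
  have hf : ContDiffAt ℝ 2 (einsteinOp i j) ((0, J, 0, 0) : EinsteinJet d) :=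
    (contDiffAt_einsteinOp i j (y := (0, J, 0, 0)) hJ).of_le (by norm_cast)
  -- Through order `m` the nonlinear equation may be replaced by its linearisation, so uniqueness of
  -- expansions applies order by order.
  have h3 := isLittleO_sub_fderiv hf hk hm hmk h₂₀ (h₁.sub_isBigO h₂ hkN hc hdc hddc)
  have h4 := (h₁.fderiv_sub h₂ J hJ i j).add href
  refine h4.eq_zero hmN ?_
  exact (hsol.sub h3).congr_left fun x => by ring

/-- The curve of Einstein data, as a function of `s = x²`, of the family `∑ x^k e_k`, where only the
even `k` are used. -/
def evenCurve (K : ℕ) (e : ℕ → MetricJet2 d) (s : ℝ) : EinsteinJet d :=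
  (s, ∑ k ∈ Finset.range (K + 1), s ^ (k / 2) • e k,
    ∑ k ∈ Finset.range (K + 1), (k * s ^ (k / 2)) • (e k).1,
    ∑ k ∈ Finset.range (K + 1), (k * (k - 1) * s ^ (k / 2)) • (e k).1)

theorem contDiff_evenCurve (K : ℕ) (e : ℕ → MetricJet2 d) : ContDiff ℝ ∞ (evenCurve K e) := by
  unfold evenCurve
  fun_prop

theorem evenCurve_zero (K : ℕ) {e : ℕ → MetricJet2 d} (hodd : ∀ k, Odd k → e k = 0) :
    evenCurve K e 0 = (0, e 0, 0, 0) := by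
  have h1 : ∀ k, k ≠ 0 → (0 : ℝ) ^ (k / 2) • e k = 0 := fun k hk => by
    rcases Nat.even_or_odd k with h | h
    · obtain ⟨r, rfl⟩ := h
      rw [zero_pow (by omega), zero_smul]
    · rw [hodd k h, smul_zero]
  have h2 : ∀ k, k ≠ 0 → (0 : ℝ) ^ (k / 2) • (e k).1 = 0 := fun k hk =>
    congrArg Prod.fst (h1 k hk)
  refine Prod.ext rfl (Prod.ext ?_ (Prod.ext ?_ ?_))
  · change ∑ k ∈ Finset.range (K + 1), (0 : ℝ) ^ (k / 2) • e k = e 0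
    rw [Finset.sum_eq_single 0 (fun k _ hk => h1 k hk) (by simp)]
    simp
  · change ∑ k ∈ Finset.range (K + 1), ((k : ℝ) * 0 ^ (k / 2)) • (e k).1 = 0
    refine Finset.sum_eq_zero fun k _ => ?_
    rcases eq_or_ne k 0 with rfl | hk
    · simp
    · rw [mul_smul, h2 k hk, smul_zero]
  · change ∑ k ∈ Finset.range (K + 1), ((k : ℝ) * (k - 1) * 0 ^ (k / 2)) • (e k).1 = 0
    refine Finset.sum_eq_zero fun k _ => ?_
    rcases eq_or_ne k 0 with rfl | hk
    · simp
    · rw [mul_smul, h2 k hk, smul_zero]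

/-- The curve is smooth in `s`, so it moves by `O(s)`, and `s = x²`. This is where evenness of the
reference family pays off. -/
theorem evenCurve_sub_isBigO (K : ℕ) {e : ℕ → MetricJet2 d} (hodd : ∀ k, Odd k → e k = 0) :
    (fun x : ℝ => evenCurve K e (x ^ 2) - (0, e 0, 0, 0)) =O[𝓝[>] 0] fun x : ℝ => x ^ 2 := by
  have h1 : HasDerivAt (evenCurve K e) (deriv (evenCurve K e) 0) 0 :=
    ((contDiff_evenCurve K e).differentiable (by simp) 0).hasDerivAt
  have h2 : Tendsto (fun x : ℝ => x ^ 2) (𝓝[>] 0) (𝓝 0) := by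
    have := (continuous_pow 2).tendsto (0 : ℝ)
    simp only [ne_eq, OfNat.ofNat_ne_zero, not_false_eq_true, zero_pow] at this
    exact this.mono_left nhdsWithin_le_nhds
  have h3 := h1.hasFDerivAt.isBigO_sub.comp_tendsto h2
  refine h3.congr (fun x => ?_) (fun x => ?_)
  · simp [evenCurve_zero K hodd]
  · simp

theorem jetExpansion_evenCurve (K : ℕ) {e : ℕ → MetricJet2 d} (hodd : ∀ k, Odd k → e k = 0)
    (hK : ∀ k, K < k → e k = 0) :
    JetExpansion N (fun x => evenCurve K e (x ^ 2)) (fun k i j => Polynomial.C ((e k).1 i j))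
      (fun k p i j => Polynomial.C ((e k).2.1 p i j))
      (fun k p q i j => Polynomial.C ((e k).2.2 p q i j)) := by
  -- The rounding in `k / 2` is harmless: for odd `k` the coefficient is zero.
  have h1 : ∀ (k : ℕ) (x : ℝ) , (x ^ 2) ^ (k / 2) • e k = x ^ k • e k := fun k x => by
    rcases Nat.even_or_odd k with h | h
    · rw [← pow_mul, Nat.mul_div_cancel' h.two_dvd]
    · rw [hodd k h, smul_zero, smul_zero]
  have h2 : ∀ (k : ℕ) (x : ℝ), (x ^ 2) ^ (k / 2) • (e k).1 = x ^ k • (e k).1 := fun k x =>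
    congrArg Prod.fst (h1 k x)
  have hJ : ∀ x : ℝ, (evenCurve K e (x ^ 2)).2.1 = ∑ k ∈ Finset.range (K + 1), x ^ k • e k :=
    fun x => by simp only [evenCurve, h1]
  have hp : ∀ x : ℝ, (evenCurve K e (x ^ 2)).2.2.1 =
      ∑ k ∈ Finset.range (K + 1), (k : ℝ) • x ^ k • (e k).1 := fun x => by
    simp only [evenCurve, mul_smul, h2]
  have hq : ∀ x : ℝ, (evenCurve K e (x ^ 2)).2.2.2 =
      ∑ k ∈ Finset.range (K + 1), ((k : ℝ) * (k - 1)) • x ^ k • (e k).1 := fun x => by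
    simp only [evenCurve, mul_smul, h2]
  constructor
  · intro x; rfl
  · intro i j
    refine (LogExpansion.of_sum K (fun k => (e k).1 i j) fun k hk => by simp [hK k hk]).congr'
      (Eventually.of_forall fun x => ?_)
    simp [hJ, Prod.fst_sum, Finset.sum_apply, mul_comm]
  · intro p i j
    refine (LogExpansion.of_sum K (fun k => (e k).2.1 p i j) fun k hk => by simp [hK k hk]).congr'
      (Eventually.of_forall fun x => ?_)
    simp [hJ, Prod.fst_sum, Prod.snd_sum, Finset.sum_apply, mul_comm]
  · intro p q i j
    refine (LogExpansion.of_sum K (fun k => (e k).2.2 p q i j) fun k hk => by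
      simp [hK k hk]).congr' (Eventually.of_forall fun x => ?_)
    simp [hJ, Prod.snd_sum, Finset.sum_apply, mul_comm]
  · intro i j
    refine ((LogExpansion.of_sum K (fun k => k * (e k).1 i j) fun k hk => by
      simp [hK k hk]).congr' (Eventually.of_forall fun x => ?_)).congr_coeff fun k _ => by simp
    simp only [hp, Finset.sum_apply, Pi.smul_apply, smul_eq_mul]
    exact Finset.sum_congr rfl fun k _ => by ring
  · intro i j
    refine ((LogExpansion.of_sum K (fun k => k * (k - 1) * (e k).1 i j) fun k hk => by
      simp [hK k hk]).congr' (Eventually.of_forall fun x => ?_)).congr_coeff fun k _ => ?_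
    · simp only [hq, Finset.sum_apply, Pi.smul_apply, smul_eq_mul]
      exact Finset.sum_congr rfl fun k _ => by ring
    · simp only [eulerOp_C, ← Polynomial.C_sub]
      congr 1
      ring

theorem sum_inv_mul_self {g : Fin d → Fin d → ℝ} (hg : (Matrix.of g).det ≠ 0) :
    ∑ a, ∑ b, (Matrix.of g)⁻¹ a b * g b a = d := by
  have h := Matrix.nonsing_inv_mul (Matrix.of g) (isUnit_iff_ne_zero.2 hg)
  have h2 := congrArg Matrix.trace h
  simpa [Matrix.trace, Matrix.mul_apply] using h2

/-- Consequences of the indicial equation for the coefficient of `x^k`. -/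
theorem indicialOp_eq_zero {k : ℕ} (hk : 1 ≤ k) (hkd : k < 2 * d) {g : Fin d → Fin d → ℝ}
    (hg : (Matrix.of g).det ≠ 0) {p : Fin d → Fin d → ℝ[X]}
    (h : ∀ i j, indicialOp g (fun a b => (Matrix.of g)⁻¹ a b) k p i j = 0) (i j : Fin d) :
    ((k : ℝ) - d) • p i j + Polynomial.derivative (p i j) = 0 := by
  have h1 := (indicial_equation hk hkd g _ (sum_inv_mul_self hg) p h).1 i j
  rw [eulerOp_apply] at h1
  rw [← h1, sub_smul]
  abel

end Comparison

/-! ### The Ricci tensor of `x⁻² (dx² + h_x)` -/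

section Collar

variable {d : ℕ}

/-- The linear coordinates `(x, u)` on `ℝ^(d+1)`. -/
def collarCoord (d : ℕ) : (ℝ × Model d) ≃L[ℝ] Model (d + 1) :=
  LinearEquiv.toContinuousLinearEquiv
    { toFun := fun z => WithLp.toLp 2 (Fin.cons z.1 z.2.ofLp : Fin (d + 1) → ℝ)
      invFun := fun w => (w 0, WithLp.toLp 2 fun i => w i.succ)
      map_add' := fun z w => by
        ext i; refine Fin.cases ?_ (fun i => ?_) i <;> simp
      map_smul' := fun a z => by
        ext i; refine Fin.cases ?_ (fun i => ?_) i <;> simp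
      left_inv := fun z => by simp
      right_inv := fun w => by
        ext i; refine Fin.cases ?_ (fun i => ?_) i <;> simp }

@[simp]
theorem collarCoord_apply_zero (z : ℝ × Model d) : collarCoord d z 0 = z.1 := rfl

@[simp]
theorem collarCoord_apply_succ (z : ℝ × Model d) (i : Fin d) :
    collarCoord d z i.succ = z.2 i := rfl

theorem collarCoord_one_zero : collarCoord d (1, 0) = stdVec (d + 1) 0 := by
  ext i
  refine Fin.cases ?_ (fun i => ?_) i <;> simp [stdVec]

theorem collarCoord_zero_stdVec (j : Fin d) :
    collarCoord d (0, stdVec d j) = stdVec (d + 1) j.succ := by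
  ext i
  refine Fin.cases ?_ (fun i => ?_) i
  · simp [stdVec, (Fin.succ_ne_zero j).symm]
  · simp [stdVec]

/-- Agreement near `z` is enough; this matters because the form of the collar metric is only known
on the open set `W`. -/
theorem fderiv_collarCoord {F : Model (d + 1) → ℝ} {f : ℝ × Model d → ℝ} {z : ℝ × Model d}
    (h : ∀ᶠ w in 𝓝 z, F (collarCoord d w) = f w) (v : ℝ × Model d) :
    fderiv ℝ F (collarCoord d z) (collarCoord d v) = fderiv ℝ f z v := by
  have h1 : fderiv ℝ (F ∘ collarCoord d) z = fderiv ℝ f z := Filter.EventuallyEq.fderiv_eq h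
  rw [← h1, ContinuousLinearEquiv.comp_right_fderiv]
  rfl

theorem pd_zero_collarCoord {F : Model (d + 1) → ℝ} {f : ℝ × Model d → ℝ} {z : ℝ × Model d}
    (h : ∀ᶠ w in 𝓝 z, F (collarCoord d w) = f w) :
    pd 0 F (collarCoord d z) = fderiv ℝ f z (1, 0) := by
  rw [pd, ← collarCoord_one_zero, fderiv_collarCoord h]

theorem pd_succ_collarCoord {F : Model (d + 1) → ℝ} {f : ℝ × Model d → ℝ} {z : ℝ × Model d}
    (h : ∀ᶠ w in 𝓝 z, F (collarCoord d w) = f w) (i : Fin d) :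
    pd i.succ F (collarCoord d z) = fderiv ℝ f z (0, stdVec d i) := by
  rw [pd, ← collarCoord_zero_stdVec, fderiv_collarCoord h]

theorem hasDerivAt_slice {f : ℝ × Model d → ℝ} {z : ℝ × Model d} (h : DifferentiableAt ℝ f z) :
    HasDerivAt (fun s => f (s, z.2)) (fderiv ℝ f z (1, 0)) z.1 := by
  have h1 : HasFDerivAt f (fderiv ℝ f z) (z.1, z.2) := h.hasFDerivAt
  exact h1.comp_hasDerivAt z.1 ((hasDerivAt_id z.1).prodMk (hasDerivAt_const z.1 z.2))

theorem pd_slice {f : ℝ × Model d → ℝ} {z : ℝ × Model d} (h : DifferentiableAt ℝ f z)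
    (i : Fin d) : pd i (fun v => f (z.1, v)) z.2 = fderiv ℝ f z (0, stdVec d i) := by
  have h1 : HasFDerivAt f (fderiv ℝ f z) (z.1, z.2) := h.hasFDerivAt
  have h2 := h1.comp z.2 ((hasFDerivAt_const z.1 z.2).prodMk (hasFDerivAt_id z.2))
  have h3 : HasFDerivAt (fun v => f (z.1, v)) _ z.2 := h2
  rw [pd, h3.fderiv]
  rfl

/-- On the open set `W`, the metric `G` has the form `x⁻² (dx² + k_x)`. -/
structure IsCollarMetric (W : Set (ℝ × Model d))
    (G : Model (d + 1) → Matrix (Fin (d + 1)) (Fin (d + 1)) ℝ)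
    (k : ℝ → Model d → Matrix (Fin d) (Fin d) ℝ) : Prop where
  isOpen : IsOpen W
  pos : ∀ z ∈ W, 0 < z.1
  smooth : ∀ i j, ContDiffOn ℝ 2 (fun z : ℝ × Model d => k z.1 z.2 i j) W
  symm : ∀ z ∈ W, ∀ i j, k z.1 z.2 i j = k z.1 z.2 j i
  det_ne : ∀ z ∈ W, (k z.1 z.2).det ≠ 0
  zero_zero : ∀ z ∈ W, G (collarCoord d z) 0 0 = (z.1 ^ 2)⁻¹
  zero_succ : ∀ z ∈ W, ∀ j : Fin d, G (collarCoord d z) 0 j.succ = 0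
  succ_zero : ∀ z ∈ W, ∀ j : Fin d, G (collarCoord d z) j.succ 0 = 0
  succ_succ : ∀ z ∈ W, ∀ i j : Fin d,
    G (collarCoord d z) i.succ j.succ = (z.1 ^ 2)⁻¹ * k z.1 z.2 i j

namespace IsCollarMetric

variable {W : Set (ℝ × Model d)} {G : Model (d + 1) → Matrix (Fin (d + 1)) (Fin (d + 1)) ℝ}
  {k : ℝ → Model d → Matrix (Fin d) (Fin d) ℝ} {z : ℝ × Model d}

theorem inv_eq (h : IsCollarMetric W G k) (hz : z ∈ W) :
    (G (collarCoord d z))⁻¹ = Matrix.of (Fin.cons (Fin.cons (z.1 ^ 2) fun _ => 0)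
      fun i => Fin.cons 0 fun j => z.1 ^ 2 * (k z.1 z.2)⁻¹ i j) := by
  have hx : z.1 ≠ 0 := (h.pos z hz).ne'
  have hk : k z.1 z.2 * (k z.1 z.2)⁻¹ = 1 :=
    Matrix.mul_nonsing_inv _ (isUnit_iff_ne_zero.2 (h.det_ne z hz))
  refine Matrix.inv_eq_right_inv ?_
  ext i j
  refine Fin.cases ?_ (fun i => ?_) i <;> refine Fin.cases ?_ (fun j => ?_) j
  · simp [Matrix.mul_apply, Fin.sum_univ_succ, h.zero_zero z hz, h.zero_succ z hz, hx]
  · simp [Matrix.mul_apply, Fin.sum_univ_succ, h.zero_succ z hz, (Fin.succ_ne_zero j).symm]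
  · simp [Matrix.mul_apply, Fin.sum_univ_succ, h.succ_zero z hz, Fin.succ_ne_zero]
  · have h1 := congrFun (congrFun hk i) j
    rw [Matrix.mul_apply] at h1
    simp only [Matrix.mul_apply, Fin.sum_univ_succ, h.succ_zero z hz, h.succ_succ z hz,
      Matrix.of_apply, Fin.cons_succ, Fin.cons_zero, zero_mul, zero_add]
    simp only [Matrix.one_apply, Fin.succ_inj] at h1 ⊢
    rw [← h1]
    refine Finset.sum_congr rfl fun l _ => ?_
    field_simp

theorem differentiableAt (h : IsCollarMetric W G k) (hz : z ∈ W) (i j : Fin d) :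
    DifferentiableAt ℝ (fun z : ℝ × Model d => k z.1 z.2 i j) z :=
  ((h.smooth i j).contDiffAt (h.isOpen.mem_nhds hz)).differentiableAt (by norm_num)

theorem eventually_mem (h : IsCollarMetric W G k) (hz : z ∈ W) : ∀ᶠ w in 𝓝 z, w ∈ W :=
  h.isOpen.mem_nhds hz

theorem pd_zero_zero_zero (h : IsCollarMetric W G k) (hz : z ∈ W) :
    pd 0 (fun v => G v 0 0) (collarCoord d z) = -2 * (z.1 ^ 3)⁻¹ := by
  have hx : z.1 ≠ 0 := (h.pos z hz).ne'
  rw [pd_zero_collarCoord ((h.eventually_mem hz).mono fun w hw => h.zero_zero w hw)]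
  have h1 : HasDerivAt (fun s : ℝ => (s ^ 2)⁻¹) (-2 * (z.1 ^ 3)⁻¹) z.1 := by
    refine ((hasDerivAt_pow 2 z.1).fun_inv (pow_ne_zero 2 hx)).congr_deriv ?_
    norm_num
    field_simp
  refine HasDerivAt.unique (hasDerivAt_slice (f := fun w : ℝ × Model d => (w.1 ^ 2)⁻¹) ?_) h1
  exact (differentiableAt_fst.pow 2).inv (pow_ne_zero 2 hx)

theorem pd_succ_zero_zero (h : IsCollarMetric W G k) (hz : z ∈ W) (p : Fin d) :
    pd p.succ (fun v => G v 0 0) (collarCoord d z) = 0 := by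
  have hx : z.1 ≠ 0 := (h.pos z hz).ne'
  rw [pd_succ_collarCoord ((h.eventually_mem hz).mono fun w hw => h.zero_zero w hw),
    ← pd_slice (f := fun w : ℝ × Model d => (w.1 ^ 2)⁻¹)]
  · simp [pd]
  · exact (differentiableAt_fst.pow 2).inv (pow_ne_zero 2 hx)

theorem pd_zero_succ (h : IsCollarMetric W G k) (hz : z ∈ W) (p : Fin (d + 1)) (j : Fin d) :
    pd p (fun v => G v 0 j.succ) (collarCoord d z) = 0 := by
  have h1 : ∀ᶠ w in 𝓝 z, G (collarCoord d w) 0 j.succ = 0 :=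
    (h.eventually_mem hz).mono fun w hw => h.zero_succ w hw j
  refine Fin.cases ?_ (fun p => ?_) p
  · rw [pd_zero_collarCoord (F := fun v => G v 0 j.succ) h1]; simp
  · rw [pd_succ_collarCoord (F := fun v => G v 0 j.succ) h1]; simp

theorem pd_succ_zero (h : IsCollarMetric W G k) (hz : z ∈ W) (p : Fin (d + 1)) (j : Fin d) :
    pd p (fun v => G v j.succ 0) (collarCoord d z) = 0 := by
  have h1 : ∀ᶠ w in 𝓝 z, G (collarCoord d w) j.succ 0 = 0 :=
    (h.eventually_mem hz).mono fun w hw => h.succ_zero w hw j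
  refine Fin.cases ?_ (fun p => ?_) p
  · rw [pd_zero_collarCoord (F := fun v => G v j.succ 0) h1]; simp
  · rw [pd_succ_collarCoord (F := fun v => G v j.succ 0) h1]; simp

theorem pd_zero_succ_succ (h : IsCollarMetric W G k) (hz : z ∈ W) (i j : Fin d) :
    pd 0 (fun v => G v i.succ j.succ) (collarCoord d z) =
      (z.1 ^ 2)⁻¹ * deriv (fun s => k s z.2 i j) z.1 - 2 * (z.1 ^ 3)⁻¹ * k z.1 z.2 i j := by
  have hx : z.1 ≠ 0 := (h.pos z hz).ne'
  rw [pd_zero_collarCoord ((h.eventually_mem hz).mono fun w hw => h.succ_succ w hw i j)]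
  have h0 := (hasDerivAt_slice (h.differentiableAt hz i j)).differentiableAt.hasDerivAt
  have h1 : HasDerivAt (fun s : ℝ => (s ^ 2)⁻¹ * k s z.2 i j)
      ((z.1 ^ 2)⁻¹ * deriv (fun s => k s z.2 i j) z.1 - 2 * (z.1 ^ 3)⁻¹ * k z.1 z.2 i j) z.1 := by
    refine (((hasDerivAt_pow 2 z.1).fun_inv (pow_ne_zero 2 hx)).mul h0).congr_deriv ?_
    norm_num
    field_simp
    ring
  refine HasDerivAt.unique (hasDerivAt_slice
    (f := fun w : ℝ × Model d => (w.1 ^ 2)⁻¹ * k w.1 w.2 i j) ?_) h1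
  exact ((differentiableAt_fst.pow 2).inv (pow_ne_zero 2 hx)).mul (h.differentiableAt hz i j)

theorem pd_succ_succ_succ (h : IsCollarMetric W G k) (hz : z ∈ W) (p i j : Fin d) :
    pd p.succ (fun v => G v i.succ j.succ) (collarCoord d z) =
      (z.1 ^ 2)⁻¹ * pd p (fun u => k z.1 u i j) z.2 := by
  have hx : z.1 ≠ 0 := (h.pos z hz).ne'
  rw [pd_succ_collarCoord ((h.eventually_mem hz).mono fun w hw => h.succ_succ w hw i j),
    ← pd_slice (f := fun w : ℝ × Model d => (w.1 ^ 2)⁻¹ * k w.1 w.2 i j)]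
  · simp only [pd]
    rw [show (fun v => (z.1 ^ 2)⁻¹ * k z.1 v i j) = (z.1 ^ 2)⁻¹ • fun v => k z.1 v i j from rfl,
      fderiv_const_smul_field]
    simp
  · exact ((differentiableAt_fst.pow 2).inv (pow_ne_zero 2 hx)).mul (h.differentiableAt hz i j)

theorem deriv_symm (h : IsCollarMetric W G k) (hz : z ∈ W) (i j : Fin d) :
    deriv (fun s => k s z.2 i j) z.1 = deriv (fun s => k s z.2 j i) z.1 := by
  refine Filter.EventuallyEq.deriv_eq ?_
  have h1 : Tendsto (fun s : ℝ => (s, z.2)) (𝓝 z.1) (𝓝 z) := by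
    have : ContinuousAt (fun s : ℝ => (s, z.2)) z.1 := by fun_prop
    exact this
  filter_upwards [h1 (h.isOpen.mem_nhds hz)] with s hs
  exact h.symm _ hs i j

theorem inv_symm (h : IsCollarMetric W G k) (hz : z ∈ W) (i j : Fin d) :
    (k z.1 z.2)⁻¹ i j = (k z.1 z.2)⁻¹ j i := by
  have h1 : (k z.1 z.2).transpose = k z.1 z.2 := by
    ext a b; exact h.symm z hz b a
  have h2 := Matrix.transpose_nonsing_inv (k z.1 z.2)
  rw [h1] at h2
  exact (congrFun (congrFun h2 i) j).symm

theorem inv_mul_apply (h : IsCollarMetric W G k) (hz : z ∈ W) (i j : Fin d) :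
    ∑ l, (k z.1 z.2)⁻¹ i l * k z.1 z.2 j l = if i = j then 1 else 0 := by
  have h1 := Matrix.nonsing_inv_mul (k z.1 z.2) (isUnit_iff_ne_zero.2 (h.det_ne z hz))
  have h2 := congrFun (congrFun h1 i) j
  rw [Matrix.mul_apply, Matrix.one_apply] at h2
  rw [← h2]
  exact Finset.sum_congr rfl fun l _ => by rw [h.symm z hz j l]

theorem christoffel_zero_zero_zero (h : IsCollarMetric W G k) (hz : z ∈ W) :
    christoffel G 0 0 0 (collarCoord d z) = -z.1⁻¹ := by
  have hx : z.1 ≠ 0 := (h.pos z hz).ne'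
  simp only [christoffel, Fin.sum_univ_succ, h.inv_eq hz, Matrix.of_apply, Fin.cons_zero,
    Fin.cons_succ, zero_mul, Finset.sum_const_zero, h.pd_zero_zero_zero hz]
  field_simp
  ring

theorem christoffel_zero_zero_succ (h : IsCollarMetric W G k) (hz : z ∈ W) (j : Fin d) :
    christoffel G 0 0 j.succ (collarCoord d z) = 0 := by
  simp [christoffel, Fin.sum_univ_succ, h.inv_eq hz, h.pd_zero_succ hz, h.pd_succ_zero hz,
    h.pd_succ_zero_zero hz]

theorem christoffel_zero_succ_zero (h : IsCollarMetric W G k) (hz : z ∈ W) (j : Fin d) :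
    christoffel G 0 j.succ 0 (collarCoord d z) = 0 := by
  simp [christoffel, Fin.sum_univ_succ, h.inv_eq hz, h.pd_zero_succ hz, h.pd_succ_zero hz,
    h.pd_succ_zero_zero hz]

theorem christoffel_zero_succ_succ (h : IsCollarMetric W G k) (hz : z ∈ W) (i j : Fin d) :
    christoffel G 0 i.succ j.succ (collarCoord d z) =
      -(1 / 2) * deriv (fun s => k s z.2 i j) z.1 + z.1⁻¹ * k z.1 z.2 i j := by
  have hx : z.1 ≠ 0 := (h.pos z hz).ne'
  simp only [christoffel, Fin.sum_univ_succ, h.inv_eq hz, Matrix.of_apply, Fin.cons_zero,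
    Fin.cons_succ, zero_mul, Finset.sum_const_zero, h.pd_succ_zero hz, h.pd_zero_succ_succ hz]
  field_simp
  ring

theorem christoffel_succ_succ_zero (h : IsCollarMetric W G k) (hz : z ∈ W) (a i : Fin d) :
    christoffel G a.succ i.succ 0 (collarCoord d z) =
      1 / 2 * ∑ l, (k z.1 z.2)⁻¹ a l * deriv (fun s => k s z.2 i l) z.1 -
        z.1⁻¹ * if a = i then 1 else 0 := by
  have hx : z.1 ≠ 0 := (h.pos z hz).ne'
  simp only [christoffel, Fin.sum_univ_succ, h.inv_eq hz, Matrix.of_apply, Fin.cons_zero,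
    Fin.cons_succ, zero_mul, h.pd_succ_zero hz, h.pd_zero_succ hz, h.pd_zero_succ_succ hz,
    zero_add, sub_zero]
  rw [← h.inv_mul_apply hz, Finset.mul_sum, Finset.mul_sum, Finset.mul_sum,
    ← Finset.sum_sub_distrib]
  refine Finset.sum_congr rfl fun l _ => ?_
  field_simp

theorem christoffel_succ_succ_succ (h : IsCollarMetric W G k) (hz : z ∈ W) (a i j : Fin d) :
    christoffel G a.succ i.succ j.succ (collarCoord d z) = christoffel (k z.1) a i j z.2 := by
  have hx : z.1 ≠ 0 := (h.pos z hz).ne'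
  simp only [christoffel, Fin.sum_univ_succ, h.inv_eq hz, Matrix.of_apply, Fin.cons_zero,
    Fin.cons_succ, zero_mul, h.pd_succ_succ_succ hz, zero_add]
  congr 1
  refine Finset.sum_congr rfl fun l _ => ?_
  field_simp

/-- Joint differentiability in `(x, u)` is what identifies partial derivatives in the bulk with
derivatives along the slices. It follows from the joint `C²` regularity of `k`. -/
theorem differentiableAt_christoffel (h : IsCollarMetric W G k) (hz : z ∈ W) (a i j : Fin d) :
    DifferentiableAt ℝ (fun z : ℝ × Model d => christoffel (k z.1) a i j z.2) z := by
  have h1 : ∀ p i j : Fin d, DifferentiableAt ℝ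
      (fun z : ℝ × Model d => pd p (fun u => k z.1 u i j) z.2) z := fun p i j => by
    have h2 : ContDiffAt ℝ 1 (fderiv ℝ fun z : ℝ × Model d => k z.1 z.2 i j) z :=
      ((h.smooth i j).contDiffAt (h.isOpen.mem_nhds hz)).fderiv_right (by norm_num)
    refine ((h2.differentiableAt (by norm_num)).clm_apply
      (differentiableAt_const ((0 : ℝ), stdVec d p))).congr_of_eventuallyEq ?_
    filter_upwards [h.eventually_mem hz] with w hw
    exact pd_slice (h.differentiableAt hw i j) p
  have h3 : ∀ i j : Fin d, DifferentiableAt ℝ (fun z : ℝ × Model d => (k z.1 z.2)⁻¹ i j) z :=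
    fun i j => (contDiffAt_inv_apply (f := fun z : ℝ × Model d => k z.1 z.2)
      (fun a b => (h.smooth a b).contDiffAt (h.isOpen.mem_nhds hz)) (h.det_ne z hz)
      i j).differentiableAt (by norm_num)
  unfold christoffel
  exact (DifferentiableAt.fun_sum fun l _ => (h3 _ _).mul
    (((h1 _ _ _).add (h1 _ _ _)).sub (h1 _ _ _))).const_mul _

theorem pd_christoffel_succ (h : IsCollarMetric W G k) (hz : z ∈ W) (p a i j : Fin d) :
    pd p.succ (christoffel G a.succ i.succ j.succ) (collarCoord d z) =
      pd p (christoffel (k z.1) a i j) z.2 := by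
  rw [pd_succ_collarCoord ((h.eventually_mem hz).mono fun w hw =>
    h.christoffel_succ_succ_succ hw a i j),
    ← pd_slice (h.differentiableAt_christoffel hz a i j)]

theorem pd_christoffel_zero_succ_zero (h : IsCollarMetric W G k) (hz : z ∈ W) (p i : Fin d) :
    pd p.succ (christoffel G 0 i.succ 0) (collarCoord d z) = 0 := by
  rw [pd_succ_collarCoord ((h.eventually_mem hz).mono fun w hw =>
    h.christoffel_zero_succ_zero hw i)]
  simp

theorem differentiableAt_deriv (h : IsCollarMetric W G k) (hz : z ∈ W) (i j : Fin d) :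
    DifferentiableAt ℝ (fun w : ℝ × Model d => deriv (fun s => k s w.2 i j) w.1) z := by
  have h2 : ContDiffAt ℝ 1 (fderiv ℝ fun z : ℝ × Model d => k z.1 z.2 i j) z :=
    ((h.smooth i j).contDiffAt (h.isOpen.mem_nhds hz)).fderiv_right (by norm_num)
  refine ((h2.differentiableAt (by norm_num)).clm_apply
    (differentiableAt_const ((1 : ℝ), (0 : Model d)))).congr_of_eventuallyEq ?_
  filter_upwards [h.eventually_mem hz] with w hw
  exact (hasDerivAt_slice (h.differentiableAt hw i j)).deriv

theorem pd_christoffel_zero (h : IsCollarMetric W G k) (hz : z ∈ W) (i j : Fin d) :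
    pd 0 (christoffel G 0 i.succ j.succ) (collarCoord d z) =
      -(1 / 2) * deriv (deriv fun s => k s z.2 i j) z.1 +
        z.1⁻¹ * deriv (fun s => k s z.2 i j) z.1 - (z.1 ^ 2)⁻¹ * k z.1 z.2 i j := by
  have hx : z.1 ≠ 0 := (h.pos z hz).ne'
  rw [pd_zero_collarCoord ((h.eventually_mem hz).mono fun w hw =>
    h.christoffel_zero_succ_succ hw i j)]
  have h0 := (hasDerivAt_slice (h.differentiableAt hz i j)).differentiableAt.hasDerivAt
  have h00 := (hasDerivAt_slice (h.differentiableAt_deriv hz i j)).differentiableAt.hasDerivAt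
  refine HasDerivAt.unique (hasDerivAt_slice (f := fun w : ℝ × Model d =>
    -(1 / 2) * deriv (fun s => k s w.2 i j) w.1 + w.1⁻¹ * k w.1 w.2 i j) ?_) ?_
  · exact ((h.differentiableAt_deriv hz i j).const_mul _).add
      ((differentiableAt_fst.inv hx).mul (h.differentiableAt hz i j))
  · refine ((h00.const_mul (-(1 / 2))).add ((hasDerivAt_inv hx).mul h0)).congr_deriv ?_
    ring

/-- The Ricci tensor of `x⁻² (dx² + k_x)` in tangential directions. -/
theorem neg_two_mul_ricci_add (h : IsCollarMetric W G k) (hz : z ∈ W) (i j : Fin d) :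
    -2 * (z.1 ^ 2) * (ricciComps G (collarCoord d z) i.succ j.succ +
        d * G (collarCoord d z) i.succ j.succ) =
      einsteinOp i j (z.1 ^ 2, jet2 (k z.1) z.2,
        fun a b => z.1 * deriv (fun s => k s z.2 a b) z.1,
        fun a b => z.1 ^ 2 * deriv (deriv fun s => k s z.2 a b) z.1) := by
  have hx : z.1 ≠ 0 := (h.pos z hz).ne'
  have hline : ∀ a b, ContDiffAt ℝ 2 (fun u => k z.1 u a b) z.2 := fun a b =>
    ContDiffAt.comp (g := fun w : ℝ × Model d => k w.1 w.2 a b) (f := fun u => (z.1, u)) z.2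
      ((h.smooth a b).contDiffAt (h.isOpen.mem_nhds hz)) (by fun_prop)
  have hJ : ricciJet i j (jet2 (k z.1) z.2) = ricciComps (k z.1) z.2 i j :=
    (ricciComps_eq_jet hline (h.det_ne z hz) i j).symm
  set A : Fin d → Fin d → ℝ := fun a b => deriv (fun s => k s z.2 a b) z.1 with hA
  set B : Fin d → Fin d → ℝ := fun a b => (k z.1 z.2)⁻¹ a b with hB
  set K : Fin d → Fin d → ℝ := fun a b => k z.1 z.2 a b with hK
  have hAs : ∀ a b, A a b = A b a := h.deriv_symm hz
  have hBs : ∀ a b, B a b = B b a := h.inv_symm hz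
  have hKs : ∀ a b, K a b = K b a := h.symm z hz
  have hBK : ∀ a b, ∑ l, B a l * K b l = if a = b then 1 else 0 := h.inv_mul_apply hz
  -- The endomorphism `k⁻¹ k'`, which is up to factors the shape operator of the slices; all mixed
  -- Christoffel symbols are expressed by it.
  set C : Fin d → Fin d → ℝ := fun a b => ∑ l, B a l * A b l with hC
  have hKC : ∀ a b, ∑ l, K a l * C l b = A b a := fun a b => by
    simp only [hC, Finset.mul_sum]
    rw [Finset.sum_comm]
    have : ∀ m, ∑ l, K a l * (B l m * A b m) = (if m = a then 1 else 0) * A b m := fun m => by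
      rw [← hBK m a, Finset.sum_mul]
      exact Finset.sum_congr rfl fun l _ => by rw [hBs l m]; ring
    simp [this]
  -- The contraction of `Γ⁰` with the mixed symbols. It occurs twice in the quadratic part of the
  -- Ricci tensor, once in each order of the factors.
  have hS : ∀ a b, ∑ l, (-(1 / 2) * A a l + z.1⁻¹ * K a l) *
      (1 / 2 * C l b - z.1⁻¹ * if l = b then 1 else 0) =
      -(1 / 4) * ∑ l, A a l * C l b + z.1⁻¹ * A a b - (z.1 ^ 2)⁻¹ * K a b := fun a b => by
    have e1 : ∀ l, (-(1 / 2) * A a l + z.1⁻¹ * K a l) *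
        (1 / 2 * C l b - z.1⁻¹ * if l = b then 1 else 0) =
        -(1 / 4) * (A a l * C l b) + 1 / 2 * z.1⁻¹ * (K a l * C l b) +
        (1 / 2 * z.1⁻¹ * A a l - (z.1 ^ 2)⁻¹ * K a l) * (if l = b then 1 else 0) := fun l => by
      field_simp
      ring
    rw [Finset.sum_congr rfl fun l _ => e1 l]
    simp only [Finset.sum_add_distrib, ← Finset.mul_sum, hKC, mul_ite, mul_one, mul_zero,
      Finset.sum_ite_eq', Finset.mem_univ, if_true]
    rw [hAs b a]
    ring
  have hT : ∑ a, 1 / 2 * C a a = 1 / 2 * ∑ a, C a a := by rw [Finset.mul_sum]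
  -- The trace of the identity part of the mixed symbols, in the shape in which simplification
  -- leaves it in `hR`.
  have hT' : (∑ _i : Fin d, z.1⁻¹) * (if True then 1 else 0) = d * z.1⁻¹ := by simp
  have hQ : ∀ a b, ∑ l, A a l * C l b = ∑ l, ∑ m, A a l * B l m * A m b := fun a b => by
    refine Finset.sum_congr rfl fun l _ => ?_
    rw [hC, Finset.mul_sum]
    exact Finset.sum_congr rfl fun m _ => by rw [hAs m b]; ring
  have hQs : ∑ l, A j l * C l i = ∑ l, A i l * C l j := by
    simp only [hC, Finset.mul_sum]
    rw [Finset.sum_comm]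
    refine Finset.sum_congr rfl fun l _ => Finset.sum_congr rfl fun m _ => ?_
    rw [hBs m l]; ring
  have hR : ricciComps G (collarCoord d z) i.succ j.succ = ricciComps (k z.1) z.2 i j +
      (-(1 / 2) * deriv (deriv fun s => k s z.2 i j) z.1 + z.1⁻¹ * A i j -
        (z.1 ^ 2)⁻¹ * K i j) +
      (-z.1⁻¹ + (1 / 2 * ∑ a, C a a - d * z.1⁻¹)) * (-(1 / 2) * A i j + z.1⁻¹ * K i j) -
      2 * (-(1 / 4) * ∑ l, A i l * C l j + z.1⁻¹ * A i j - (z.1 ^ 2)⁻¹ * K i j) := by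
    have hS1 := hS j i
    have hS2 : ∑ l, (1 / 2 * C l j - z.1⁻¹ * if l = j then 1 else 0) *
      (-(1 / 2) * A i l + z.1⁻¹ * K i l) = _ := Eq.trans
        (Finset.sum_congr rfl fun l _ => mul_comm _ _) (hS i j)
    rw [hQs, hAs j i, hKs j i] at hS1
    simp only [ricciComps, Matrix.of_apply, Fin.sum_univ_succ, h.pd_christoffel_succ hz,
      h.pd_christoffel_zero hz, h.pd_christoffel_zero_succ_zero hz,
      h.christoffel_zero_zero_zero hz, h.christoffel_zero_zero_succ hz,
      h.christoffel_zero_succ_zero hz, h.christoffel_zero_succ_succ hz,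
      h.christoffel_succ_succ_zero hz,
      h.christoffel_succ_succ_succ hz, Finset.sum_add_distrib, Finset.sum_sub_distrib,
      zero_mul, mul_zero, Finset.sum_const_zero, zero_add, ← Finset.sum_mul]
    simp only [hA, hB, hC, hK] at hS1 hS2 hT ⊢
    linear_combination (-(1 / 2) * deriv (fun s => k s z.2 i j) z.1 + z.1⁻¹ * k z.1 z.2 i j) *
      (hT - hT') - hS1 - hS2
  have htr : ∑ a, ∑ b, (Matrix.of (jet2 (k z.1) z.2).1)⁻¹ a b * (z.1 * A b a) =
      z.1 * ∑ a, C a a := by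
    simp only [hC, Finset.mul_sum]
    refine Finset.sum_congr rfl fun a _ => Finset.sum_congr rfl fun b _ => ?_
    change B a b * (z.1 * A b a) = _
    rw [hAs b a]; ring
  have hquad : ∑ a, ∑ b, z.1 * A i a * (Matrix.of (jet2 (k z.1) z.2).1)⁻¹ a b * (z.1 * A b j) =
      z.1 ^ 2 * ∑ l, A i l * C l j := by
    rw [hQ]
    simp only [Finset.mul_sum]
    refine Finset.sum_congr rfl fun a _ => Finset.sum_congr rfl fun b _ => ?_
    change z.1 * A i a * B a b * (z.1 * A b j) = _
    ring
  have hg : (jet2 (k z.1) z.2).1 i j = K i j := rfl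
  rw [hR, h.succ_succ z hz, einsteinOp]
  simp only [hJ]
  rw [htr, hquad, hg]
  change -2 * z.1 ^ 2 * (_ + d * ((z.1 ^ 2)⁻¹ * K i j)) = z.1 ^ 2 * _ + (1 - d) * (z.1 * A i j) -
    _ * _ + 1 / 2 * _ * (z.1 * A i j) - _ - _
  generalize deriv (deriv fun s => k s z.2 i j) z.1 = A'
  field_simp
  ring

end IsCollarMetric

end Collar

/-! ### Bounding components of a tensor by its norm -/

section Norm

/-- Cauchy–Schwarz for the inner product of `A`: `x p` is the product of `x` with `A⁻¹ e_p`, a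
vector of squared length `A⁻¹ p p`. -/
theorem sq_apply_le_inv_mul_dotProduct {n : Type*} [Fintype n] [DecidableEq n]
    {A : Matrix n n ℝ} (hA : A.PosDef) (x : n → ℝ) (p : n) :
    x p ^ 2 ≤ A⁻¹ p p * (x ⬝ᵥ A.mulVec x) := by
  have hc : 0 < A⁻¹ p p := hA.inv.diag_pos
  have hAA : A * A⁻¹ = 1 := Matrix.mul_nonsing_inv _ (by
    exact (Matrix.isUnit_iff_isUnit_det A).1 hA.isUnit)
  set y : n → ℝ := A⁻¹.mulVec (Pi.single p 1) with hy
  have hAy : A.mulVec y = Pi.single p 1 := by rw [hy, Matrix.mulVec_mulVec, hAA, Matrix.one_mulVec]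
  have hyp : y p = A⁻¹ p p := by simp [hy]
  have hAt : A.transpose = A := by
    have := hA.isHermitian
    rwa [Matrix.IsHermitian, Matrix.conjTranspose_eq_transpose_of_trivial] at this
  have hyx : y ⬝ᵥ A.mulVec x = x p := by
    rw [Matrix.dotProduct_mulVec, ← Matrix.mulVec_transpose, hAt, hAy]
    simp
  -- Positivity of the component of `x` that is `A`-orthogonal to `y`.
  have h0 := hA.posSemidef.dotProduct_mulVec_nonneg (x - (x p / A⁻¹ p p) • y)
  simp only [star_trivial, Matrix.mulVec_sub, Matrix.mulVec_smul, hAy, sub_dotProduct,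
    dotProduct_sub, smul_dotProduct, dotProduct_smul, hyx, smul_eq_mul, dotProduct_single,
    Pi.sub_apply, Pi.smul_apply, hyp, mul_one] at h0
  have h1 : x p / A⁻¹ p p * A⁻¹ p p = x p := div_mul_cancel₀ _ hc.ne'
  have h2 : x p / A⁻¹ p p * x p ≤ x ⬝ᵥ A.mulVec x := by rw [h1] at h0; linarith
  calc x p ^ 2 = A⁻¹ p p * (x p / A⁻¹ p p * x p) := by field_simp
    _ ≤ _ := mul_le_mul_of_nonneg_left h2 hc.le

open scoped Kronecker in
/-- The components of a 2-tensor are bounded by its norm. -/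
theorem sq_apply_le_norm {m : ℕ} {G : Matrix (Fin m) (Fin m) ℝ} (hG : G.PosDef)
    (E : Matrix (Fin m) (Fin m) ℝ) (a b : Fin m) :
    E a b ^ 2 ≤ G a a * G b b *
      ∑ i, ∑ j, ∑ k, ∑ l, G⁻¹ i k * G⁻¹ j l * E i j * E k l := by
  have hU : IsUnit G.det := (Matrix.isUnit_iff_isUnit_det G).1 hG.isUnit
  -- The squared norm of a 2-tensor is the quadratic form of this Kronecker product on vectors
  -- indexed by pairs.
  have hA : (G⁻¹ ⊗ₖ G⁻¹).PosDef := hG.inv.kronecker hG.inv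
  have hAi : (G⁻¹ ⊗ₖ G⁻¹)⁻¹ = G ⊗ₖ G := Matrix.inv_eq_right_inv (by
    rw [← Matrix.mul_kronecker_mul, Matrix.nonsing_inv_mul _ hU, Matrix.one_kronecker_one])
  have h := sq_apply_le_inv_mul_dotProduct hA (fun p : Fin m × Fin m => E p.1 p.2) (a, b)
  rw [hAi] at h
  refine h.trans_eq ?_
  rw [Matrix.kroneckerMap_apply]
  congr 1
  simp only [dotProduct, Matrix.mulVec, Fintype.sum_prod_type, Matrix.kroneckerMap_apply,
    Finset.mul_sum]
  refine Finset.sum_congr rfl fun i _ => Finset.sum_congr rfl fun j _ =>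
    Finset.sum_congr rfl fun k _ => Finset.sum_congr rfl fun l _ => ?_
  ring

end Norm

/-! ### Components of tensors in charts -/

section Charts

variable {m : ℕ} {X : Type*} [TopologicalSpace X] [ChartedSpace (Model m) X]
  {φ : OpenPartialHomeomorph X (Model m)} {u : Model m}

theorem sum_smul_stdVec (v : Model m) : ∑ i, v i • stdVec m i = v := by
  ext j
  simp [stdVec, Pi.single_apply]

theorem apply_mfderiv_symm (T : Tensor2 m X) (v w : Model m) :
    T (φ.symm u) (mfderiv (𝓡 m) (𝓡 m) φ.symm u v) (mfderiv (𝓡 m) (𝓡 m) φ.symm u w) =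
      ∑ i, ∑ j, v i * w j * comps φ T u i j := by
  have h : ∀ v : Model m, mfderiv (𝓡 m) (𝓡 m) φ.symm u v = ∑ i, v i • coordVec φ i u := fun v => by
    conv_lhs => rw [← sum_smul_stdVec v]
    exact (map_sum (mfderiv (𝓡 m) (𝓡 m) φ.symm u) _ _).trans
      (Finset.sum_congr rfl fun i _ => map_smul (mfderiv (𝓡 m) (𝓡 m) φ.symm u) _ _)
  rw [h v, map_sum, sum_apply]
  refine Finset.sum_congr rfl fun i _ => ?_
  rw [h w, map_sum]
  refine Finset.sum_congr rfl fun j _ => ?_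
  rw [map_smul, map_smul]
  simp only [smul_apply, smul_eq_mul, comps, Matrix.of_apply]
  ring

theorem mDifferentiable_of_mem_maximalAtlas (hφ : φ ∈ IsManifold.maximalAtlas (𝓡 m) ∞ X) :
    φ.MDifferentiable (𝓡 m) (𝓡 m) :=
  ⟨(contMDiffOn_of_mem_maximalAtlas hφ).mdifferentiableOn (by simp),
    (contMDiffOn_symm_of_mem_maximalAtlas hφ).mdifferentiableOn (by simp)⟩

variable [IsManifold (𝓡 m) ∞ X]

theorem mfderiv_symm_bijective (hφ : φ ∈ IsManifold.maximalAtlas (𝓡 m) ∞ X) (hu : u ∈ φ.target) :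
    Function.Bijective (mfderiv (𝓡 m) (𝓡 m) φ.symm u) :=
  have : IsManifold (𝓡 m) 1 X := IsManifold.of_le (n := ∞) (by simp)
  (mDifferentiable_of_mem_maximalAtlas hφ).symm.mfderiv_bijective hu

theorem comps_symm (g : Metric m X) (φ : OpenPartialHomeomorph X (Model m)) (u : Model m)
    (i j : Fin m) : comps φ g.inner u i j = comps φ g.inner u j i :=
  g.symm _ _ _

theorem comps_posDef (g : Metric m X) (hφ : φ ∈ IsManifold.maximalAtlas (𝓡 m) ∞ X)
    (hu : u ∈ φ.target) : (comps φ g.inner u).PosDef := by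
  refine Matrix.PosDef.of_dotProduct_mulVec_pos ?_ fun x hx => ?_
  · ext i j
    simp [comps_symm g φ u j i]
  · have h1 := apply_mfderiv_symm (φ := φ) (u := u) g.inner (WithLp.toLp 2 x) (WithLp.toLp 2 x)
    have h2 : mfderiv (𝓡 m) (𝓡 m) φ.symm u (WithLp.toLp 2 x : Model m) ≠ 0 := fun h => by
      apply hx
      have h3 := (mfderiv_symm_bijective hφ hu).1 (h.trans (map_zero _).symm)
      exact congrArg WithLp.ofLp h3
    have h4 := g.pos _ _ h2
    refine h4.trans_eq (h1.trans ?_)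
    simp only [dotProduct, Matrix.mulVec, Finset.mul_sum, star_trivial]
    exact Finset.sum_congr rfl fun i _ => Finset.sum_congr rfl fun j _ => by ring

/-- The coordinate fields are smooth sections along `φ.symm`, being the tangent map applied to
constant fields; the smooth metric is then evaluated on two of them. -/
theorem contDiffOn_comps (g : Metric m X) (hφ : φ ∈ IsManifold.maximalAtlas (𝓡 m) ∞ X)
    (i j : Fin m) : ContDiffOn ℝ ∞ (fun u => comps φ g.inner u i j) φ.target := by
  have : IsManifold (𝓡 m) 1 X := IsManifold.of_le (n := ∞) (by simp)
  have hs : ContMDiffOn (𝓡 m) (𝓡 m) ∞ φ.symm φ.target := contMDiffOn_symm_of_mem_maximalAtlas hφ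
  have hv : ∀ i : Fin m, ContMDiffOn (𝓡 m) ((𝓡 m).prod 𝓘(ℝ, Model m)) ∞
      (fun u => Bundle.TotalSpace.mk' (Model m) (E := fun p : X => TangentSpace (𝓡 m) p)
        (φ.symm u) (coordVec φ i u)) φ.target := fun i => by
    have h1 := hs.contMDiffOn_tangentMapWithin (m := ∞) (by simp)
      φ.open_target.uniqueMDiffOn
    have h2 : ContMDiff (𝓡 m) (𝓡 m).tangent ∞
        (fun u : Model m => (⟨u, stdVec m i⟩ : TangentBundle (𝓡 m) (Model m))) :=
      (contMDiff_vectorSpace_iff_contDiff (V := fun _ : Model m => stdVec m i)).2 contDiff_const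
    have h3 := h1.comp h2.contMDiffOn (s := φ.target) (fun u hu => hu)
    refine h3.congr fun u hu => ?_
    simp only [Function.comp, tangentMapWithin, coordVec,
      mfderivWithin_of_isOpen φ.open_target hu]
  have hg := g.contMDiff.comp_contMDiffOn hs
  have h := ContMDiffOn.clm_bundle_apply₂ (F₁ := Model m) (F₂ := Model m) (F₃ := ℝ)
    (E₃ := Bundle.Trivial X ℝ) (n := ∞) (ψ := fun u => g.inner (φ.symm u)) hg (hv i) (hv j)
  rw [← contMDiffOn_iff_contDiffOn]
  intro u hu
  have h5 := h u hu
  simp only [Bundle.contMDiffWithinAt_totalSpace] at h5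
  exact h5.2

theorem eq_zero_of_comps_eq_zero {T : Tensor2 m X} (hφ : φ ∈ IsManifold.maximalAtlas (𝓡 m) ∞ X)
    (hu : u ∈ φ.target) (h : ∀ i j, comps φ T u i j = 0) : T (φ.symm u) = 0 := by
  ext v w
  obtain ⟨v, rfl⟩ := (mfderiv_symm_bijective hφ hu).2 v
  obtain ⟨w, rfl⟩ := (mfderiv_symm_bijective hφ hu).2 w
  refine (apply_mfderiv_symm T v w).trans ?_
  simp [h]

end Charts

/-! ### Collar charts -/

section CollarChart

variable {d : ℕ}
  {M : Type*} [TopologicalSpace M] {S : Type*} [TopologicalSpace S]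

/-- The chart of the bulk with coordinates `(x, u)`, made from the collar and a chart of `S`. -/
def collarChart (Φ : OpenPartialHomeomorph (ℝ × S) M) (φ : OpenPartialHomeomorph S (Model d)) :
    OpenPartialHomeomorph M (Model (d + 1)) :=
  (Φ.symm.trans ((OpenPartialHomeomorph.refl ℝ).prod φ)).trans
    (collarCoord d).toHomeomorph.toOpenPartialHomeomorph

variable {Φ : OpenPartialHomeomorph (ℝ × S) M} {φ : OpenPartialHomeomorph S (Model d)}

theorem collarChart_apply (p : M) :
    collarChart Φ φ p = collarCoord d ((Φ.symm p).1, φ (Φ.symm p).2) := rfl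

theorem collarCoord_mem_target {z : ℝ × Model d} :
    collarCoord d z ∈ (collarChart Φ φ).target ↔ z.2 ∈ φ.target ∧ (z.1, φ.symm z.2) ∈ Φ.source := by
  simp [collarChart]

theorem collarChart_source :
    (collarChart Φ φ).source = Φ.target ∩ Φ.symm ⁻¹' (univ ×ˢ φ.source) := by
  simp [collarChart]

variable [ChartedSpace (Model (d + 1)) M] [ChartedSpace (Model d) S]
  [IsManifold (𝓡 (d + 1)) ∞ M] [IsManifold (𝓡 d) ∞ S]
  {g : Metric (d + 1) M} {ε : ℝ} {h : ℝ → Metric d S}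

theorem collarChart_mem_maximalAtlas (hnf : IsNormalForm g ε Φ h)
    (hφ : φ ∈ IsManifold.maximalAtlas (𝓡 d) ∞ S) :
    collarChart Φ φ ∈ IsManifold.maximalAtlas (𝓡 (d + 1)) ∞ M := by
  refine OpenPartialHomeomorph.mem_maximalAtlas_of_contMDiffOn _ ?_ ?_
  · have h1 : ContMDiffOn (𝓡 (d + 1)) (𝓘(ℝ, ℝ).prod (𝓡 d)) ∞ Φ.symm (collarChart Φ φ).source :=
      hnf.smooth_symm.mono (by rw [collarChart_source]; exact inter_subset_left)
    have h2 : ContMDiffOn (𝓡 (d + 1)) 𝓘(ℝ, ℝ) ∞ (fun p => (Φ.symm p).1)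
        (collarChart Φ φ).source := contMDiff_fst.comp_contMDiffOn h1
    have h3 : ContMDiffOn (𝓡 (d + 1)) (𝓡 d) ∞ (fun p => φ (Φ.symm p).2)
        (collarChart Φ φ).source :=
      (contMDiffOn_of_mem_maximalAtlas hφ).comp (contMDiff_snd.comp_contMDiffOn h1) fun p hp => by
        rw [collarChart_source] at hp
        exact hp.2.2
    exact (collarCoord d).contDiff.contMDiff.comp_contMDiffOn (h2.prodMk_space h3)
  · have h1 : ContMDiff (𝓡 (d + 1)) 𝓘(ℝ, ℝ) ∞
        (fun w : Model (d + 1) => ((collarCoord d).symm w).1) :=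
      (contDiff_fst.comp (collarCoord d).symm.contDiff).contMDiff
    have h2 : ContMDiff (𝓡 (d + 1)) (𝓡 d) ∞
        (fun w : Model (d + 1) => ((collarCoord d).symm w).2) :=
      (contDiff_snd.comp (collarCoord d).symm.contDiff).contMDiff
    have hmem : ∀ w ∈ (collarChart Φ φ).target, ((collarCoord d).symm w).2 ∈ φ.target ∧
        (((collarCoord d).symm w).1, φ.symm ((collarCoord d).symm w).2) ∈ Φ.source :=
      fun w hw => by
      rw [← collarCoord_mem_target, ContinuousLinearEquiv.apply_symm_apply]
      exact hw
    have h3 : ContMDiffOn (𝓡 (d + 1)) (𝓡 d) ∞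
        (fun w : Model (d + 1) => φ.symm ((collarCoord d).symm w).2) (collarChart Φ φ).target :=
      (contMDiffOn_symm_of_mem_maximalAtlas hφ).comp h2.contMDiffOn fun w hw => (hmem w hw).1
    exact hnf.smooth.comp (h1.contMDiffOn.prodMk h3) fun w hw => (hmem w hw).2

theorem mfderiv_collarChart_symm (hnf : IsNormalForm g ε Φ h)
    (hφ : φ ∈ IsManifold.maximalAtlas (𝓡 d) ∞ S) {x : ℝ} (hx : x ∈ Ioo 0 ε) {u : Model d}
    (hu : u ∈ φ.target) (a : ℝ) (v : Model d) :
    mfderiv (𝓡 (d + 1)) (𝓡 (d + 1)) (collarChart Φ φ).symm (collarCoord d (x, u))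
        (collarCoord d (a, v)) =
      mfderiv (𝓘(ℝ, ℝ).prod (𝓡 d)) (𝓡 (d + 1)) Φ (x, φ.symm u)
        ((a, mfderiv (𝓡 d) (𝓡 d) φ.symm u v) :
          TangentSpace (𝓘(ℝ, ℝ).prod (𝓡 d)) (x, φ.symm u)) := by
  have hsrc : (x, φ.symm u) ∈ Φ.source := by
    rw [hnf.source_eq]; exact ⟨hx, mem_univ _⟩
  set w := collarCoord d (x, u) with hw
  have hcw : (collarCoord d).symm w = (x, u) := (collarCoord d).symm_apply_apply _
  have hΦ : HasMFDerivAt (𝓘(ℝ, ℝ).prod (𝓡 d)) (𝓡 (d + 1)) Φ (x, φ.symm u)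
      (mfderiv (𝓘(ℝ, ℝ).prod (𝓡 d)) (𝓡 (d + 1)) Φ (x, φ.symm u)) :=
    ((hnf.smooth.contMDiffAt (Φ.open_source.mem_nhds hsrc)).mdifferentiableAt
      (by simp)).hasMFDerivAt
  have hφu : HasMFDerivAt (𝓡 d) (𝓡 d) φ.symm u (mfderiv (𝓡 d) (𝓡 d) φ.symm u) :=
    ((mDifferentiable_of_mem_maximalAtlas hφ).mdifferentiableAt_symm hu).hasMFDerivAt
  have h1 : HasMFDerivAt (𝓡 (d + 1)) 𝓘(ℝ, ℝ)
      (fun w : Model (d + 1) => ((collarCoord d).symm w).1) w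
      ((ContinuousLinearMap.fst ℝ ℝ (Model d)).comp
        ((collarCoord d).symm : Model (d + 1) →L[ℝ] ℝ × Model d)) :=
    (hasFDerivAt_fst.comp w (collarCoord d).symm.hasFDerivAt).hasMFDerivAt
  have h2 : HasMFDerivAt (𝓡 (d + 1)) (𝓡 d)
      (fun w : Model (d + 1) => ((collarCoord d).symm w).2) w
      ((ContinuousLinearMap.snd ℝ ℝ (Model d)).comp
        ((collarCoord d).symm : Model (d + 1) →L[ℝ] ℝ × Model d)) :=
    (hasFDerivAt_snd.comp w (collarCoord d).symm.hasFDerivAt).hasMFDerivAt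
  have hφu' : HasMFDerivAt (𝓡 d) (𝓡 d) φ.symm ((collarCoord d).symm w).2
      (mfderiv (𝓡 d) (𝓡 d) φ.symm ((collarCoord d).symm w).2) := by rw [hcw]; exact hφu
  have hΦ' : HasMFDerivAt (𝓘(ℝ, ℝ).prod (𝓡 d)) (𝓡 (d + 1)) Φ
      (((collarCoord d).symm w).1, φ.symm ((collarCoord d).symm w).2)
      (mfderiv (𝓘(ℝ, ℝ).prod (𝓡 d)) (𝓡 (d + 1)) Φ
        (((collarCoord d).symm w).1, φ.symm ((collarCoord d).symm w).2)) := by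
    rw [hcw]; exact hΦ
  have h3 := h1.prodMk (hφu'.comp w h2)
  have h4 := HasMFDerivAt.comp w hΦ' h3
  have h5 : mfderiv (𝓡 (d + 1)) (𝓡 (d + 1)) (collarChart Φ φ).symm w = _ := h4.mfderiv
  rw [h5]
  rfl

/-- The curve of Einstein data of the family `h_x` at the point with coordinates `u`. -/
def familyCurve (φ : OpenPartialHomeomorph S (Model d)) (h : ℝ → Metric d S) (u : Model d)
    (x : ℝ) : EinsteinJet d :=
  (x ^ 2, jet2 (comps φ (h x).inner) u,
    fun i j => x * deriv (fun s => comps φ (h s).inner u i j) x,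
    fun i j => x ^ 2 * deriv (deriv fun s => comps φ (h s).inner u i j) x)

theorem inner_collarChart (hnf : IsNormalForm g ε Φ h)
    (hφ : φ ∈ IsManifold.maximalAtlas (𝓡 d) ∞ S) {x : ℝ} (hx : x ∈ Ioo 0 ε) {u : Model d}
    (hu : u ∈ φ.target) (a b : ℝ) (v w : Model d) :
    g.inner ((collarChart Φ φ).symm (collarCoord d (x, u)))
        (mfderiv (𝓡 (d + 1)) (𝓡 (d + 1)) (collarChart Φ φ).symm (collarCoord d (x, u))
          (collarCoord d (a, v)))
        (mfderiv (𝓡 (d + 1)) (𝓡 (d + 1)) (collarChart Φ φ).symm (collarCoord d (x, u))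
          (collarCoord d (b, w))) =
      (x ^ 2)⁻¹ * (a * b + (h x).inner (φ.symm u) (mfderiv (𝓡 d) (𝓡 d) φ.symm u v)
        (mfderiv (𝓡 d) (𝓡 d) φ.symm u w)) := by
  rw [mfderiv_collarChart_symm hnf hφ hx hu, mfderiv_collarChart_symm hnf hφ hx hu]
  exact hnf.metric_eq x hx (φ.symm u) a b _ _

/-- Joint regularity of `h_x` in `(x, u)` is not part of the normal form; it is recovered from the
smoothness of `g`, as `h_x` is `x² g` on tangential vectors. -/
theorem isCollarMetric (hnf : IsNormalForm g ε Φ h)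
    (hφ : φ ∈ IsManifold.maximalAtlas (𝓡 d) ∞ S) :
    IsCollarMetric (Ioo 0 ε ×ˢ φ.target) (comps (collarChart Φ φ) g.inner)
      (fun x => comps φ (h x).inner) := by
  have hss : ∀ z ∈ Ioo 0 ε ×ˢ φ.target, ∀ i j : Fin d,
      comps (collarChart Φ φ) g.inner (collarCoord d z) i.succ j.succ =
        (z.1 ^ 2)⁻¹ * comps φ (h z.1).inner z.2 i j := fun z hz i j => by
    have := inner_collarChart hnf hφ hz.1 hz.2 0 0 (stdVec d i) (stdVec d j)
    rw [collarCoord_zero_stdVec, collarCoord_zero_stdVec, zero_mul, zero_add] at this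
    exact this
  have hsum := fun (z : ℝ × Model d) (hz : z ∈ Ioo 0 ε ×ˢ φ.target) (a b : ℝ) (v w : Model d) =>
    (inner_collarChart hnf hφ hz.1 hz.2 a b v w).trans
      (congrArg (fun t => (z.1 ^ 2)⁻¹ * (a * b + t)) (apply_mfderiv_symm (h z.1).inner v w))
  refine ⟨isOpen_Ioo.prod φ.open_target, fun z hz => hz.1.1, fun i j => ?_,
    fun z hz i j => comps_symm _ _ _ i j, fun z hz => (comps_posDef (h z.1) hφ hz.2).det_pos.ne',
    fun z hz => ?_, fun z hz j => ?_, fun z hz j => ?_, hss⟩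
  · have h1 := (contDiffOn_comps g (collarChart_mem_maximalAtlas hnf hφ) i.succ j.succ).comp
      (collarCoord d).contDiff.contDiffOn (s := Ioo 0 ε ×ˢ φ.target) fun z hz =>
        collarCoord_mem_target.2 ⟨hz.2, by rw [hnf.source_eq]; exact ⟨hz.1, mem_univ _⟩⟩
    have h2 : ContDiffOn ℝ 2 (fun z : ℝ × Model d => z.1 ^ 2 *
        comps (collarChart Φ φ) g.inner (collarCoord d z) i.succ j.succ) (Ioo 0 ε ×ˢ φ.target) :=
      (contDiff_fst.pow 2).contDiffOn.mul (h1.of_le (by norm_cast))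
    refine h2.congr fun z hz => ?_
    rw [hss z hz]
    have : z.1 ≠ 0 := hz.1.1.ne'
    field_simp
  · have := hsum z hz 1 1 0 0
    rw [collarCoord_one_zero] at this
    exact this.trans (by simp)
  · have := hsum z hz 1 0 0 (stdVec d j)
    rw [collarCoord_one_zero, collarCoord_zero_stdVec] at this
    exact this.trans (by simp)
  · have := hsum z hz 0 1 (stdVec d j) 0
    rw [collarCoord_one_zero, collarCoord_zero_stdVec] at this
    exact this.trans (by simp)

/-- The decay of the Einstein defect, in terms of the family `h_x`. -/
theorem einsteinOp_familyCurve_sq_le (hnf : IsNormalForm g ε Φ h)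
    (hE : IsPoincareEinsteinToOrder g Φ (d + 2)) :
    ∃ C : ℝ, ∃ δ > 0, ∀ φ ∈ IsManifold.maximalAtlas (𝓡 d) ∞ S, ∀ u ∈ φ.target, ∀ i j : Fin d,
      ∀ x ∈ Ioo 0 ε, x < δ → einsteinOp i j (familyCurve φ h u x) ^ 2 ≤
        comps φ (h x).inner u i i * comps φ (h x).inner u j j * (2 * C * x ^ (d + 2)) ^ 2 := by
  obtain ⟨C, δ, hδ, hC⟩ := hE
  refine ⟨C, δ, hδ, fun φ hφ u hu i j x hx hxδ => ?_⟩
  have hcm := isCollarMetric hnf hφ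
  have hz : ((x, u) : ℝ × Model d) ∈ Ioo 0 ε ×ˢ φ.target := ⟨hx, hu⟩
  have hsrc : (x, φ.symm u) ∈ Φ.source := by rw [hnf.source_eq]; exact ⟨hx, mem_univ _⟩
  have hψ := collarChart_mem_maximalAtlas hnf hφ
  have hpt : collarChart Φ φ (Φ (x, φ.symm u)) = collarCoord d (x, u) := by
    rw [collarChart_apply, Φ.left_inv hsrc, φ.right_inv hu]
  have hN := hC (x, φ.symm u) hsrc hxδ _ hψ (by
    rw [collarChart_source]
    refine ⟨Φ.map_source hsrc, ?_⟩
    rw [mem_preimage, Φ.left_inv hsrc]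
    exact ⟨mem_univ _, φ.map_target hu⟩)
  rw [hpt] at hN
  have htgt : collarCoord d (x, u) ∈ (collarChart Φ φ).target :=
    collarCoord_mem_target.2 ⟨hu, hsrc⟩
  have hb := sq_apply_le_norm (comps_posDef g hψ htgt)
    (defectComps g (collarChart Φ φ) (collarCoord d (x, u))) i.succ j.succ
  have hG := comps_posDef g hψ htgt
  have hR := hcm.neg_two_mul_ricci_add hz i j
  have hii := hcm.succ_succ _ hz i i
  have hjj := hcm.succ_succ _ hz j j
  simp only at hii hjj hR
  change -2 * x ^ 2 * _ = einsteinOp i j (familyCurve φ h u x) at hR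
  have hD : defectComps g (collarChart Φ φ) (collarCoord d (x, u)) i.succ j.succ =
      ricciComps (comps (collarChart Φ φ) g.inner) (collarCoord d (x, u)) i.succ j.succ +
        d * comps (collarChart Φ φ) g.inner (collarCoord d (x, u)) i.succ j.succ := by
    simp [defectComps]
  rw [← hD] at hR
  rw [defectNorm] at hN
  have hx0 : 0 < x := hx.1
  have hCx : 0 ≤ C * x ^ (d + 2) := (Real.sqrt_nonneg _).trans hN
  have hS := (Real.sqrt_le_left hCx).1 hN
  have hGpos : 0 ≤ comps (collarChart Φ φ) g.inner (collarCoord d (x, u)) i.succ i.succ *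
      comps (collarChart Φ φ) g.inner (collarCoord d (x, u)) j.succ j.succ :=
    mul_nonneg hG.diag_pos.le hG.diag_pos.le
  have hfin := hb.trans (mul_le_mul_of_nonneg_left hS hGpos)
  rw [hii, hjj] at hfin
  rw [← hR]
  -- The factor `x⁴` cancels the two factors `x⁻²` in the diagonal components of `g`, so no power of
  -- `x` is lost from the decay rate.
  calc _ = 4 * x ^ 4 *
        defectComps g (collarChart Φ φ) (collarCoord d (x, u)) i.succ j.succ ^ 2 := by
        ring
    _ ≤ 4 * x ^ 4 * _ := mul_le_mul_of_nonneg_left hfin (by positivity)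
    _ = _ := by field_simp; ring

end CollarChart

/-! ### Expansions of polyhomogeneous families -/

/-- The polynomial `∑_{l ≤ L} b_l X^l`. -/
def logPoly (L : ℕ) (b : ℕ → ℝ) : ℝ[X] :=
  ∑ l ∈ Finset.range (L + 1), Polynomial.C (b l) * Polynomial.X ^ l

theorem eval_logPoly (L : ℕ) (b : ℕ → ℝ) (t : ℝ) :
    (logPoly L b).eval t = ∑ l ∈ Finset.range (L + 1), b l * t ^ l := by
  simp [logPoly, Polynomial.eval_finsetSum]

theorem coeff_logPoly (L : ℕ) (b : ℕ → ℝ) {l : ℕ} (hl : l ≤ L) : (logPoly L b).coeff l = b l := by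
  simp [logPoly, Polynomial.finsetSum_coeff, hl]

theorem logPoly_eq_C {L : ℕ} {b : ℕ → ℝ} {t : ℝ}
    (h : ∀ l ≤ L, b l = if l = 0 then t else 0) : logPoly L b = Polynomial.C t := by
  rw [logPoly, Finset.sum_eq_single 0]
  · simp [h 0 (Nat.zero_le _)]
  · intro l hl hl0
    rw [h l (by simpa [Nat.lt_succ_iff] using hl), if_neg hl0]
    simp
  · simp

theorem eq_of_logPoly_eq_C {L : ℕ} {b : ℕ → ℝ} {t : ℝ} (h : logPoly L b = Polynomial.C t) {l : ℕ}
    (hl : l ≤ L) : b l = if l = 0 then t else 0 := by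
  rw [← coeff_logPoly L b hl, h, Polynomial.coeff_C]

theorem logPoly_sum {ι : Type*} (s : Finset ι) (L : ℕ) (c : ι → ℝ) (b : ι → ℕ → ℝ) :
    logPoly L (fun l => ∑ i ∈ s, c i * b i l) =
      ∑ i ∈ s, Polynomial.C (c i) * logPoly L (b i) := by
  simp only [logPoly, Finset.mul_sum, Finset.sum_mul, map_sum, map_mul, mul_assoc]
  exact Finset.sum_comm

theorem pd_congr {m : ℕ} {f g : Model m → ℝ} {T : Set (Model m)} (hT : IsOpen T)
    (h : ∀ v ∈ T, f v = g v) {u : Model m} (hu : u ∈ T) (p : Fin m) : pd p f u = pd p g u := by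
  have : f =ᶠ[𝓝 u] g := by
    filter_upwards [hT.mem_nhds hu] with v hv using h v hv
  rw [pd, pd, this.fderiv_eq]

theorem pd_sub_sum {m : ℕ} {ι : Type*} (s : Finset ι) {f : Model m → ℝ} {g : ι → Model m → ℝ}
    (c : ι → ℝ) {u : Model m} (hf : DifferentiableAt ℝ f u)
    (hg : ∀ i ∈ s, DifferentiableAt ℝ (g i) u) (p : Fin m) :
    pd p (fun v => f v - ∑ i ∈ s, c i * g i v) u = pd p f u - ∑ i ∈ s, c i * pd p (g i) u := by
  have h : HasFDerivAt (fun v => f v - ∑ i ∈ s, c i * g i v) _ u :=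
    hf.hasFDerivAt.sub (HasFDerivAt.fun_sum fun i hi => ((hg i hi).hasFDerivAt.const_mul (c i)))
  rw [pd, h.fderiv]
  simp [pd, sum_apply]

section Family

variable {d : ℕ}
  {M : Type*} [TopologicalSpace M] {S : Type*} [TopologicalSpace S]
  {Φ : OpenPartialHomeomorph (ℝ × S) M} {φ : OpenPartialHomeomorph S (Model d)}
  [ChartedSpace (Model (d + 1)) M] [ChartedSpace (Model d) S]
  [IsManifold (𝓡 (d + 1)) ∞ M] [IsManifold (𝓡 d) ∞ S]
  {g : Metric (d + 1) M} {ε : ℝ} {h : ℝ → Metric d S}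

/-- The expansion of the family `h_x` with coefficients `a`, in the chart `φ`. -/
def HasChartExpansion (N L : ℕ) (h : ℝ → Metric d S) (a : ℕ → ℕ → Tensor2 d S)
    (φ : OpenPartialHomeomorph S (Model d)) : Prop :=
  ∀ i j : Fin d, (∀ k l, ContDiffOn ℝ 2 (fun u => comps φ (a k l) u i j) φ.target) ∧
    ∀ u₀ ∈ φ.target, ∀ r s : ℕ, r + s ≤ 2 →
      (fun z : ℝ × Model d => z.1 ^ r *
        ‖iteratedFDeriv ℝ s (fun u => iteratedDeriv r (fun x =>
            comps φ (h x).inner u i j -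
              ∑ k ∈ Finset.range (N + 1), ∑ l ∈ Finset.range (L + 1),
                x ^ k * Real.log x ^ l * comps φ (a k l) u i j) z.1) z.2‖)
        =o[𝓝[>] 0 ×ˢ 𝓝 u₀] fun z => z.1 ^ N

theorem sum_eq_eval_logPoly (N L : ℕ) (b : ℕ → ℕ → ℝ) (x : ℝ) :
    ∑ k ∈ Finset.range (N + 1), ∑ l ∈ Finset.range (L + 1), x ^ k * Real.log x ^ l * b k l =
      ∑ k ∈ Finset.range (N + 1), x ^ k * (logPoly L (b k)).eval (Real.log x) := by
  refine Finset.sum_congr rfl fun k _ => ?_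
  rw [eval_logPoly, Finset.mul_sum]
  exact Finset.sum_congr rfl fun l _ => by ring

/-- The remainder estimate is locally uniform in `u`; the determination of coefficients only needs
it at each fixed `u`, with the tangential derivatives already taken. -/
theorem HasChartExpansion.restrict {N L : ℕ} {a : ℕ → ℕ → Tensor2 d S}
    (ha : HasChartExpansion N L h a φ) {u : Model d} (hu : u ∈ φ.target) (i j : Fin d) {r s : ℕ}
    (hrs : r + s ≤ 2) :
    (fun x : ℝ => x ^ r * ‖iteratedFDeriv ℝ s (fun u => iteratedDeriv r (fun x =>
      comps φ (h x).inner u i j - ∑ k ∈ Finset.range (N + 1),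
        x ^ k * (logPoly L fun l => comps φ (a k l) u i j).eval (Real.log x)) x) u‖)
      =o[𝓝[>] 0] fun x => x ^ N := by
  have h1 := ((ha i j).2 u hu r s hrs).comp_tendsto
    (tendsto_id.prodMk (tendsto_const_nhds (x := u)) : Tendsto (fun x : ℝ => (x, u)) (𝓝[>] 0) _)
  simp only [sum_eq_eval_logPoly] at h1
  exact h1

/-- The Einstein data of a polyhomogeneous family. -/
theorem HasChartExpansion.jetExpansion {N L : ℕ} {a : ℕ → ℕ → Tensor2 d S}
    (ha : HasChartExpansion N L h a φ) (hnf : IsNormalForm g ε Φ h)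
    (hφ : φ ∈ IsManifold.maximalAtlas (𝓡 d) ∞ S) {u : Model d} (hu : u ∈ φ.target) :
    JetExpansion N (familyCurve φ h u)
      (fun k i j => logPoly L fun l => comps φ (a k l) u i j)
      (fun k p i j => logPoly L fun l => pd p (fun v => comps φ (a k l) v i j) u)
      (fun k p q i j => logPoly L fun l =>
        pd p (fun v => pd q (fun w => comps φ (a k l) w i j) v) u) := by
  have hx : ∀ i j, _ := fun i j => LogExpansion.of_iteratedDeriv_remainder (N := N) hnf.pos
    (f := fun x => comps φ (h x).inner u i j)
    (c := fun k => logPoly L fun l => comps φ (a k l) u i j)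
    (((isCollarMetric hnf hφ).smooth i j).comp (t := Ioo 0 ε ×ˢ φ.target)
      (f := fun x : ℝ => (x, u)) (by fun_prop) fun x hx => ⟨hx, hu⟩) fun r hr => by
      have h1 := ha.restrict hu i j (r := r) (s := 0) (by omega)
      simp only [norm_iteratedFDeriv_zero] at h1
      refine isLittleO_norm_left.1 (h1.congr' ?_ EventuallyEq.rfl)
      filter_upwards [self_mem_nhdsWithin] with x hx
      have hx : (0 : ℝ) < x := hx
      rw [norm_mul, norm_pow, Real.norm_of_nonneg hx.le]
  have hh : ∀ (x : ℝ) (i j : Fin d), ContDiffOn ℝ 2 (fun v => comps φ (h x).inner v i j) φ.target :=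
    fun x i j => (contDiffOn_comps (h x) hφ i j).of_le (by norm_cast)
  have hone : ∀ (T : Model d → ℝ), ContDiffOn ℝ 2 T φ.target → ∀ v ∈ φ.target,
      DifferentiableAt ℝ T v := fun T hT v hv =>
    (hT.contDiffAt (φ.open_target.mem_nhds hv)).differentiableAt (by norm_num)
  have htwo : ∀ (T : Model d → ℝ) (q : Fin d), ContDiffOn ℝ 2 T φ.target → ∀ v ∈ φ.target,
      DifferentiableAt ℝ (fun v => pd q T v) v := fun T q hT v hv =>
    differentiableAt_pd (hT.contDiffAt (φ.open_target.mem_nhds hv)) q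
  -- Flattening the double sum separates the factors in `x` from those in `u`, so tangential
  -- derivatives fall on the coefficients alone.
  have hrem : ∀ (x : ℝ) (v : Model d) (b : ℕ → ℕ → ℝ), ∑ k ∈ Finset.range (N + 1),
      x ^ k * (logPoly L (b k)).eval (Real.log x) =
      ∑ t ∈ Finset.range (N + 1) ×ˢ Finset.range (L + 1),
        (x ^ t.1 * Real.log x ^ t.2) * b t.1 t.2 := fun x v b => by
    rw [← sum_eq_eval_logPoly, Finset.sum_product]
  have hp1 : ∀ (x : ℝ) (i j p : Fin d), ∀ v ∈ φ.target,
      pd p (fun v => comps φ (h x).inner v i j - ∑ k ∈ Finset.range (N + 1),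
        x ^ k * (logPoly L fun l => comps φ (a k l) v i j).eval (Real.log x)) v =
      pd p (fun v => comps φ (h x).inner v i j) v - ∑ k ∈ Finset.range (N + 1),
        x ^ k * (logPoly L fun l => pd p (fun w => comps φ (a k l) w i j) v).eval
          (Real.log x) := fun x i j p v hv => by
    rw [hrem x v fun k l => pd p (fun w => comps φ (a k l) w i j) v]
    simp only [fun v : Model d => hrem x v fun k l => comps φ (a k l) v i j]
    exact pd_sub_sum _ (fun t : ℕ × ℕ => x ^ t.1 * Real.log x ^ t.2) (hone _ (hh x i j) v hv)
      (fun t _ => hone _ ((ha i j).1 t.1 t.2) v hv) p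
  have hp2 : ∀ (x : ℝ) (i j p q : Fin d),
      pd p (fun v => pd q (fun v => comps φ (h x).inner v i j - ∑ k ∈ Finset.range (N + 1),
        x ^ k * (logPoly L fun l => comps φ (a k l) v i j).eval (Real.log x)) v) u =
      pd p (fun v => pd q (fun v => comps φ (h x).inner v i j) v) u -
        ∑ k ∈ Finset.range (N + 1), x ^ k * (logPoly L fun l =>
          pd p (fun v => pd q (fun w => comps φ (a k l) w i j) v) u).eval
          (Real.log x) := fun x i j p q => by
    rw [pd_congr φ.open_target (hp1 x i j q) hu p,
      hrem x u fun k l => pd p (fun v => pd q (fun w => comps φ (a k l) w i j) v) u]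
    simp only [fun v : Model d => hrem x v fun k l => pd q (fun w => comps φ (a k l) w i j) v]
    exact pd_sub_sum _ (fun t : ℕ × ℕ => x ^ t.1 * Real.log x ^ t.2) (htwo _ q (hh x i j) u hu)
      (fun t _ => htwo _ q ((ha i j).1 t.1 t.2) u hu) p
  refine ⟨fun x => rfl, fun i j => (hx i j).1, fun p i j => ?_, fun p q i j => ?_,
    fun i j => (hx i j).2.1, fun i j => (hx i j).2.2⟩
  · have h1 := ha.restrict hu i j (r := 0) (s := 1) (by omega)
    simp only [iteratedDeriv_zero, pow_zero, one_mul] at h1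
    have h2 : (fun x : ℝ => pd p (fun v => comps φ (h x).inner v i j -
        ∑ k ∈ Finset.range (N + 1),
        x ^ k * (logPoly L fun l => comps φ (a k l) v i j).eval (Real.log x)) u)
        =o[𝓝[>] 0] fun x => x ^ N := by
      refine IsBigO.trans_isLittleO (IsBigO.of_bound ‖stdVec d p‖ (Eventually.of_forall
        fun x => ?_)) h1
      rw [norm_iteratedFDeriv_one, norm_norm, mul_comm]
      exact ContinuousLinearMap.le_opNorm _ _
    simp only [hp1 _ i j p u hu] at h2
    exact h2
  · have h1 := ha.restrict hu i j (r := 0) (s := 2) (by omega)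
    simp only [iteratedDeriv_zero, pow_zero, one_mul] at h1
    have h2 : (fun x : ℝ => pd p (fun v => pd q (fun v => comps φ (h x).inner v i j -
        ∑ k ∈ Finset.range (N + 1),
        x ^ k * (logPoly L fun l => comps φ (a k l) v i j).eval (Real.log x)) v) u)
        =o[𝓝[>] 0] fun x => x ^ N := by
      refine IsBigO.trans_isLittleO (IsBigO.of_bound (‖stdVec d p‖ * ‖stdVec d q‖)
        (Eventually.of_forall fun x => ?_)) h1
      set F : Model d → ℝ := fun v => comps φ (h x).inner v i j - ∑ k ∈ Finset.range (N + 1),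
        x ^ k * (logPoly L fun l => comps φ (a k l) v i j).eval (Real.log x) with hF
      have hFc : ContDiffAt ℝ 2 F u := by
        have : ContDiffOn ℝ 2 F φ.target := by
          simp only [hF, fun v : Model d => hrem x v fun k l => comps φ (a k l) v i j]
          exact (hh x i j).sub (ContDiffOn.sum fun t _ =>
            contDiffOn_const.mul ((ha i j).1 t.1 t.2))
        exact this.contDiffAt (φ.open_target.mem_nhds hu)
      have hd1 : DifferentiableAt ℝ (fderiv ℝ F) u :=
        (hFc.fderiv_right (m := 1) (by norm_num)).differentiableAt (by norm_num)
      have h3 : pd p (fun v => pd q F v) u =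
          iteratedFDeriv ℝ 2 F u ![stdVec d p, stdVec d q] := by
        rw [iteratedFDeriv_two_apply]
        have := (hd1.hasFDerivAt.clm_apply (hasFDerivAt_const (stdVec d q) u))
        have h4 : HasFDerivAt (fun v => pd q F v) _ u := this
        rw [pd, h4.fderiv]
        simp
      rw [h3, norm_norm, mul_comm]
      refine (ContinuousMultilinearMap.le_opNorm _ _).trans_eq ?_
      simp [Fin.prod_univ_two]
    simp only [hp2 _ i j p q] at h2
    exact h2

/-- The expansion of the values of `h_x` on a pair of tangent vectors. -/
theorem HasChartExpansion.inner {N L : ℕ} {a : ℕ → ℕ → Tensor2 d S}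
    (ha : HasChartExpansion N L h a φ) (hnf : IsNormalForm g ε Φ h)
    (hφ : φ ∈ IsManifold.maximalAtlas (𝓡 d) ∞ S) {y : S} (hy : y ∈ φ.source)
    (v w : TangentSpace (𝓡 d) y) :
    LogExpansion N (fun x => (h x).inner y v w) fun k => logPoly L fun l => a k l y v w := by
  obtain ⟨u, hu, rfl⟩ : ∃ u ∈ φ.target, φ.symm u = y := ⟨φ y, φ.map_source hy, φ.left_inv hy⟩
  obtain ⟨v, rfl⟩ := (mfderiv_symm_bijective hφ hu).2 v
  obtain ⟨w, rfl⟩ := (mfderiv_symm_bijective hφ hu).2 w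
  change Model d at v w
  have hv := fun T : Tensor2 d S => (apply_mfderiv_symm (φ := φ) (u := u) T v w).trans
    (Finset.sum_product' Finset.univ Finset.univ fun i j =>
      (v i * w j) * comps φ T u i j).symm
  have h1 := LogExpansion.sum (Finset.univ ×ˢ Finset.univ) fun (t : Fin d × Fin d) _ =>
    ((ha.jetExpansion hnf hφ hu).metric t.1 t.2).const_mul (v t.1 * w t.2)
  refine (h1.congr' (Eventually.of_forall fun x => ?_)).congr_coeff fun k _ => ?_
  · exact (hv (h x).inner).symm
  · refine (logPoly_sum _ L _ _).symm.trans (congrArg (logPoly L) (funext fun l => ?_))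
    exact (hv (a k l)).symm

/-- The family is an approximate solution of the Einstein equation. -/
theorem einsteinOp_familyCurve_isLittleO {L : ℕ} {a : ℕ → ℕ → Tensor2 d S}
    (ha : HasChartExpansion (d + 1) L h a φ) (ha0 : ∀ l, 0 < l → a 0 l = 0)
    (hnf : IsNormalForm g ε Φ h) (hE : IsPoincareEinsteinToOrder g Φ (d + 2))
    (hφ : φ ∈ IsManifold.maximalAtlas (𝓡 d) ∞ S) {u : Model d} (hu : u ∈ φ.target)
    (i j : Fin d) :
    (fun x => einsteinOp i j (familyCurve φ h u x)) =o[𝓝[>] 0] fun x : ℝ => x ^ (d + 1) := by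
  obtain ⟨C, δ, hδ, hC⟩ := einsteinOp_familyCurve_sq_le hnf hE
  -- Since order zero has no logarithms, the diagonal components stay bounded, and the estimate of
  -- the squared operator keeps its rate.
  have hbd : ∀ i : Fin d, (fun x => comps φ (h x).inner u i i) =O[𝓝[>] 0] fun _ => (1 : ℝ) :=
    fun i => by
    have h1 := ((ha.jetExpansion hnf hφ hu).metric i i).leading (Nat.zero_le _) (by simp)
    have h2 : logPoly L (fun l => comps φ (a 0 l) u i i) =
        Polynomial.C (comps φ (a 0 0) u i i) := logPoly_eq_C fun l _ => by
      rcases Nat.eq_zero_or_pos l with rfl | hl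
      · simp
      · rw [ha0 l hl, if_neg hl.ne']; simp [comps]
    simp only [h2, pow_zero, one_mul, Polynomial.eval_C] at h1
    have h3 := h1.isBigO.add (isBigO_const_const (comps φ (a 0 0) u i i) (one_ne_zero (α := ℝ))
      (𝓝[>] (0 : ℝ)))
    refine h3.congr_left fun x => ?_
    simp only [sub_add_cancel]
    rfl
  have h1 : (fun x => einsteinOp i j (familyCurve φ h u x) ^ 2) =O[𝓝[>] 0]
      fun x : ℝ => (x ^ (d + 2)) ^ 2 := by
    have h2 : (fun x => comps φ (h x).inner u i i * comps φ (h x).inner u j j *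
        (2 * C * x ^ (d + 2)) ^ 2) =O[𝓝[>] 0] fun x : ℝ => (x ^ (d + 2)) ^ 2 := by
      have h3 := ((hbd i).mul (hbd j)).mul (((isBigO_refl (fun x : ℝ => x ^ (d + 2))
        (𝓝[>] 0)).const_mul_left (2 * C)).pow 2)
      exact h3.congr_right fun x => by ring
    refine IsBigO.trans (IsBigO.of_bound 1 ?_) h2
    filter_upwards [Ioo_mem_nhdsGT hnf.pos, Ioo_mem_nhdsGT hδ] with x hx hx'
    rw [one_mul, Real.norm_of_nonneg (sq_nonneg _)]
    exact (hC φ hφ u hu i j x hx hx'.2).trans (le_abs_self _)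
  have h4 : (fun x => einsteinOp i j (familyCurve φ h u x)) =O[𝓝[>] 0]
      fun x : ℝ => x ^ (d + 2) := IsBigO.of_pow two_ne_zero h1
  exact h4.trans_isLittleO (by
    simpa using isLittleO_pow_mul_eval_log (show d + 1 < d + 2 by omega) (1 : ℝ[X]))

end Family

/-! ### Determination of the expansion coefficients -/

section Determination

variable {d : ℕ}
  {M : Type*} [TopologicalSpace M] {S : Type*} [TopologicalSpace S]
  {Φ : OpenPartialHomeomorph (ℝ × S) M} {φ : OpenPartialHomeomorph S (Model d)}
  [ChartedSpace (Model (d + 1)) M] [ChartedSpace (Model d) S]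
  [IsManifold (𝓡 (d + 1)) ∞ M] [IsManifold (𝓡 d) ∞ S]
  {g : Metric (d + 1) M} {ε : ℝ} {h : ℝ → Metric d S} {L : ℕ} {a : ℕ → ℕ → Tensor2 d S}

/-- If the coefficients of `x^j`, `j < k`, agree with those of an even reference family, then the
next coefficients differ by solutions of the indicial equation. -/
theorem HasChartExpansion.indicial (ha : HasChartExpansion (d + 1) L h a φ)
    (ha0 : ∀ l, 0 < l → a 0 l = 0) (hnf : IsNormalForm g ε Φ h)
    (hE : IsPoincareEinsteinToOrder g Φ (d + 2))
    (hφ : φ ∈ IsManifold.maximalAtlas (𝓡 d) ∞ S) {u : Model d} (hu : u ∈ φ.target)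
    {G : ℕ → Model d → Matrix (Fin d) (Fin d) ℝ} (hG0 : G 0 u = comps φ (h 0).inner u)
    (hGodd : ∀ k, Odd k → G k = fun _ => 0) {K : ℕ} (hGK : ∀ k, K < k → G k = fun _ => 0)
    {k m : ℕ} (hk : 1 ≤ k) (hkd : k ≤ d + 1) (hmd : m ≤ d + 1) (hm : m ≤ k + 1)
    (hmk : m + 1 ≤ 2 * k)
    (hG : ∀ j < k, ∀ v ∈ φ.target, ∀ p q, ∀ l ≤ L,
      comps φ (a j l) v p q = if l = 0 then G j v p q else 0)
    {t : Fin d → Fin d → ℕ → ℝ[X]}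
    (href : ∀ i j, LogExpansion (d + 1)
      (fun x => einsteinOp i j (evenCurve K (fun k => jet2 (G k) u) (x ^ 2))) (t i j))
    {n : ℕ} (hn : 1 ≤ n) (hnm : n ≤ m) (hnd : n < 2 * d) (ht : ∀ i j, t i j n = 0)
    (i j : Fin d) :
    ((n : ℝ) - d) • (logPoly L (fun l => comps φ (a n l) u i j) - Polynomial.C (G n u i j)) +
      Polynomial.derivative
        (logPoly L (fun l => comps φ (a n l) u i j) - Polynomial.C (G n u i j)) = 0 := by
  have hjet : ∀ k, G k = (fun _ => 0) → jet2 (G k) u = 0 := fun k hk => by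
    rw [hk]
    refine Prod.ext ?_ (Prod.ext ?_ ?_) <;> ext <;> simp [jet2, pd]
  have hodd : ∀ k, Odd k → jet2 (G k) u = 0 := fun k hk => hjet k (hGodd k hk)
  have hJ : (Matrix.of (jet2 (G 0) u).1).det ≠ 0 := by
    have : Matrix.of (jet2 (G 0) u).1 = comps φ (h 0).inner u := hG0
    rw [this]
    exact (comps_posDef (h 0) hφ hu).det_pos.ne'
  -- Agreement of the lower coefficients on the whole chart, not only at `u`, passes to their
  -- derivatives; the comparison needs agreement of the full 2-jets.
  have hpd1 : ∀ j < k, ∀ v ∈ φ.target, ∀ p i i', ∀ l ≤ L,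
      pd p (fun w => comps φ (a j l) w i i') v =
        if l = 0 then pd p (fun w => G j w i i') v else 0 := by
    intro j hj v hv p i i' l hl
    rw [pd_congr φ.open_target (fun w hw => hG j hj w hw i i' l hl) hv p]
    split_ifs with h0
    · rfl
    · simp [pd]
  have hpd2 : ∀ j < k, ∀ p q i i', ∀ l ≤ L,
      pd p (fun v => pd q (fun w => comps φ (a j l) w i i') v) u =
        if l = 0 then pd p (fun v => pd q (fun w => G j w i i') v) u else 0 := by
    intro j hj p q i i' l hl
    rw [pd_congr φ.open_target (fun w hw => hpd1 j hj w hw q i i' l hl) hu p]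
    split_ifs with h0
    · rfl
    · simp [pd]
  refine indicialOp_eq_zero (p := fun i j => logPoly L (fun l => comps φ (a n l) u i j) -
    Polynomial.C (G n u i j)) hn hnd hJ (fun i j => ?_) i j
  have h1 := (ha.jetExpansion hnf hφ hu).indicial
    (jetExpansion_evenCurve K (e := fun k => jet2 (G k) u) hodd fun k hk => hjet k (hGK k hk))
    hJ (evenCurve_sub_isBigO K hodd) hk hkd hmd hm hmk
    (fun j hj => funext fun i => funext fun i' => logPoly_eq_C (hG j hj u hu i i'))
    (fun j hj => funext fun p => funext fun i => funext fun i' =>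
      logPoly_eq_C (hpd1 j hj u hu p i i'))
    (fun j hj => funext fun p => funext fun q => funext fun i => funext fun i' =>
      logPoly_eq_C (hpd2 j hj p q i i')) i j
    ((einsteinOp_familyCurve_isLittleO ha ha0 hnf hE hφ hu i j).trans_isBigO
      (isBigO_pow_of_le hmd)) (href i j) n hnm
  rw [ht, add_zero] at h1
  exact h1

/-- The coefficients of `(1 - λ x² / 4)²`. -/
def warpCoeff (lam : ℝ) (k : ℕ) : ℝ :=
  if k = 0 then 1 else if k = 2 then -lam / 2 else if k = 4 then lam ^ 2 / 16 else 0

theorem warpCoeff_eq_zero (lam : ℝ) {k : ℕ} (hk : 4 < k) : warpCoeff lam k = 0 := by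
  simp [warpCoeff, show k ≠ 0 by omega, show k ≠ 2 by omega, show k ≠ 4 by omega]

theorem warpCoeff_of_odd (lam : ℝ) {k : ℕ} (hk : Odd k) : warpCoeff lam k = 0 := by
  have h1 : k ≠ 0 := by rintro rfl; simp at hk
  have h2 : k ≠ 2 := by rintro rfl; exact absurd hk (by decide)
  have h3 : k ≠ 4 := by rintro rfl; exact absurd hk (by decide)
  simp [warpCoeff, h1, h2, h3]

theorem sum_warpCoeff (lam x : ℝ) :
    ∑ k ∈ Finset.range (4 + 1), warpCoeff lam k * x ^ k = (1 - lam / 4 * x ^ 2) ^ 2 := by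
  simp [Finset.sum_range_succ, warpCoeff]
  ring

/-- The Einstein operator on multiples of a fixed metric. -/
theorem einsteinOp_smul {J : MetricJet2 d} (hJ : (Matrix.of J.1).det ≠ 0) {ρ : ℝ} (hρ : ρ ≠ 0)
    (s π χ : ℝ) (i j : Fin d) :
    einsteinOp i j (s, ρ • J, π • J.1, χ • J.1) =
      (χ + (1 - 2 * d) * π + (d / 2 - 1) * (π ^ 2 / ρ)) * J.1 i j -
        2 * s * ricciJet i j (ρ • J) := by
  have hinv : (Matrix.of (ρ • J).1)⁻¹ = ρ⁻¹ • (Matrix.of J.1)⁻¹ := by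
    have : Matrix.of (ρ • J).1 = ρ • Matrix.of J.1 := rfl
    rw [this]
    have h1 := Matrix.inv_smul' (A := Matrix.of J.1) (Units.mk0 ρ hρ)
      (isUnit_iff_ne_zero.2 hJ)
    exact h1
  have htr : ∑ b, ∑ c, (Matrix.of (ρ • J).1)⁻¹ b c * (π • J.1) c b = π / ρ * d := by
    rw [← sum_inv_mul_self hJ, hinv]
    simp only [Finset.mul_sum, Matrix.smul_apply, Pi.smul_apply, smul_eq_mul]
    exact Finset.sum_congr rfl fun b _ => Finset.sum_congr rfl fun c _ => by ring
  have hquad : ∑ b, ∑ c, (π • J.1) i b * (Matrix.of (ρ • J).1)⁻¹ b c * (π • J.1) c j =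
      π ^ 2 / ρ * J.1 i j := by
    have h1 : Matrix.of J.1 * ((Matrix.of J.1)⁻¹ * Matrix.of J.1) = Matrix.of J.1 := by
      rw [Matrix.nonsing_inv_mul _ (isUnit_iff_ne_zero.2 hJ), mul_one]
    have h2 := congrFun (congrFun h1 i) j
    simp only [Matrix.mul_apply, Matrix.of_apply, Finset.mul_sum] at h2
    rw [hinv, ← h2]
    simp only [Finset.mul_sum, Matrix.smul_apply, Pi.smul_apply, smul_eq_mul]
    exact Finset.sum_congr rfl fun b _ => Finset.sum_congr rfl fun c _ => by ring
  rw [einsteinOp]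
  dsimp only
  rw [htr, hquad]
  simp only [Prod.smul_fst, Pi.smul_apply, smul_eq_mul]
  field_simp
  ring

/-- The family `(1 - λ x² / 4)² h₀` solves the Einstein equation. -/
theorem einsteinOp_warp {h₀ : Metric d S} {lam : ℝ}
    (hein : IsEinstein h₀ (((d : ℝ) - 1) * lam)) (hφ : φ ∈ IsManifold.maximalAtlas (𝓡 d) ∞ S)
    {u : Model d} (hu : u ∈ φ.target) (i j : Fin d) {s : ℝ} (hs : 1 - lam / 4 * s ≠ 0) :
    einsteinOp i j (evenCurve 4
      (fun k => jet2 (fun v => warpCoeff lam k • comps φ h₀.inner v) u) s) = 0 := by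
  have hdet : (comps φ h₀.inner u).det ≠ 0 := (comps_posDef h₀ hφ hu).det_pos.ne'
  set J := jet2 (comps φ h₀.inner) u with hJ
  have hJdet : (Matrix.of J.1).det ≠ 0 := hdet
  have hρ : (1 - lam / 4 * s) ^ 2 ≠ 0 := pow_ne_zero 2 hs
  -- With `ρ = (1 - λ x²/4)²` and `s = x²`, the scalar factors are `ρ`, `x ρ'` and `x² ρ''`.
  have hcurve : evenCurve 4 (fun k => jet2 (fun v => warpCoeff lam k • comps φ h₀.inner v) u) s =
      (s, (1 - lam / 4 * s) ^ 2 • J, (-lam * s * (1 - lam / 4 * s)) • J.1,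
        (-lam * s + 3 / 4 * lam ^ 2 * s ^ 2) • J.1) := by
    simp only [jet2_smul, ← hJ]
    refine Prod.ext rfl (Prod.ext ?_ (Prod.ext ?_ ?_))
    · simp only [evenCurve, Finset.sum_range_succ, Finset.sum_range_zero, warpCoeff, smul_smul]
      norm_num
      rw [add_assoc, ← add_smul]
      nth_rewrite 1 [← one_smul ℝ J]
      rw [← add_smul]
      congr 1
      ring
    · simp only [evenCurve, Finset.sum_range_succ, Finset.sum_range_zero, warpCoeff, smul_smul,
        Prod.smul_fst]
      norm_num
      rw [← neg_smul, ← add_smul]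
      congr 1
      ring
    · simp only [evenCurve, Finset.sum_range_succ, Finset.sum_range_zero, warpCoeff, smul_smul,
        Prod.smul_fst]
      norm_num
      rw [← add_smul]
      congr 1
      ring
  have hric : ricciJet i j ((1 - lam / 4 * s) ^ 2 • J) = ((d : ℝ) - 1) * lam * J.1 i j := by
    rw [hJ, ← jet2_smul, ← ricciComps_eq_jet, ricciComps_smul hρ, hein φ hφ u hu]
    · rfl
    · intro i j
      have h1 := (contDiffOn_comps h₀ hφ i j).contDiffAt (φ.open_target.mem_nhds hu)
      exact contDiffAt_const.mul (h1.of_le (by norm_cast))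
    · rw [Matrix.det_smul]
      exact mul_ne_zero (pow_ne_zero _ hρ) hdet
  have hq : (-lam * s * (1 - lam / 4 * s)) ^ 2 / (1 - lam / 4 * s) ^ 2 = lam ^ 2 * s ^ 2 := by
    rw [mul_pow, mul_div_assoc, div_self hρ]
    ring
  rw [hcurve, einsteinOp_smul hJdet hρ, hric, hq]
  ring

/-- Below order `d` the coefficients are found inductively, one comparison for each order; orders
`d` and `d + 1` come from a single one. The excluded pair `k = d`, `l = 0` is the Neumann datum, the
only kernel of the indicial operator in this range. -/
theorem comps_einstein (hd : 2 ≤ d) {h₀ : Metric d S} {lam : ℝ}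
    (hein : IsEinstein h₀ (((d : ℝ) - 1) * lam)) (h0 : h 0 = h₀)
    (ha : HasChartExpansion (d + 1) L h a φ) (ha00 : a 0 0 = (h 0).inner)
    (ha0 : ∀ l, 0 < l → a 0 l = 0) (hnf : IsNormalForm g ε Φ h)
    (hE : IsPoincareEinsteinToOrder g Φ (d + 2)) (hφ : φ ∈ IsManifold.maximalAtlas (𝓡 d) ∞ S)
    {u : Model d} (hu : u ∈ φ.target) {k l : ℕ} (hk : k ≤ d + 1) (hl : l ≤ L)
    (hkl : k ≠ d ∨ l ≠ 0) (i j : Fin d) :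
    comps φ (a k l) u i j = if l = 0 then warpCoeff lam k * comps φ h₀.inner u i j else 0 := by
  set G : ℕ → Model d → Matrix (Fin d) (Fin d) ℝ :=
    fun k v => warpCoeff lam k • comps φ h₀.inner v with hG
  have hG0 : ∀ u, G 0 u = comps φ (h 0).inner u := fun u => by simp [hG, warpCoeff, h0]
  have hGodd : ∀ k, Odd k → G k = fun _ => 0 := fun k hk => by
    simp [hG, warpCoeff_of_odd lam hk]
  have hGK : ∀ k, 4 < k → G k = fun _ => 0 := fun k hk => by
    simp [hG, warpCoeff_eq_zero lam hk]
  have href : ∀ u ∈ φ.target, ∀ i j, LogExpansion (d + 1)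
      (fun x => einsteinOp i j (evenCurve 4 (fun k => jet2 (G k) u) (x ^ 2))) fun _ => 0 := by
    intro u hu i j
    refine (LogExpansion.of_isLittleO (isLittleO_zero (E' := ℝ) _ _)).congr' ?_
    -- The reference metric degenerates where this factor vanishes, but not for small `x`.
    have h1 : ContinuousAt (fun x : ℝ => 1 - lam / 4 * x ^ 2) 0 := by fun_prop
    have h2 := (h1.eventually_ne (y := 0) (by norm_num)).filter_mono
      (nhdsWithin_le_nhds (s := Ioi 0))
    filter_upwards [h2] with x hx
    exact (einsteinOp_warp hein hφ hu i j hx).symm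
  have key : ∀ k < d, ∀ u ∈ φ.target, ∀ i j, ∀ l ≤ L,
      comps φ (a k l) u i j = if l = 0 then G k u i j else 0 := by
    intro k
    induction k using Nat.strong_induction_on with
    | _ k ih =>
      intro hk u hu i j l hl
      rcases Nat.eq_zero_or_pos k with rfl | hk0
      · rcases Nat.eq_zero_or_pos l with rfl | hl0
        · rw [if_pos rfl, hG0, ha00]
        · rw [if_neg hl0.ne', ha0 l hl0]
          simp [comps]
      · have h1 := ha.indicial ha0 hnf hE hφ hu (hG0 u) hGodd hGK hk0 (by omega)
          (show k ≤ d + 1 by omega) (by omega) (by omega)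
          (fun j hj v hv p q l hl => ih j hj (by omega) v hv p q l hl)
          (href u hu) hk0 le_rfl (by omega) (fun _ _ => rfl) i j
        have h2 := eq_zero_of_smul_add_derivative (by
          rw [sub_ne_zero]; exact_mod_cast hk.ne) h1
        exact eq_of_logPoly_eq_C (sub_eq_zero.1 h2) hl
  rcases lt_or_ge k d with hkd | hkd
  · exact key k hkd u hu i j l hl
  -- The decisive comparison: agreement below `k = d` gives the linear equation up to `m = d + 1`,
  -- since `d + 2 ≤ 2 * d`. Agreement at order `d` is not required.
  · have h1 : ∀ n, 1 ≤ n → n ≤ d + 1 → _ := fun n hn hnd =>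
      ha.indicial ha0 hnf hE hφ hu (hG0 u) hGodd hGK (k := d) (by omega) (by omega)
        (le_refl (d + 1)) le_rfl (by omega) key (href u hu) hn hnd (by omega) (fun _ _ => rfl) i j
    have h2 := h1 k (by omega) hk
    rcases eq_or_ne k d with rfl | hne
    · rw [sub_self, zero_smul, zero_add] at h2
      have hl0 : l ≠ 0 := hkl.resolve_left (by simp)
      -- At order `d` the equation only says that the polynomial in `log x` has zero derivative;
      -- this coefficient is `l` times the one sought.
      have h3 := congrArg (fun p : ℝ[X] => p.coeff (l - 1)) h2
      rw [if_neg hl0, ← coeff_logPoly L (fun l => comps φ (a k l) u i j) hl]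
      simp only [Polynomial.coeff_derivative, Polynomial.coeff_sub, Nat.sub_add_cancel
        (Nat.one_le_iff_ne_zero.2 hl0), Polynomial.coeff_C, if_neg hl0, Polynomial.coeff_zero,
        sub_zero] at h3
      exact (mul_eq_zero.1 h3).resolve_right (by positivity)
    · have h3 := eq_zero_of_smul_add_derivative (by
        rw [sub_ne_zero]; exact_mod_cast hne) h2
      exact eq_of_logPoly_eq_C (sub_eq_zero.1 h3) hl

/-- In even boundary dimension, the odd coefficients of an expansion without logarithms vanish. -/
theorem comps_odd (hd : 2 ≤ d) (hde : Even d)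
    (ha : HasChartExpansion (d + 1) L h a φ) (ha00 : a 0 0 = (h 0).inner)
    (ha0 : ∀ l, 0 < l → a 0 l = 0) (hnf : IsNormalForm g ε Φ h)
    (hE : IsPoincareEinsteinToOrder g Φ (d + 2)) (hφ : φ ∈ IsManifold.maximalAtlas (𝓡 d) ∞ S)
    (hlog : ∀ k ≤ d + 1, ∀ l ≤ L, l ≠ 0 → ∀ v ∈ φ.target, ∀ p q, comps φ (a k l) v p q = 0)
    {k : ℕ} (hk : k ≤ d + 1) (hodd : Odd k) {u : Model d} (hu : u ∈ φ.target) (i j : Fin d) :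
    comps φ (a k 0) u i j = 0 := by
  -- The reference family is the even part of the expansion itself. It need not solve the Einstein
  -- equation; only the parity of its error matters.
  set G : ℕ → Model d → Matrix (Fin d) (Fin d) ℝ :=
    fun k => if Even k ∧ k ≤ d + 1 then comps φ (a k 0) else fun _ => 0 with hG
  have hG0 : ∀ u, G 0 u = comps φ (h 0).inner u := fun u => by simp [hG, ha00]
  have hGodd : ∀ k, Odd k → G k = fun _ => 0 := fun k hk => by
    simp [hG, Nat.not_even_iff_odd.2 hk]
  have hGK : ∀ k, d + 1 < k → G k = fun _ => 0 := fun k hk => by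
    simp [hG, Nat.not_le.2 hk]
  have href : ∀ u ∈ φ.target, ∀ i j, ∃ t : ℕ → ℝ, (∀ k, Odd k → t k = 0) ∧
      LogExpansion (d + 1) (fun x => einsteinOp i j (evenCurve (d + 1)
        (fun k => jet2 (G k) u) (x ^ 2))) fun k => Polynomial.C (t k) := by
    intro u hu i j
    refine LogExpansion.exists_of_comp_sq (f := fun s => einsteinOp i j (evenCurve (d + 1)
      (fun k => jet2 (G k) u) s)) ?_ (d + 1)
    have h0 : evenCurve (d + 1) (fun k => jet2 (G k) u) 0 = (0, jet2 (G 0) u, 0, 0) :=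
      evenCurve_zero (d + 1) (e := fun k => jet2 (G k) u) fun k hk => by
        simp only [hGodd k hk]
        refine Prod.ext ?_ (Prod.ext ?_ ?_) <;> ext <;> simp [jet2, pd]
    refine ContDiffAt.comp (g := einsteinOp i j) (0 : ℝ) ?_ (contDiff_evenCurve _ _).contDiffAt
    refine contDiffAt_einsteinOp i j ?_
    rw [h0]
    have h1 : Matrix.of (jet2 (G 0) u).1 = comps φ (h 0).inner u := hG0 u
    change (Matrix.of (jet2 (G 0) u).1).det ≠ 0
    rw [h1]
    exact (comps_posDef (h 0) hφ hu).det_pos.ne'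
  induction k using Nat.strong_induction_on generalizing u i j with
  | _ k ih =>
    choose t ht hexp using href u hu
    have hk0 : 1 ≤ k := hodd.pos
    have h1 := ha.indicial ha0 hnf hE hφ hu (hG0 u) hGodd hGK hk0 hk hk (by omega) (by omega)
      (fun n hn v hv p q l hl => by
        rcases eq_or_ne l 0 with rfl | hl0
        · rw [if_pos rfl]
          rcases Nat.even_or_odd n with hne | hno
          · rw [hG]
            dsimp only
            rw [if_pos ⟨hne, by omega⟩]
          · rw [hGodd n hno, ih n hn (by omega) hno hv]
            rfl
        · rw [if_neg hl0, hlog n (by omega) l hl hl0 v hv])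
      hexp hk0 le_rfl (by omega) (fun i j => by rw [ht i j k hodd, map_zero]) i j
    -- The indicial root `d` is even and `k` is odd, so no free datum occurs among the odd
    -- coefficients.
    have hkd : (k : ℝ) - d ≠ 0 := by
      rw [sub_ne_zero]
      rintro h2
      rw [Nat.cast_inj] at h2
      exact (Nat.not_even_iff_odd.2 hodd) (h2 ▸ hde)
    have h2 := eq_zero_of_smul_add_derivative hkd h1
    have h3 := eq_of_logPoly_eq_C (sub_eq_zero.1 h2) (Nat.zero_le L)
    rw [h3, if_pos rfl, hGodd k hodd]
    rfl

theorem eq_of_comps_eq {T T' : Tensor2 d S} (hφ : φ ∈ IsManifold.maximalAtlas (𝓡 d) ∞ S)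
    {u : Model d} (hu : u ∈ φ.target) (hT : ∀ i j, comps φ T u i j = comps φ T' u i j) :
    T (φ.symm u) = T' (φ.symm u) := by
  have h1 := eq_zero_of_comps_eq_zero (T := fun p => T p - T' p) hφ hu fun i j =>
    sub_eq_zero.2 (hT i j)
  exact sub_eq_zero.1 h1

/-- The expansion coefficients of the right-hand side of `HasEinsteinExpansion`. -/
theorem logExpansion_einstein (N d : ℕ) (lam c θ κ : ℝ) :
    LogExpansion N (fun x : ℝ => (1 - lam / 4 * x ^ 2) ^ 2 * c + x ^ d / (d : ℝ) * θ +
        x ^ (d + 1) / ((d : ℝ) + 1) * κ)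
      fun k => Polynomial.C (warpCoeff lam k * c + (if k = d then θ / d else 0) +
        if k = d + 1 then κ / ((d : ℝ) + 1) else 0) := by
  have h1 := LogExpansion.of_sum (N := N) 4 (fun k => warpCoeff lam k * c) fun k hk => by
    simp [warpCoeff_eq_zero lam hk]
  have h2 := fun (n : ℕ) (b : ℝ) => LogExpansion.of_sum (N := N) n
    (fun k => if k = n then b else 0) fun k hk => if_neg hk.ne'
  refine (((h1.add (h2 d (θ / d))).add (h2 (d + 1) (κ / ((d : ℝ) + 1)))).congr'
    (Eventually.of_forall fun x => ?_)).congr_coeff fun k _ => ?_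
  · simp only [mul_right_comm _ c, ← Finset.sum_mul, sum_warpCoeff, ite_mul, zero_mul,
      Finset.sum_ite_eq', Finset.mem_range, Nat.lt_succ_self, if_true]
    ring
  · simp only [map_add]

/-- Powers of the factor `(1 - λ x²/4)²` coincide with `x^d` or `x^(d+1)` for small `d`. Collecting
all contributions to each power permits comparison by uniqueness without case distinctions. -/
theorem hasEinsteinExpansion_iff {h₀ : Metric d S} {lam : ℝ} {θ κ : Tensor2 d S} :
    HasEinsteinExpansion h h₀ lam θ κ ↔ ∀ (y : S) (v w : TangentSpace (𝓡 d) y),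
      LogExpansion (d + 1) (fun x => (h x).inner y v w) fun k =>
        Polynomial.C (warpCoeff lam k * h₀.inner y v w + (if k = d then θ y v w / d else 0) +
          if k = d + 1 then κ y v w / ((d : ℝ) + 1) else 0) := by
  refine forall_congr' fun y => forall_congr' fun v => forall_congr' fun w => ?_
  have h1 := logExpansion_einstein (d + 1) d lam (h₀.inner y v w) (θ y v w) (κ y v w)
  constructor
  · intro h2
    refine ((LogExpansion.of_isLittleO h2).add h1).congr' (Eventually.of_forall fun x => ?_)
      |>.congr_coeff fun k _ => zero_add _
    simp only [sub_add_cancel]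
  · intro h2
    have h3 := h2.sub h1
    simpa [LogExpansion] using h3

theorem metricTrace_zero (h₀ : Metric d S) (p : S) : metricTrace h₀ 0 p = 0 :=
  Finset.sum_eq_zero fun _ _ => Finset.sum_eq_zero fun _ _ => mul_eq_zero_of_right _ rfl

theorem massIntegral_zero [T2Space S] [SigmaCompactSpace S] [MeasurableSpace S]
    (h₀ : Metric d S) : massIntegral h₀ 0 = 0 := by
  simp [massIntegral, metricTrace_zero]

end Determination

/-! ### Vanishing of the mass -/

section Mass

variable {d : ℕ}
  {M : Type*} [TopologicalSpace M] {S : Type*} [TopologicalSpace S]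
  {Φ : OpenPartialHomeomorph (ℝ × S) M}
  [ChartedSpace (Model (d + 1)) M] [ChartedSpace (Model d) S]
  [IsManifold (𝓡 (d + 1)) ∞ M] [IsManifold (𝓡 d) ∞ S]
  {g : Metric (d + 1) M} {ε : ℝ} {h : ℝ → Metric d S}

theorem IsPolyhomogeneous.exists_hasChartExpansion {N : ℕ} (hreg : IsPolyhomogeneous N h) :
    ∃ (L : ℕ) (a : ℕ → ℕ → Tensor2 d S), a 0 0 = (h 0).inner ∧ (∀ l, 0 < l → a 0 l = 0) ∧
      ∀ φ ∈ IsManifold.maximalAtlas (𝓡 d) ∞ S, HasChartExpansion N L h a φ :=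
  hreg

theorem tensor_eq_of_comps_eq {T T' : Tensor2 d S}
    (hT : ∀ φ ∈ IsManifold.maximalAtlas (𝓡 d) ∞ S, ∀ u ∈ φ.target, ∀ i j,
      comps φ T u i j = comps φ T' u i j) : T = T' := by
  funext y
  have hφ := IsManifold.chart_mem_maximalAtlas (I := 𝓡 d) (n := ∞) y
  have hu := mem_chart_target (Model d) y
  have h1 := eq_of_comps_eq hφ hu (hT _ hφ _ hu)
  rwa [(chartAt (Model d) y).left_inv (mem_chart_source _ y)] at h1

/-- The expansion coefficients of a family with Einstein conformal infinity. -/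
theorem exists_einstein_logExpansion (hd : 2 ≤ d) {h₀ : Metric d S} {lam : ℝ}
    (hein : IsEinstein h₀ (((d : ℝ) - 1) * lam)) (h0 : h 0 = h₀) (hnf : IsNormalForm g ε Φ h)
    (hreg : IsPolyhomogeneous (d + 1) h) (hE : IsPoincareEinsteinToOrder g Φ (d + 2)) :
    ∃ b : Tensor2 d S, ∀ (y : S) (v w : TangentSpace (𝓡 d) y),
      LogExpansion (d + 1) (fun x => (h x).inner y v w) fun k =>
        Polynomial.C (if k = d then b y v w else warpCoeff lam k * h₀.inner y v w) := by
  obtain ⟨L, a, ha00, ha0, ha⟩ := hreg.exists_hasChartExpansion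
  have key : ∀ k ≤ d + 1, ∀ l ≤ L, (k ≠ d ∨ l ≠ 0) →
      a k l = if l = 0 then fun y => warpCoeff lam k • h₀.inner y else 0 := by
    intro k hk l hl hkl
    refine tensor_eq_of_comps_eq fun φ hφ u hu i j => ?_
    rw [comps_einstein hd hein h0 (ha φ hφ) ha00 ha0 hnf hE hφ hu hk hl hkl]
    split_ifs <;> rfl
  refine ⟨a d 0, fun y v w => ?_⟩
  refine ((ha _ (IsManifold.chart_mem_maximalAtlas y)).inner hnf
    (IsManifold.chart_mem_maximalAtlas y) (mem_chart_source _ y) v w).congr_coeff fun k hk =>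
      logPoly_eq_C fun l hl => ?_
  by_cases hkl : k ≠ d ∨ l ≠ 0
  · rw [key k hk l hl hkl]
    split_ifs with hl0 hkd
    · exact absurd hkd (hkl.resolve_right (not_not.2 hl0))
    · rfl
    · rfl
  · obtain ⟨rfl, rfl⟩ : k = d ∧ l = 0 := by simpa [not_or] using hkl
    simp

theorem exists_hasEinsteinExpansion (hd : 2 ≤ d) {h₀ : Metric d S} {lam : ℝ}
    (hein : IsEinstein h₀ (((d : ℝ) - 1) * lam)) (h0 : h 0 = h₀) (hnf : IsNormalForm g ε Φ h)
    (hreg : IsPolyhomogeneous (d + 1) h) (hE : IsPoincareEinsteinToOrder g Φ (d + 2)) :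
    ∃ θ κ : Tensor2 d S, HasEinsteinExpansion h h₀ lam θ κ := by
  obtain ⟨b, hb⟩ := exists_einstein_logExpansion hd hein h0 hnf hreg hE
  -- The warp factor may already contribute at order `d` (when `d` is 2 or 4), so its share is
  -- removed from the free coefficient; the factor `d` undoes the normalisation of `θ`.
  refine ⟨fun y => (d : ℝ) • (b y - warpCoeff lam d • h₀.inner y), 0,
    hasEinsteinExpansion_iff.2 fun y v w => (hb y v w).congr_coeff fun k hk => ?_⟩
  have hd0 : (d : ℝ) ≠ 0 := by positivity
  congr 1
  have h2 : (0 : Tensor2 d S) y v w = 0 := rfl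
  have h3 : ((d : ℝ) • (b y - warpCoeff lam d • h₀.inner y)) v w =
    d * (b y v w - warpCoeff lam d * h₀.inner y v w) := rfl
  rw [h2, h3]
  rcases eq_or_ne k d with rfl | hkd
  · simp
    field_simp
    ring
  · simp [hkd]

/-- At order `d + 1` the family has exactly the coefficient of the warp factor, so uniqueness leaves
nothing for `κ`, whatever `θ` is. -/
theorem HasEinsteinExpansion.eq_zero (hd : 2 ≤ d) {h₀ : Metric d S} {lam : ℝ}
    (hein : IsEinstein h₀ (((d : ℝ) - 1) * lam)) (h0 : h 0 = h₀) (hnf : IsNormalForm g ε Φ h)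
    (hreg : IsPolyhomogeneous (d + 1) h) (hE : IsPoincareEinsteinToOrder g Φ (d + 2))
    {θ κ : Tensor2 d S} (hκ : HasEinsteinExpansion h h₀ lam θ κ) : κ = 0 := by
  obtain ⟨b, hb⟩ := exists_einstein_logExpansion hd hein h0 hnf hreg hE
  funext y
  ext v w
  have h1 := (hasEinsteinExpansion_iff.1 hκ y v w).unique (hb y v w) (d + 1) le_rfl
  have h2 := Polynomial.C_injective h1
  have hd1 : (d : ℝ) + 1 ≠ 0 := by positivity
  simp only [Nat.succ_ne_self, if_false, if_true, add_zero, add_eq_left, div_eq_zero_iff, hd1,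
    or_false] at h2
  exact h2

theorem HasPowerExpansion.logExpansion {κ : Tensor2 d S} {b : ℕ → Tensor2 d S} {y : S}
    {v w : TangentSpace (𝓡 d) y}
    (hb : (fun x : ℝ => (h x).inner y v w - (∑ k ∈ Finset.range (d + 1), x ^ k * b k y v w +
        x ^ (d + 1) / ((d : ℝ) + 1) * κ y v w))
      =o[𝓝[>] 0] fun x => x ^ (d + 1)) :
    LogExpansion (d + 1) (fun x => (h x).inner y v w) fun k =>
      Polynomial.C (if k = d + 1 then κ y v w / ((d : ℝ) + 1) else b k y v w) := by
  refine IsLittleO.congr_left hb fun x => ?_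
  rw [Finset.sum_range_succ _ (d + 1)]
  dsimp only
  rw [if_pos rfl, Polynomial.eval_C]
  congr 2
  · refine Finset.sum_congr rfl fun k hk => ?_
    rw [if_neg (Finset.mem_range.1 hk).ne, Polynomial.eval_C]
  · ring

/-- The existence of an expansion in pure powers forces all logarithmic coefficients through order
`d + 1` to vanish, by uniqueness. The parity argument then applies to the odd order `d + 1`, without
any curvature condition on the metric at infinity. -/
theorem HasPowerExpansion.eq_zero (hd : 2 ≤ d) (hde : Even d) (hnf : IsNormalForm g ε Φ h)
    (hreg : IsPolyhomogeneous (d + 1) h) (hE : IsPoincareEinsteinToOrder g Φ (d + 2))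
    {κ : Tensor2 d S} (hκ : HasPowerExpansion h κ) : κ = 0 := by
  obtain ⟨L, a, ha00, ha0, ha⟩ := hreg.exists_hasChartExpansion
  obtain ⟨b, hb⟩ := hκ
  have hd1 : (d : ℝ) + 1 ≠ 0 := by positivity
  have h1 : ∀ (y : S) (v w : TangentSpace (𝓡 d) y), ∀ k ≤ d + 1, ∀ l ≤ L,
      a k l y v w = if l = 0 then
        (if k = d + 1 then κ y v w / ((d : ℝ) + 1) else b k y v w) else 0 := by
    intro y v w k hk l hl
    have h2 := (ha _ (IsManifold.chart_mem_maximalAtlas y)).inner hnf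
      (IsManifold.chart_mem_maximalAtlas y) (mem_chart_source _ y) v w
    exact eq_of_logPoly_eq_C (h2.unique (HasPowerExpansion.logExpansion (hb y v w)) k hk) hl
  have h2 : a (d + 1) 0 = 0 := tensor_eq_of_comps_eq fun φ hφ u hu i j =>
    comps_odd hd hde (ha φ hφ) ha00 ha0 hnf hE hφ
      (fun k hk l hl hl0 v _ p q => (h1 _ _ _ k hk l hl).trans (if_neg hl0)) le_rfl
      hde.add_one hu i j
  funext y
  ext v w
  have h3 := h1 y v w (d + 1) le_rfl 0 (Nat.zero_le _)
  rw [h2, if_pos rfl, if_pos rfl] at h3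
  exact (div_eq_zero_iff.1 h3.symm).resolve_right hd1

end Mass

end WangMass

end

/-! ### Both statements about the mass. -/

open WangMass in
theorem proposition2p7 (d : ℕ) (hd : 2 ≤ d)
    {M : Type*} [TopologicalSpace M] [ChartedSpace (Model (d + 1)) M]
    [IsManifold (𝓡 (d + 1)) ∞ M]
    {S : Type*} [TopologicalSpace S] [ChartedSpace (Model d) S] [IsManifold (𝓡 d) ∞ S]
    [T2Space S] [CompactSpace S] [MeasurableSpace S] [BorelSpace S]
    (g : Metric (d + 1) M) (ε : ℝ) (Φ : OpenPartialHomeomorph (ℝ × S) M) (h : ℝ → Metric d S)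
    (hnf : IsNormalForm g ε Φ h) (hreg : IsPolyhomogeneous (d + 1) h)
    (hE : IsPoincareEinsteinToOrder g Φ (d + 2))
    (h₀ : Metric d S) (lam : ℝ) (hein : IsEinstein h₀ (((d : ℝ) - 1) * lam))
    (hconf : IsConformal (h 0) h₀) :
    (h 0 = h₀ →
      (∃ θ κ : Tensor2 d S, HasEinsteinExpansion h h₀ lam θ κ) ∧
      ∀ θ κ : Tensor2 d S, HasEinsteinExpansion h h₀ lam θ κ →
        κ = 0 ∧ massIntegral h₀ κ = 0) ∧
    (Odd (d + 1) → ∀ κ : Tensor2 d S, HasPowerExpansion h κ →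
      (∀ y, metricTrace (h 0) κ y = 0) ∧ massIntegral (h 0) κ = 0) := by
  refine ⟨fun h0 => ⟨exists_hasEinsteinExpansion hd hein h0 hnf hreg hE, fun θ κ hκ => ?_⟩,
    fun hodd κ hκ => ?_⟩
  · obtain rfl := HasEinsteinExpansion.eq_zero hd hein h0 hnf hreg hE hκ
    exact ⟨rfl, massIntegral_zero h₀⟩
  · have hde : Even d := by
      rw [← Nat.not_odd_iff_even]
      exact fun hdo => (Nat.not_even_iff_odd.2 hodd) hdo.add_one
    obtain rfl := HasPowerExpansion.eq_zero hd hde hnf hreg hE hκ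
    exact ⟨metricTrace_zero _, massIntegral_zero _⟩
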